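/- Setting. Draw the triangular lattice with vertical unit edges. Let $R$ be a finite set of its unit triangles that can be tiled by lozenges (unions of two adjacent triangles); $R$ need not be simply connected, nor connected. In a tiling $T$ of $R$, the non-horizontal lozenges (those with two vertical sides) form disjoint left-to-right lattice paths through midpoints of vertical edges, where each step raises or lowers the height by $1/2$. A path starts at each vertical edge with only its right triangle in $R$ and ends at an edge with only its left triangle in $R$. The width $w$ of $R$ is the horizontal distance, in steps, from the leftmost start to the rightmost end of a path. A site is an internal point of a path, i.e. a pair (path, position strictly between its endpoints). A local move pushes one point of one path up or down by one unit, so that the result is again a tiling of $R$. Let $C$ be a connected component of the set of tilings of $R$ under local moves (for a simply connected region with at least one tiling there is only one); all tilings in $C$ have the same sites, and $p$ is their number. The Luby–Randall–Sinclair chain on $C$: pick a uniformly random site and, independently, a direction (up or down, probability $1/2$ each) and a uniform $r\in[0,1]$. If the path has a local minimum (for up; a local maximum for down) at the site, and exactly $k\ge 0$ further paths, stacked directly above (below) it, block its movement, and the outermost of these $k+1$ paths is free to move within $R$, then push all $k+1$ points by one unit if $r\le 1/(k+1)$; in all other cases do nothing. The grand coupling uses the same site (same position on the same path), the same direction and the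 same $r$ for all initial tilings; the steps are independent. Theorem. (a) For every $\delta>0$ there is $W$ such that for every such $R$ of width $w\ge W$ and every component $C$ as above: $C$ has a bottom tiling $\hat 0$ and a top tiling $\hat 1$ (every path of every tiling in $C$ lies weakly between the corresponding paths of $\hat 0$ and $\hat 1$), and, if $m$ is the least number of local moves leading from $\hat 0$ to $\hat 1$, then for every $\varepsilon>0$ and every integer $t\ge 0$ with $$t\ \ge\ \frac{2+\delta}{\pi^2}\,p\,w^2\log\frac m\varepsilon$$ (nothing being required of $t$ if $m=0$), the probability that the copies of the chain started at all the tilings in $C$ (in particular those started at $\hat 0$ and $\hat 1$) have not all coalesced after $t$ steps is at most $\varepsilon$. In other words, coalescence occurs except with probability $\varepsilon$ after $\frac{2+o(1)}{\pi^2}p w^2\log\frac m\varepsilon$ steps, where the $o(1)$ is a function of $w$ alone and tends to $0$ as $w\to\infty$. (b) Let $R$ be the regular hexagon of side length $\ell$ with two vertical sides. For every $\delta>0$ and $\varepsilon>0$ there is $L$ such that for all $\ell\ge L$ and all integers $t\ge\left(\frac{48}{\pi^2}+\delta\right)\ell^4\log\ell$, except with probability at most $\varepsilon$ the copies of the chain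 started at all the tilings of $R$ have coalesced after $t$ steps; moreover, for any two initial tilings the distributions of the chain after $t$ steps differ by at most $\varepsilon$ in total variation distance. -/

import Mathlib

open MeasureTheory ProbabilityTheory

noncomputable section

/-!
Conventions.  The triangular lattice is drawn with one of its three edge directions vertical.  A
vertical unit edge is a pair `(x, u)` of integers: it lies on the `x`-th vertical line and its
midpoint has height `u - x / 2` (so every pair occurs, and consecutive vertical lines are shifted by
one half).  Each triangle has exactly one vertical side.
-/

namespace Lozenges

/-- A vertical unit edge `(x, u)` of the triangular lattice: column `x`, height `u - x / 2`. -/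
abbrev Edge := ℤ × ℤ

/-- A unit triangle of the lattice, named by its vertical side `(x, u)`; `left x u` is the triangle
to the left of this side, `right x u` the triangle to the right of it. -/
inductive Triangle
  | left (x u : ℤ)
  | right (x u : ℤ)
  deriving DecidableEq

/-- The vertical side of a triangle. -/
def Triangle.edge : Triangle → Edge
  | .left x u => (x, u)
  | .right x u => (x, u)

/-- A lozenge.  `horiz x u` consists of the two triangles on both sides of the vertical edge
`(x, u)`.  The other two types have two vertical sides, `(x, u)` on the left and a side in column
`x + 1` on the right, one half higher for `up x u`, and one half lower for `down x u`; they are the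
ascending and the descending steps of the lattice paths. -/
inductive Lozenge
  | horiz (x u : ℤ)
  | up (x u : ℤ)
  | down (x u : ℤ)
  deriving DecidableEq

/-- The two triangles of a lozenge. -/
def Lozenge.cells : Lozenge → Finset Triangle
  | .horiz x u => {.left x u, .right x u}
  | .up x u => {.right x u, .left (x + 1) (u + 1)}
  | .down x u => {.right x u, .left (x + 1) u}

/-- A region is a finite set of triangles. -/
abbrev Region := Finset Triangle

/-- A configuration is a finite set of lozenges. -/
abbrev Config := Finset Lozenge

/-- `T` is a lozenge tiling of the region `R`. -/
def IsTiling (R : Region) (T : Config) : Prop :=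
  (∀ l ∈ T, l.cells ⊆ R) ∧ ∀ t ∈ R, ∃! l, l ∈ T ∧ t ∈ l.cells

/-! ### Lattice paths -/

/-- The edges where a lattice path starts: region on the right side only. -/
def starts (R : Region) : Finset Edge :=
  (R.image Triangle.edge).filter fun e => .right e.1 e.2 ∈ R ∧ .left e.1 e.2 ∉ R

/-- The edges where a lattice path ends: region on the left side only. -/
def ends (R : Region) : Finset Edge :=
  (R.image Triangle.edge).filter fun e => .left e.1 e.2 ∈ R ∧ .right e.1 e.2 ∉ R

/-- The width: the horizontal distance between the leftmost start of a path and the rightmost end of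
a path (`0` if there are no paths). -/
def width (R : Region) : ℕ :=
  (starts R ×ˢ ends R).sup fun q => (q.2.1 - q.1.1).toNat

/-- The height coordinate, after `n` steps, of the lattice path of `T` that starts at `s`: its `n`-th
point is the edge `(s.1 + n, height T s n)`. -/
def height (T : Config) (s : Edge) : ℕ → ℤ
  | 0 => s.2
  | n + 1 => if Lozenge.up (s.1 + n) (height T s n) ∈ T then height T s n + 1 else height T s n

/-- The number of steps of the lattice path of `T` that starts at `s`: the path ends at the first
edge that has no triangle of the region to its right. -/
def length (R : Region) (T : Config) (s : Edge) : ℕ :=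
  sInf {n | Triangle.right (s.1 + n) (height T s n) ∉ R}

/-- The sites `(s, n)`: the internal points (number `n`, neither the first nor the last) of the
lattice paths (starting at `s`) of `T`. -/
def sites (R : Region) (T : Config) : Finset (Edge × ℕ) :=
  (starts R).biUnion fun s => {s} ×ˢ Finset.Ioo 0 (length R T s)

/-- Each path of `S` lies weakly below the corresponding path of `T`. -/
def Below (R : Region) (S T : Config) : Prop :=
  ∀ s ∈ starts R, ∀ n ≤ length R S s, height S s n ≤ height T s n

/-! ### Local moves -/

/-- Push a lattice path up by one unit at the edge `(x, u)`, where it has a local minimum: rotate the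
three lozenges of the unit hexagon centred at the upper end of this edge. -/
def flipUp (T : Config) (x u : ℤ) : Config :=
  (T \ {.down (x - 1) u, .up x u, .horiz x (u + 1)}) ∪ {.up (x - 1) u, .down x (u + 1), .horiz x u}

/-- Push a lattice path down by one unit at the edge `(x, u)`, where it has a local maximum. -/
def flipDown (T : Config) (x u : ℤ) : Config :=
  (T \ {.up (x - 1) (u - 1), .down x u, .horiz x (u - 1)}) ∪
    {.down (x - 1) (u - 1), .up x (u - 1), .horiz x u}

/-- The tiling `S` of `R` becomes the tiling `T` of `R` by pushing one point of one lattice path up by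
one unit. -/
def LocalUp (R : Region) (S T : Config) : Prop :=
  IsTiling R S ∧ IsTiling R T ∧ ∃ x u : ℤ, ({.down (x - 1) u, .up x u, .horiz x (u + 1)} : Config) ⊆ S ∧ T = flipUp S x u

/-- The graph of local moves (in both directions) between tilings of `R`. -/
def moveGraph (R : Region) : SimpleGraph Config := SimpleGraph.fromRel (LocalUp R)

/-- The connected component of the tiling `T₀` in the space of tilings of `R`. -/
def component (R : Region) (T₀ : Config) : Set Config := {T | (moveGraph R).Reachable T₀ T}

/-! ### The chain with tower moves -/

/-- The path through `(x, u)` has a local minimum there, its upward movement is blocked by exactly `k`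
further paths (which pass, also with a local minimum, through the `k` edges above it), and the
uppermost of these `k + 1` paths is free to move up. -/
def IsTowerUp (T : Config) (x u : ℤ) (k : ℕ) : Prop :=
  (∀ j : ℕ, j ≤ k → .down (x - 1) (u + j) ∈ T ∧ .up x (u + j) ∈ T) ∧ .horiz x (u + k + 1) ∈ T

/-- The path through `(x, u)` has a local maximum there, its downward movement is blocked by exactly
`k` further paths, and the lowest of these `k + 1` paths is free to move down. -/
def IsTowerDown (T : Config) (x u : ℤ) (k : ℕ) : Prop :=
  (∀ j : ℕ, j ≤ k → .up (x - 1) (u - j - 1) ∈ T ∧ .down x (u - j) ∈ T) ∧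
    .horiz x (u - k - 1) ∈ T

/-- Push up the `k + 1` paths through `(x, u), …, (x, u + k)`, the uppermost first. -/
def towerUp (T : Config) (x u : ℤ) : ℕ → Config
  | 0 => flipUp T x u
  | k + 1 => towerUp (flipUp T x (u + (k + 1))) x u k

/-- Push down the `k + 1` paths through `(x, u), …, (x, u - k)`, the lowest first. -/
def towerDown (T : Config) (x u : ℤ) : ℕ → Config
  | 0 => flipDown T x u
  | k + 1 => towerDown (flipDown T x (u - (k + 1))) x u k

open Classical in
/-- Attempt to push up the path through `(x, u)`; the number `r` decides whether a tower of `k + 1`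
paths is moved, and if `r` is uniform in `[0, 1]` this happens with probability `1 / (k + 1)`. -/
def pushUp (r : unitInterval) (T : Config) (x u : ℤ) : Config :=
  if h : ∃ k, IsTowerUp T x u k ∧ (r : ℝ) ≤ 1 / ((k : ℝ) + 1) then towerUp T x u h.choose else T

open Classical in
/-- Attempt to push down the path through `(x, u)`. -/
def pushDown (r : unitInterval) (T : Config) (x u : ℤ) : Config :=
  if h : ∃ k, IsTowerDown T x u k ∧ (r : ℝ) ≤ 1 / ((k : ℝ) + 1) then towerDown T x u h.choose else T

/-- The random choices of one step: a site of one of the paths, a direction (`true` is up), and a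
number in `[0, 1]`.  The sites are those of the reference tiling `T₀`; all tilings in the component
of `T₀` have the same sites. -/
abbrev Update (R : Region) (T₀ : Config) := ({q // q ∈ sites R T₀} × Bool) × unitInterval

/-- The distribution of the random choices of one step: site and direction uniform, and
independently a uniform number in `[0, 1]`. -/
def updateLaw (R : Region) (T₀ : Config) : Measure (Update R T₀) :=
  (uniformOn (Set.univ : Set ({q // q ∈ sites R T₀} × Bool))).prod (volume : Measure unitInterval)

/-- The random map of one step: the path starting at `s` is pushed at its `n`-th point. -/
def step {R : Region} {T₀ : Config} (a : Update R T₀) (T : Config) : Config :=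
  let s : Edge := a.1.1.1.1
  let n : ℕ := a.1.1.1.2
  bif a.1.2 then pushUp a.2 T (s.1 + n) (height T s n)
  else pushDown a.2 T (s.1 + n) (height T s n)

/-- The state at time `t` of the copy of the chain started at `T`, with the random choices `ω`. -/
def run {R : Region} {T₀ : Config} : (t : ℕ) → (Fin t → Update R T₀) → Config → Config
  | 0, _, T => T
  | t + 1, ω, T => step (ω (Fin.last t)) (run t (fun i => ω i.castSucc) T)

/-- The distribution of the random choices of `t` steps: independent choices with distribution
`updateLaw`. -/
def runLaw (R : Region) (T₀ : Config) (t : ℕ) : Measure (Fin t → Update R T₀) :=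
  Measure.pi fun _ => updateLaw R T₀

/-- The random choices of `t` steps for which the copies of the chain started at the states in `C`
have not all coalesced. -/
def notCoalesced (R : Region) (T₀ : Config) (C : Set Config) (t : ℕ) :
    Set (Fin t → Update R T₀) :=
  {ω | ∃ S ∈ C, ∃ T ∈ C, run t ω S ≠ run t ω T}

/-! ### The hexagon -/

/-- The vertical edges in the regular hexagon of side `ℓ`, the boundary included. -/
def hexEdges (ℓ : ℕ) : Finset Edge :=
  (Finset.Icc (0 : ℤ) (2 * ℓ) ×ˢ Finset.Ico (0 : ℤ) (2 * ℓ)).filter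
    fun e => -(ℓ : ℤ) ≤ e.2 - e.1 ∧ e.2 - e.1 < ℓ

/-- The regular hexagon of side `ℓ`, with two vertical sides: the left one in column `0`, the
right one in column `2 * ℓ`. -/
def hexagon (ℓ : ℕ) : Region :=
  ((hexEdges ℓ).filter fun e => e.1 < 2 * (ℓ : ℤ)).image (fun e => Triangle.right e.1 e.2) ∪
    ((hexEdges ℓ).filter fun e => 0 < e.1).image (fun e => Triangle.left e.1 e.2)

end Lozenges

end

namespace Lozenges

/-! ### Tilings -/

section Tilings

variable {R : Region} {T : Config} {x u : ℤ}

/-! The copies of the chain are compared through a weighted sum of height differences that contracts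
in expectation. A tower of `k + 1` paths in column `x` moves with probability `1 / (k + 1)`, so an
attempted push changes the expected sum of `w (col q) * ht T q` by `± w x` or by 0, whatever `k` is
(`Space.integral_pushUp`). Unless the boundary blocks a move, the drift at a site is therefore the
discrete Laplacian of the height along its path, as if the paths did not interact. Blocking does no
harm: a local minimum of the lower tiling without a tower lies in a stack of paths pinned by the
boundary, and every higher compatible tiling has the same blocked minimum there (`Compat.blocked`).
This gives `Compat.drift_le`. Summation by parts moves the Laplacian onto the weights, so that any
weight function with averages at most `(1 - lam) * w` gives a contraction by `1 - lam / p` in each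
step (`Space.lintegral_step_le`).

The grand coupling is monotone (`Space.step_below`): where two ordered tilings agree at a point that
the lower one pushes up, the upper one has a tower that is no larger, hence is accepted with the
same `r`. All copies thus stay between those started at the bottom and the top. Heights are
integers, so with weights at least 1 Markov's inequality bounds the probability of non-coalescence
(`notCoalesced_le`).

In a strip of width `w` a cosine of frequency slightly below `π / w` is a suitable weight, with
`lam` about `π ^ 2 / (2 * w ^ 2)`; being bounded away from 0 on the strip, it costs only a constant
factor `K` (`exists_notCoalesced_le_exp`). If `log (m / ε)` is large, the slack `δ` absorbs `K`.
Otherwise `m` is bounded, the top and the bottom differ in at most `m` columns, and a parabola in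
the rank of these columns contracts at rate `1 / m ^ 2`, which is ample for large `w`
(`notCoalesced_le_rank`). This is how the error term comes to depend on `w` alone.

Components are handled through the invariant `Compat`: same endpoints, same vertical order, no hole
between corresponding points. Flips preserve it, and a tiling that is not above some compatible
tiling can be flipped up (`exists_flippable`), so all compatible tilings climb to a common top and
form exactly one component (`component_eq`). Statements about downward moves follow by reflection.
In the hexagon all tilings are compatible; `p ≤ 2 * ℓ ^ 2`, width `2 * ℓ` and a total height
difference of order `ℓ ^ 3` give the constant `48 / π ^ 2`. -/

theorem IsTiling.eq_of_mem (hT : IsTiling R T) {l l' : Lozenge} {t : Triangle} (hl : l ∈ T)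
    (hl' : l' ∈ T) (ht : t ∈ l.cells) (ht' : t ∈ l'.cells) : l = l' :=
  (hT.2 t (hT.1 l hl ht)).unique ⟨hl, ht⟩ ⟨hl', ht'⟩

theorem IsTiling.cover_right (hT : IsTiling R T) (h : .right x u ∈ R) :
    .horiz x u ∈ T ∨ .up x u ∈ T ∨ .down x u ∈ T := by
  obtain ⟨l, ⟨hl, hc⟩, -⟩ := hT.2 _ h
  cases l <;> simp [Lozenge.cells] at hc <;> obtain ⟨rfl, rfl⟩ := hc <;> simp [hl]

theorem IsTiling.cover_left (hT : IsTiling R T) (h : .left x u ∈ R) :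
    .horiz x u ∈ T ∨ .up (x - 1) (u - 1) ∈ T ∨ .down (x - 1) u ∈ T := by
  obtain ⟨l, ⟨hl, hc⟩, -⟩ := hT.2 _ h
  cases l <;> simp [Lozenge.cells] at hc <;> obtain ⟨rfl, rfl⟩ := hc <;> simp [hl]

theorem IsTiling.horiz_mem (hT : IsTiling R T) (h : .horiz x u ∈ T) :
    .left x u ∈ R ∧ .right x u ∈ R :=
  ⟨hT.1 _ h (by simp [Lozenge.cells]), hT.1 _ h (by simp [Lozenge.cells])⟩

theorem IsTiling.up_mem (hT : IsTiling R T) (h : .up x u ∈ T) :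
    .right x u ∈ R ∧ .left (x + 1) (u + 1) ∈ R :=
  ⟨hT.1 _ h (by simp [Lozenge.cells]), hT.1 _ h (by simp [Lozenge.cells])⟩

theorem IsTiling.down_mem (hT : IsTiling R T) (h : .down x u ∈ T) :
    .right x u ∈ R ∧ .left (x + 1) u ∈ R :=
  ⟨hT.1 _ h (by simp [Lozenge.cells]), hT.1 _ h (by simp [Lozenge.cells])⟩

theorem IsTiling.not_horiz_of_up (hT : IsTiling R T) (h : .up x u ∈ T) : .horiz x u ∉ T :=
  fun h' => by
    simpa using hT.eq_of_mem (t := .right x u) h h' (by simp [Lozenge.cells])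
      (by simp [Lozenge.cells])

theorem IsTiling.not_horiz_of_down (hT : IsTiling R T) (h : .down x u ∈ T) : .horiz x u ∉ T :=
  fun h' => by
    simpa using hT.eq_of_mem (t := .right x u) h h' (by simp [Lozenge.cells])
      (by simp [Lozenge.cells])

theorem IsTiling.not_down_of_up (hT : IsTiling R T) (h : .up x u ∈ T) : .down x u ∉ T :=
  fun h' => by
    simpa using hT.eq_of_mem (t := .right x u) h h' (by simp [Lozenge.cells])
      (by simp [Lozenge.cells])

theorem IsTiling.not_horiz_of_up' (hT : IsTiling R T) (h : .up (x - 1) (u - 1) ∈ T) :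
    .horiz x u ∉ T := fun h' => by
  simpa using hT.eq_of_mem (t := .left x u) h h' (by simp [Lozenge.cells])
    (by simp [Lozenge.cells])

theorem IsTiling.not_horiz_of_down' (hT : IsTiling R T) (h : .down (x - 1) u ∈ T) :
    .horiz x u ∉ T := fun h' => by
  simpa using hT.eq_of_mem (t := .left x u) h h' (by simp [Lozenge.cells])
    (by simp [Lozenge.cells])

theorem IsTiling.not_down_of_up' (hT : IsTiling R T) (h : .up (x - 1) (u - 1) ∈ T) :
    .down (x - 1) u ∉ T := fun h' => by
  simpa using hT.eq_of_mem (t := .left x u) h h' (by simp [Lozenge.cells])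
    (by simp [Lozenge.cells])

/-- Both triangles next to the edge `(x, u)` belong to the region. -/
def Interior (R : Region) (x u : ℤ) : Prop := .left x u ∈ R ∧ .right x u ∈ R

/-- The path through `(x, u)` has a local minimum there. -/
def LocMin (T : Config) (x u : ℤ) : Prop := .down (x - 1) u ∈ T ∧ .up x u ∈ T

/-- The path through `(x, u)` has a local maximum there. -/
def LocMax (T : Config) (x u : ℤ) : Prop := .up (x - 1) (u - 1) ∈ T ∧ .down x u ∈ T

theorem IsTiling.interior_of_locMin (hT : IsTiling R T) (h : LocMin T x u) : Interior R x u :=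
  ⟨by simpa using (hT.down_mem h.1).2, (hT.up_mem h.2).1⟩

/-- A path directly above a local minimum has a local minimum. -/
theorem IsTiling.locMin_succ (hT : IsTiling R T) (h : LocMin T x u) (hi : Interior R x (u + 1))
    (hh : .horiz x (u + 1) ∉ T) : LocMin T x (u + 1) := by
  constructor
  · rcases hT.cover_left hi.1 with h1 | h1 | h1
    · exact absurd h1 hh
    · rw [add_sub_cancel_right] at h1
      exact absurd h.1 (hT.not_down_of_up h1)
    · exact h1
  · rcases hT.cover_right hi.2 with h1 | h1 | h1
    · exact absurd h1 hh
    · exact h1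
    · have := hT.eq_of_mem (t := .left (x + 1) (u + 1)) h.2 h1 (by simp [Lozenge.cells])
        (by simp [Lozenge.cells])
      simp at this

end Tilings

/-! ### Lattice paths -/

section Paths

variable {R : Region} {T : Config} {s : Edge} {n : ℕ}

theorem mem_starts {e : Edge} : e ∈ starts R ↔ .right e.1 e.2 ∈ R ∧ .left e.1 e.2 ∉ R := by
  simp only [starts, Finset.mem_filter, Finset.mem_image, and_iff_right_iff_imp]
  exact fun h => ⟨_, h.1, rfl⟩

theorem mem_ends {e : Edge} : e ∈ ends R ↔ .left e.1 e.2 ∈ R ∧ .right e.1 e.2 ∉ R := by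
  simp only [ends, Finset.mem_filter, Finset.mem_image, and_iff_right_iff_imp]
  exact fun h => ⟨_, h.1, rfl⟩

theorem mem_sites {q : Edge × ℕ} :
    q ∈ sites R T ↔ q.1 ∈ starts R ∧ 0 < q.2 ∧ q.2 < length R T q.1 := by
  obtain ⟨s, n⟩ := q
  simp [sites]

theorem exists_right_notMem (R : Region) (T : Config) (s : Edge) :
    ∃ n : ℕ, Triangle.right (s.1 + n) (height T s n) ∉ R := by
  by_contra! h
  exact Set.infinite_of_injective_forall_mem (s := (R : Set Triangle))
    (f := fun n : ℕ => Triangle.right (s.1 + n) (height T s n))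
    (fun a b hab => by simpa using (Triangle.right.inj hab).1) h R.finite_toSet

theorem right_mem (hn : n < length R T s) : .right (s.1 + n) (height T s n) ∈ R := by
  have := Nat.notMem_of_lt_sInf hn
  simpa using this

theorem right_length_notMem : .right (s.1 + (length R T s : ℕ)) (height T s (length R T s)) ∉ R :=
  Nat.sInf_mem (s := {n : ℕ | Triangle.right (s.1 + n) (height T s n) ∉ R})
    (exists_right_notMem R T s)

theorem length_eq {L : ℕ} (h : ∀ n < L, .right (s.1 + n) (height T s n) ∈ R)
    (h' : .right (s.1 + L) (height T s L) ∉ R) : length R T s = L := by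
  rcases lt_trichotomy (length R T s) L with h1 | h1 | h1
  · exact absurd (h _ h1) right_length_notMem
  · exact h1
  · exact absurd (right_mem h1) h'

theorem length_pos (hs : s ∈ starts R) : 0 < length R T s := by
  by_contra! h
  have h0 : length R T s = 0 := by omega
  have := right_length_notMem (R := R) (T := T) (s := s)
  rw [h0] at this
  simp only [height] at this
  exact this (by simpa using (mem_starts.1 hs).1)

theorem height_succ_of_up (h : .up (s.1 + n) (height T s n) ∈ T) :
    height T s (n + 1) = height T s n + 1 := by
  simp [height, h]

theorem height_succ_of_not_up (h : .up (s.1 + n) (height T s n) ∉ T) :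
    height T s (n + 1) = height T s n := by
  simp [height, h]

/-- The lozenge by which a path arrives already covers the triangle to the left of the edge reached;
at the start that triangle is not in the region. -/
theorem IsTiling.horiz_notMem (hT : IsTiling R T) (hs : s ∈ starts R) (hn : n ≤ length R T s) :
    .horiz (s.1 + n) (height T s n) ∉ T := by
  induction n with
  | zero =>
    intro h
    exact (mem_starts.1 hs).2 (by simpa [height] using (hT.horiz_mem h).1)
  | succ n ih =>
    have h1 := ih (by omega)
    rcases hT.cover_right (right_mem (n := n) hn) with h | h | h
    · exact absurd h h1
    · rw [height_succ_of_up h]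
      apply hT.not_horiz_of_up'
      convert h using 2
      · push_cast; ring
      · ring
    · rw [height_succ_of_not_up fun h' => hT.not_down_of_up h' h]
      apply hT.not_horiz_of_down'
      convert h using 2
      push_cast; ring

/-- A lattice path ascends or descends in each step. -/
theorem IsTiling.height_step (hT : IsTiling R T) (hs : s ∈ starts R) (hn : n < length R T s) :
    .up (s.1 + n) (height T s n) ∈ T ∧ height T s (n + 1) = height T s n + 1 ∨
      .down (s.1 + n) (height T s n) ∈ T ∧ height T s (n + 1) = height T s n := by
  rcases hT.cover_right (right_mem hn) with h | h | h
  · exact absurd h (hT.horiz_notMem hs hn.le)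
  · exact Or.inl ⟨h, height_succ_of_up h⟩
  · exact Or.inr ⟨h, height_succ_of_not_up fun h' => hT.not_down_of_up h' h⟩

theorem IsTiling.left_mem (hT : IsTiling R T) (hs : s ∈ starts R) (h0 : 0 < n)
    (hn : n ≤ length R T s) : .left (s.1 + n) (height T s n) ∈ R := by
  obtain ⟨n, rfl⟩ := Nat.exists_eq_succ_of_ne_zero h0.ne'
  rcases hT.height_step hs (n := n) hn with h | h
  · rw [Nat.succ_eq_add_one, h.2]
    push_cast
    rw [← add_assoc]
    exact (hT.up_mem h.1).2
  · rw [Nat.succ_eq_add_one, h.2]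
    push_cast
    rw [← add_assoc]
    exact (hT.down_mem h.1).2

/-- Lattice paths are disjoint. -/
theorem IsTiling.path_unique (hT : IsTiling R T) {s' : Edge} {n' : ℕ} (hs : s ∈ starts R)
    (hs' : s' ∈ starts R) (hn : n ≤ length R T s) (hn' : n' ≤ length R T s')
    (hx : s.1 + n = s'.1 + n') (hu : height T s n = height T s' n') : s = s' ∧ n = n' := by
  induction n generalizing n' with
  | zero =>
    rcases Nat.eq_zero_or_pos n' with rfl | h0
    · exact ⟨Prod.ext (by simpa using hx) hu, rfl⟩
    · have := hT.left_mem hs' h0 hn'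
      rw [← hx, ← hu] at this
      exact absurd (by simpa [height] using this) (mem_starts.1 hs).2
  | succ n ih =>
    cases n' with
    | zero =>
      have := hT.left_mem hs n.succ_pos hn
      rw [hx, hu] at this
      exact absurd (by simpa [height] using this) (mem_starts.1 hs').2
    | succ n' =>
      have hx' : s.1 + (n : ℤ) = s'.1 + n' := by push_cast at hx; linarith
      -- Two paths that meet cannot arrive from different edges: an ascending and a descending
      -- lozenge would cover the same left triangle. So they were already together one column
      -- earlier.
      have key : height T s n = height T s' n' := by
        rcases hT.height_step hs (n := n) hn with h | h <;>
          rcases hT.height_step hs' (n := n') hn' with h' | h'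
        · linarith [h.2, h'.2]
        · have := hT.eq_of_mem (t := .left (s.1 + n + 1) (height T s n + 1)) h.1 h'.1
            (by simp [Lozenge.cells])
            (by simp [Lozenge.cells, hx']; linarith [h.2, h'.2])
          simp at this
        · have := hT.eq_of_mem (t := .left (s.1 + n + 1) (height T s n)) h.1 h'.1
            (by simp [Lozenge.cells])
            (by simp [Lozenge.cells, hx']; linarith [h.2, h'.2])
          simp at this
        · linarith [h.2, h'.2]
      obtain ⟨h1, h2⟩ := ih (by omega) (by omega) hx' key
      exact ⟨h1, by omega⟩

/-- The column of a site. -/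
def col (q : Edge × ℕ) : ℤ := q.1.1 + q.2

/-- The height coordinate of a site in a tiling. -/
def ht (T : Config) (q : Edge × ℕ) : ℤ := height T q.1 q.2

/-- The path through an edge is traced backwards: the lozenge covering the left triangle leads one
column to the left. The region is bounded on the left by `B`, so this stops, and it can stop only at
an edge whose left triangle is missing, that is, at a start. -/
theorem IsTiling.exists_path (hT : IsTiling R T) {x u : ℤ} (hh : .horiz x u ∉ T)
    (h : .right x u ∈ R ∨ .left x u ∈ R) :
    ∃ s ∈ starts R, ∃ n ≤ length R T s, s.1 + n = x ∧ height T s n = u := by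
  obtain ⟨B, hB⟩ : ∃ B : ℤ, ∀ t ∈ R, B ≤ t.edge.1 := by
    rcases (R.image fun t => t.edge.1).eq_empty_or_nonempty with h0 | h0
    · refine ⟨0, fun t ht => ?_⟩
      rw [Finset.image_eq_empty] at h0
      simp [h0] at ht
    · exact ⟨(R.image fun t => t.edge.1).min' h0, fun t ht =>
        Finset.min'_le _ _ (Finset.mem_image_of_mem (fun t => t.edge.1) ht)⟩
  have main : ∀ k : ℕ, ∀ x u : ℤ, x - B < k → .horiz x u ∉ T →
      (.right x u ∈ R ∨ .left x u ∈ R) →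
      ∃ s ∈ starts R, ∃ n ≤ length R T s, s.1 + n = x ∧ height T s n = u := by
    intro k
    induction k with
    | zero =>
      intro x u hx _ h
      rcases h with h | h <;> have := hB _ h <;> simp [Triangle.edge] at this <;>
        push_cast at hx <;> omega
    | succ k ih =>
      intro x u hx hh h
      by_cases hl : .left x u ∈ R
      · have step : ∀ v, .horiz (x - 1) v ∉ T → .right (x - 1) v ∈ R →
            (∀ s ∈ starts R, ∀ n : ℕ, n < length R T s → s.1 + n = x - 1 → height T s n = v →
              height T s (n + 1) = u) →
            ∃ s ∈ starts R, ∃ n ≤ length R T s, s.1 + n = x ∧ height T s n = u := by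
          intro v hv hr hstep
          obtain ⟨s, hs, n, hn, h1, h2⟩ := ih (x - 1) v (by push_cast at hx; omega) hv (Or.inl hr)
          have hlt : n < length R T s := by
            refine lt_of_le_of_ne hn fun h => ?_
            subst h
            exact right_length_notMem (h1 ▸ h2 ▸ hr)
          exact ⟨s, hs, n + 1, hlt, by push_cast; linarith, hstep s hs n hlt h1 h2⟩
        rcases hT.cover_left hl with h1 | h1 | h1
        · exact absurd h1 hh
        · refine step (u - 1) (hT.not_horiz_of_up h1) (hT.up_mem h1).1 fun s _ n _ h2 h3 => ?_
          rw [height_succ_of_up (by rw [h2, h3]; exact h1), h3]; ring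
        · refine step u (hT.not_horiz_of_down h1) (hT.down_mem h1).1 fun s _ n _ h2 h3 => ?_
          rw [height_succ_of_not_up (by rw [h2, h3]; exact fun h => hT.not_down_of_up h h1), h3]
      · have hr := h.resolve_right hl
        exact ⟨(x, u), mem_starts.2 ⟨hr, hl⟩, 0, Nat.zero_le _, by simp, rfl⟩
  exact main ((x - B).toNat + 1) x u (by push_cast; have := Int.self_le_toNat (x - B); omega) hh h

/-- An interior edge that is not in a horizontal lozenge is visited at a site. -/
theorem IsTiling.exists_site (hT : IsTiling R T) {x u : ℤ} (hh : .horiz x u ∉ T)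
    (h : Interior R x u) : ∃ q ∈ sites R T, col q = x ∧ ht T q = u := by
  obtain ⟨s, hs, n, hn, rfl, rfl⟩ := hT.exists_path hh (Or.inl h.2)
  refine ⟨(s, n), mem_sites.2 ⟨hs, ?_, ?_⟩, rfl, rfl⟩
  · refine Nat.pos_of_ne_zero ?_
    rintro rfl
    exact (mem_starts.1 hs).2 (by simpa [height] using h.1)
  · refine lt_of_le_of_ne hn fun hL => ?_
    dsimp only at hL
    rw [hL] at h
    exact right_length_notMem h.2

theorem mem_sites_of_interior (hs : s ∈ starts R)
    (hn : n ≤ length R T s) (h : Interior R (s.1 + n) (height T s n)) : (s, n) ∈ sites R T := by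
  refine mem_sites.2 ⟨hs, Nat.pos_of_ne_zero ?_, lt_of_le_of_ne hn fun hL => ?_⟩
  · rintro rfl
    exact (mem_starts.1 hs).2 (by simpa [height] using h.1)
  · dsimp only at hL
    rw [hL] at h
    exact right_length_notMem h.2

theorem IsTiling.interior_site (hT : IsTiling R T) {q : Edge × ℕ} (hq : q ∈ sites R T) :
    Interior R (col q) (ht T q) :=
  have h := mem_sites.1 hq
  ⟨hT.left_mem h.1 h.2.1 h.2.2.le, right_mem h.2.2⟩

theorem IsTiling.site_horiz_notMem (hT : IsTiling R T) {q : Edge × ℕ} (hq : q ∈ sites R T) :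
    .horiz (col q) (ht T q) ∉ T :=
  have h := mem_sites.1 hq
  hT.horiz_notMem h.1 h.2.2.le

theorem IsTiling.site_unique (hT : IsTiling R T) {q q' : Edge × ℕ} (hq : q ∈ sites R T)
    (hq' : q' ∈ sites R T) (hx : col q = col q') (hu : ht T q = ht T q') : q = q' := by
  have h := mem_sites.1 hq
  have h' := mem_sites.1 hq'
  obtain ⟨h1, h2⟩ := hT.path_unique h.1 h'.1 h.2.2.le h'.2.2.le hx hu
  exact Prod.ext h1 h2

/-- Consecutive columns are shifted by one half, so a descending step keeps the integer coordinate
and an ascending step raises it by one. -/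
theorem IsTiling.locMin_iff (hT : IsTiling R T) {q : Edge × ℕ} (hq : q ∈ sites R T) :
    LocMin T (col q) (ht T q) ↔
      height T q.1 (q.2 - 1) = ht T q ∧ height T q.1 (q.2 + 1) = ht T q + 1 := by
  obtain ⟨s, n⟩ := q
  obtain ⟨hs, h0, hn⟩ := mem_sites.1 hq
  simp only at hs h0 hn
  obtain ⟨n, rfl⟩ := Nat.exists_eq_succ_of_ne_zero h0.ne'
  simp only [LocMin, col, ht, Nat.succ_eq_add_one, Nat.add_sub_cancel]
  have e : s.1 + ((n + 1 : ℕ) : ℤ) - 1 = s.1 + n := by push_cast; ring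
  rw [e]
  have a := hT.height_step hs (n := n) (by omega)
  have b := hT.height_step hs (n := n + 1) hn
  constructor
  · rintro ⟨h1, h2⟩
    refine ⟨?_, height_succ_of_up h2⟩
    rcases a with a | a
    · rw [a.2] at h1
      exact absurd (by simpa [e] using h1)
        (hT.not_down_of_up' (x := s.1 + n + 1) (u := height T s n + 1) (by simpa using a.1))
    · exact a.2.symm
  · rintro ⟨h1, h2⟩
    constructor
    · rcases a with a | a
      · omega
      · rw [a.2]; exact a.1
    · rcases b with b | b
      · exact b.1
      · omega

theorem IsTiling.locMax_iff (hT : IsTiling R T) {q : Edge × ℕ} (hq : q ∈ sites R T) :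
    LocMax T (col q) (ht T q) ↔
      height T q.1 (q.2 - 1) = ht T q - 1 ∧ height T q.1 (q.2 + 1) = ht T q := by
  obtain ⟨s, n⟩ := q
  obtain ⟨hs, h0, hn⟩ := mem_sites.1 hq
  simp only at hs h0 hn
  obtain ⟨n, rfl⟩ := Nat.exists_eq_succ_of_ne_zero h0.ne'
  simp only [LocMax, col, ht, Nat.succ_eq_add_one, Nat.add_sub_cancel]
  have e : s.1 + ((n + 1 : ℕ) : ℤ) - 1 = s.1 + n := by push_cast; ring
  rw [e]
  have a := hT.height_step hs (n := n) (by omega)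
  have b := hT.height_step hs (n := n + 1) hn
  constructor
  · rintro ⟨h1, h2⟩
    refine ⟨?_, height_succ_of_not_up fun h => hT.not_down_of_up h h2⟩
    rcases a with a | a
    · rw [a.2]; ring
    · rw [a.2] at h1
      exact absurd (by simpa using a.1)
        (hT.not_down_of_up' (x := s.1 + n + 1) (u := height T s n) (by simpa using h1))
  · rintro ⟨h1, h2⟩
    constructor
    · rcases a with a | a
      · rw [a.2, add_sub_cancel_right]; exact a.1
      · omega
    · rcases b with b | b
      · omega
      · exact b.1

/-- The steps next to a site. -/
theorem IsTiling.site_steps (hT : IsTiling R T) {q : Edge × ℕ} (hq : q ∈ sites R T) :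
    (ht T q = height T q.1 (q.2 - 1) ∨ ht T q = height T q.1 (q.2 - 1) + 1) ∧
      (height T q.1 (q.2 + 1) = ht T q ∨ height T q.1 (q.2 + 1) = ht T q + 1) := by
  obtain ⟨s, n⟩ := q
  obtain ⟨hs, h0, hn⟩ := mem_sites.1 hq
  simp only at hs h0 hn
  obtain ⟨n, rfl⟩ := Nat.exists_eq_succ_of_ne_zero h0.ne'
  simp only [ht, Nat.succ_eq_add_one, Nat.add_sub_cancel]
  have a := hT.height_step hs (n := n) (by omega)
  have b := hT.height_step hs (n := n + 1) hn
  exact ⟨a.symm.imp And.right And.right, b.symm.imp And.right And.right⟩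

end Paths

/-! ### Flips -/

section Flips

variable {R : Region} {T : Config} {x u : ℤ}

/-- Replacing some lozenges of a tiling by other lozenges that cover the same triangles. -/
theorem IsTiling.exchange (hT : IsTiling R T) {A B : Config} (hA : A ⊆ T)
    (hcov : ∀ t, (∃ l ∈ A, t ∈ l.cells) ↔ ∃ l ∈ B, t ∈ l.cells)
    (hB : ∀ l ∈ B, ∀ l' ∈ B, ∀ t ∈ l.cells, t ∈ l'.cells → l = l') :
    IsTiling R ((T \ A) ∪ B) := by
  constructor
  · intro l hl
    rcases Finset.mem_union.1 hl with h | h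
    · exact hT.1 l (Finset.mem_sdiff.1 h).1
    · intro t ht
      obtain ⟨l', hl', ht'⟩ := (hcov t).2 ⟨l, h, ht⟩
      exact hT.1 l' (hA hl') ht'
  · intro t ht
    obtain ⟨l, ⟨hl, hlt⟩, -⟩ := hT.2 t ht
    by_cases hlA : l ∈ A
    · obtain ⟨l', hl', ht'⟩ := (hcov t).1 ⟨l, hlA, hlt⟩
      refine ⟨l', ⟨Finset.mem_union_right _ hl', ht'⟩, ?_⟩
      rintro l'' ⟨hl'', ht''⟩
      rcases Finset.mem_union.1 hl'' with h | h
      · have := hT.eq_of_mem (Finset.mem_sdiff.1 h).1 hl ht'' hlt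
        exact absurd (this ▸ hlA) (Finset.mem_sdiff.1 h).2
      · exact hB _ h _ hl' t ht'' ht'
    · refine ⟨l, ⟨Finset.mem_union_left _ (Finset.mem_sdiff.2 ⟨hl, hlA⟩), hlt⟩, ?_⟩
      rintro l'' ⟨hl'', ht''⟩
      rcases Finset.mem_union.1 hl'' with h | h
      · exact hT.eq_of_mem (Finset.mem_sdiff.1 h).1 hl ht'' hlt
      · obtain ⟨l', hl', ht'⟩ := (hcov t).2 ⟨l'', h, ht''⟩
        exact absurd (hT.eq_of_mem (hA hl') hl ht' hlt ▸ hl') hlA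

/-- The path through `(x, u)` has a local minimum there and is free to move up. -/
def Flippable (T : Config) (x u : ℤ) : Prop := LocMin T x u ∧ .horiz x (u + 1) ∈ T

theorem flippable_iff_subset :
    Flippable T x u ↔ ({.down (x - 1) u, .up x u, .horiz x (u + 1)} : Config) ⊆ T := by
  simp [Flippable, LocMin, Finset.insert_subset_iff, and_assoc]

theorem IsTiling.flip (hT : IsTiling R T) (h : Flippable T x u) :
    IsTiling R (flipUp T x u) := by
  refine hT.exchange (flippable_iff_subset.1 h) (fun t => ?_) ?_
  · simp [Lozenge.cells]
    tauto
  · simp [Lozenge.cells]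
    omega

theorem IsTiling.localUp (hT : IsTiling R T) (h : Flippable T x u) :
    LocalUp R T (flipUp T x u) :=
  ⟨hT, hT.flip h, x, u, flippable_iff_subset.1 h, rfl⟩

theorem up_mem_flipUp {y v : ℤ} :
    .up y v ∈ flipUp T x u ↔ .up y v ∈ T ∧ ¬ (y = x ∧ v = u) ∨ y = x - 1 ∧ v = u := by
  simp [flipUp]
  tauto

theorem down_mem_flipUp {y v : ℤ} :
    .down y v ∈ flipUp T x u ↔ .down y v ∈ T ∧ ¬ (y = x - 1 ∧ v = u) ∨ y = x ∧ v = u + 1 := by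
  simp [flipUp]
  tauto

theorem horiz_mem_flipUp {y v : ℤ} :
    .horiz y v ∈ flipUp T x u ↔ .horiz y v ∈ T ∧ ¬ (y = x ∧ v = u + 1) ∨ y = x ∧ v = u := by
  simp [flipUp]
  tauto

/-- A flip affects only the path through `(x, u)`, and only there: the two new steps next to this
point rejoin the old path in column `x + 1`. Induction along the path, according to the position of
the column relative to `x - 1` and `x`. -/
theorem IsTiling.height_flipUp (hT : IsTiling R T) (h : Flippable T x u) {s : Edge}
    (hs : s ∈ starts R) {n : ℕ} (hn : n ≤ length R T s) :
    height (flipUp T x u) s n =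
      height T s n + if s.1 + n = x ∧ height T s n = u then 1 else 0 := by
  induction n with
  | zero =>
    rw [if_neg, add_zero]
    · rfl
    rintro ⟨h1, h2⟩
    have := (hT.interior_of_locMin h.1).1
    rw [← h1, ← h2] at this
    exact (mem_starts.1 hs).2 (by simpa [height] using this)
  | succ n ih =>
    have ih := ih (by omega)
    have st := hT.height_step hs (n := n) hn
    generalize hv : height T s n = v at *
    generalize hv1 : height T s (n + 1) = v1 at *
    generalize hv' : height (flipUp T x u) s n = v' at *
    have e : height (flipUp T x u) s (n + 1) =
        if Lozenge.up (s.1 + n) v' ∈ flipUp T x u then v' + 1 else v' := by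
      rw [← hv']; rfl
    rw [e]
    simp only [up_mem_flipUp]
    push_cast
    rcases lt_trichotomy (s.1 + n) (x - 1) with hx | hx | hx
    · rw [if_neg (by omega), add_zero] at ih
      subst ih
      rw [if_neg (c := _ ∧ v1 = u) (by omega)]
      rcases st with st | st
      · rw [if_pos (Or.inl ⟨st.1, by omega⟩)]; omega
      · rw [if_neg]
        · omega
        · rintro (h1 | h1)
          · exact hT.not_down_of_up h1.1 st.1
          · omega
    · rw [if_neg (by omega), add_zero] at ih
      subst ih
      by_cases hu : v' = u
      · subst hu
        rw [if_pos (Or.inr ⟨hx, rfl⟩)]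
        rcases st with st | st
        · rw [hx] at st
          exact absurd h.1.1 (hT.not_down_of_up st.1)
        · rw [if_pos (by omega)]; omega
      · have hv1u : v1 ≠ u := by
          rintro rfl
          rcases st with st | st
          · rw [hx, show v' = v1 - 1 by omega] at st
            exact hT.not_down_of_up' st.1 h.1.1
          · omega
        rw [if_neg (c := _ ∧ v1 = u) (by omega)]
        rcases st with st | st
        · rw [if_pos (Or.inl ⟨st.1, by omega⟩)]; omega
        · rw [if_neg]
          · omega
          · rintro (h1 | h1)
            · exact hT.not_down_of_up h1.1 st.1
            · omega
    · rw [if_neg (c := _ ∧ v1 = u) (by omega)]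
      by_cases hu : s.1 + n = x ∧ v = u
      · obtain ⟨hx', rfl⟩ := hu
        rw [if_pos ⟨hx', rfl⟩] at ih
        subst ih
        rw [hx'] at st ⊢
        have h1 : v1 = v + 1 := by
          rcases st with st | st
          · exact st.2
          · exact absurd st.1 (hT.not_down_of_up h.1.2)
        rw [if_neg]
        · omega
        · rintro (h2 | h2)
          · exact hT.not_horiz_of_up h2.1 h.2
          · omega
      · rw [if_neg hu, add_zero] at ih
        subst ih
        rcases st with st | st
        · rw [if_pos (Or.inl ⟨st.1, hu⟩)]; omega
        · rw [if_neg]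
          · omega
          · rintro (h1 | h1)
            · exact hT.not_down_of_up h1.1 st.1
            · omega

theorem IsTiling.length_flipUp (hT : IsTiling R T) (h : Flippable T x u) {s : Edge}
    (hs : s ∈ starts R) : length R (flipUp T x u) s = length R T s := by
  refine length_eq (fun n hn => ?_) ?_
  · rw [hT.height_flipUp h hs hn.le]
    split_ifs with hc
    · rw [hc.1, hc.2]
      exact (hT.horiz_mem h.2).2
    · rw [add_zero]
      exact right_mem hn
  · rw [hT.height_flipUp h hs le_rfl, if_neg, add_zero]
    · exact right_length_notMem
    · rintro ⟨h1, h2⟩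
      have := (hT.interior_of_locMin h.1).2
      rw [← h1, ← h2] at this
      exact right_length_notMem this

end Flips

/-! ### Compatible tilings -/

/-- The corresponding paths of two tilings have the same endpoints, they are ordered in the same way
in every column, and no edge between corresponding points lies outside of the region. -/
structure Compat (R : Region) (S T : Config) : Prop where
  len : ∀ s ∈ starts R, length R S s = length R T s
  last : ∀ s ∈ starts R, height S s (length R S s) = height T s (length R S s)
  order : ∀ q ∈ sites R S, ∀ q' ∈ sites R S, col q = col q' → ht S q < ht S q' → ht T q < ht T q'
  interior : ∀ q ∈ sites R S, ∀ u ∈ Set.uIcc (ht S q) (ht T q), Interior R (col q) u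

section Compat

variable {R : Region} {S T U : Config}

theorem Compat.sites_eq (h : Compat R S T) : sites R S = sites R T := by
  ext q
  simp only [mem_sites]
  constructor
  · rintro ⟨h1, h2, h3⟩; exact ⟨h1, h2, h.len _ h1 ▸ h3⟩
  · rintro ⟨h1, h2, h3⟩; exact ⟨h1, h2, (h.len _ h1).symm ▸ h3⟩

theorem IsTiling.compat_refl (hT : IsTiling R T) : Compat R T T where
  len _ _ := rfl
  last _ _ := rfl
  order _ _ _ _ _ h := h
  interior q hq u hu := by
    rw [Set.uIcc_self, Set.mem_singleton_iff] at hu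
    exact hu ▸ hT.interior_site hq

theorem Compat.symm (h : Compat R S T) (hS : IsTiling R S) : Compat R T S where
  len s hs := (h.len s hs).symm
  last s hs := by rw [← h.len s hs, h.last s hs]
  order q hq q' hq' hc hlt := by
    rw [← h.sites_eq] at hq hq'
    rcases lt_trichotomy (ht S q) (ht S q') with h1 | h1 | h1
    · exact h1
    · rw [hS.site_unique hq hq' hc h1] at hlt
      exact absurd hlt (lt_irrefl _)
    · exact absurd hlt (h.order q' hq' q hq hc.symm h1).not_gt
  interior q hq u hu := h.interior q (h.sites_eq ▸ hq) u (by rwa [Set.uIcc_comm])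

theorem Compat.trans (h : Compat R S T) (h' : Compat R T U) : Compat R S U where
  len s hs := (h.len s hs).trans (h'.len s hs)
  last s hs := by rw [h.last s hs, h.len s hs, h'.last s hs]
  order q hq q' hq' hc hlt := by
    have := h.order q hq q' hq' hc hlt
    rw [h.sites_eq] at hq hq'
    exact h'.order q hq q' hq' hc this
  interior q hq u hu := by
    rcases Set.uIcc_subset_uIcc_union_uIcc (b := ht T q) hu with h1 | h1
    · exact h.interior q hq u h1
    · exact h'.interior q (h.sites_eq ▸ hq) u h1

theorem Compat.order_iff (h : Compat R S T) (hS : IsTiling R S) {q q' : Edge × ℕ}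
    (hq : q ∈ sites R S) (hq' : q' ∈ sites R S) (hc : col q = col q') :
    ht S q < ht S q' ↔ ht T q < ht T q' :=
  ⟨h.order q hq q' hq' hc, (h.symm hS).order q (h.sites_eq ▸ hq) q' (h.sites_eq ▸ hq') hc⟩

/-- In a compatible tiling, the heights at the sites determine those at the endpoints. -/
theorem Compat.height_eq_of_notMem (h : Compat R S T) {s : Edge} (hs : s ∈ starts R) {n : ℕ}
    (hn : n ≤ length R S s) (hq : (s, n) ∉ sites R S) : height S s n = height T s n := by
  simp only [mem_sites, not_and] at hq
  rcases Nat.eq_zero_or_pos n with rfl | h0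
  · rfl
  · have : n = length R S s := by have := hq hs h0; omega
    rw [this]
    exact h.last s hs

/-- The moved point enters an edge that was inside a horizontal lozenge. Such an edge is interior to
the region and on no path, so no path is overtaken and no hole is crossed. -/
theorem IsTiling.compat_flipUp (hT : IsTiling R T) {x u : ℤ} (h : Flippable T x u) :
    Compat R T (flipUp T x u) where
  len s hs := (hT.length_flipUp h hs).symm
  last s hs := by
    rw [hT.height_flipUp h hs le_rfl, if_neg, add_zero]
    rintro ⟨h1, h2⟩
    have := (hT.interior_of_locMin h.1).2
    rw [← h1, ← h2] at this
    exact right_length_notMem this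
  order q hq q' hq' hc hlt := by
    have h1 := mem_sites.1 hq
    have h2 := mem_sites.1 hq'
    have h3 := hT.site_horiz_notMem hq'
    have h4 := h.2
    simp only [ht, col] at *
    rw [hT.height_flipUp h h1.1 h1.2.2.le, hT.height_flipUp h h2.1 h2.2.2.le]
    by_cases hq : q.1.1 + q.2 = x ∧ height T q.1 q.2 = u
    · have : height T q'.1 q'.2 ≠ u + 1 := by
        intro h5
        rw [← hc, hq.1, h5] at h3
        exact h3 h4
      rw [if_pos hq]
      split_ifs <;> omega
    · rw [if_neg hq]
      split_ifs <;> omega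
  interior q hq v hv := by
    have h1 := mem_sites.1 hq
    have hi := hT.interior_site hq
    simp only [ht, col] at *
    rw [hT.height_flipUp h h1.1 h1.2.2.le] at hv
    split_ifs at hv with hc
    · rw [Set.uIcc_of_le (by omega)] at hv
      obtain ⟨hv1, hv2⟩ := hv
      rcases eq_or_lt_of_le hv1 with h2 | h2
      · rw [← h2]; exact hi
      · rw [show v = u + 1 by omega, hc.1]
        exact hT.horiz_mem h.2
    · rw [add_zero, Set.uIcc_self, Set.mem_singleton_iff] at hv
      exact hv ▸ hi

end Compat

/-! ### Towers -/

section Towers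

variable {R : Region} {S T : Config} {x u : ℤ} {k : ℕ}

theorem isTowerUp_zero : IsTowerUp T x u 0 ↔ Flippable T x u := by
  simp [IsTowerUp, Flippable, LocMin]

theorem IsTowerUp.locMin (h : IsTowerUp T x u k) {j : ℕ} (hj : j ≤ k) : LocMin T x (u + j) :=
  h.1 j hj

theorem IsTowerUp.flippable (h : IsTowerUp T x u k) : Flippable T x (u + k) :=
  ⟨h.locMin le_rfl, h.2⟩

theorem IsTowerUp.flip (h : IsTowerUp T x u (k + 1)) :
    IsTowerUp (flipUp T x (u + (k + 1))) x u k := by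
  refine ⟨fun j hj => ?_, ?_⟩
  · have := h.locMin (j := j) (by omega)
    rw [down_mem_flipUp, up_mem_flipUp]
    exact ⟨Or.inl ⟨this.1, by omega⟩, Or.inl ⟨this.2, by omega⟩⟩
  · rw [horiz_mem_flipUp]
    exact Or.inr ⟨rfl, by ring⟩

/-- The horizontal lozenge above the smaller tower would overlap a step of the larger one. -/
theorem IsTowerUp.unique (hT : IsTiling R T) {k' : ℕ} (h : IsTowerUp T x u k)
    (h' : IsTowerUp T x u k') : k = k' := by
  have key : ∀ k k' : ℕ, k < k' → IsTowerUp T x u k → IsTowerUp T x u k' → False := by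
    intro k k' hlt h h'
    have := h'.locMin (j := k + 1) hlt
    push_cast at this
    rw [← add_assoc] at this
    exact hT.not_horiz_of_up this.2 h.2
  rcases lt_trichotomy k k' with h1 | h1 | h1
  · exact (key k k' h1 h h').elim
  · exact h1
  · exact (key k' k h1 h' h).elim

/-- A tower move is a succession of single flips, the uppermost first; after that flip the
horizontal lozenge it leaves behind frees the next path below. -/
theorem IsTiling.tower (hT : IsTiling R T) (h : IsTowerUp T x u k) :
    IsTiling R (towerUp T x u k) ∧ Compat R T (towerUp T x u k) ∧
      ∀ s ∈ starts R, ∀ n ≤ length R T s, height (towerUp T x u k) s n = height T s n +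
        if s.1 + n = x ∧ u ≤ height T s n ∧ height T s n ≤ u + k then 1 else 0 := by
  induction k generalizing T with
  | zero =>
    have hf := isTowerUp_zero.1 h
    refine ⟨hT.flip hf, hT.compat_flipUp hf, fun s hs n hn => ?_⟩
    have := hT.height_flipUp hf hs hn
    simp only [towerUp]
    rw [this]
    congr 2
    push_cast
    rw [eq_iff_iff]
    omega
  | succ k ih =>
    have hf := h.flippable
    push_cast at hf
    obtain ⟨h1, h2, h3⟩ := ih (hT.flip hf) h.flip
    have hc := hT.compat_flipUp hf
    refine ⟨h1, hc.trans h2, fun s hs n hn => ?_⟩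
    have h4 := h3 s hs n (hc.len s hs ▸ hn)
    rw [hT.height_flipUp hf hs hn] at h4
    simp only [towerUp]
    rw [h4]
    push_cast
    split_ifs <;> omega

theorem pushUp_of_tower (hT : IsTiling R T) {r : unitInterval} (h : IsTowerUp T x u k)
    (hr : (r : ℝ) ≤ 1 / ((k : ℝ) + 1)) : pushUp r T x u = towerUp T x u k := by
  have hex : ∃ k, IsTowerUp T x u k ∧ (r : ℝ) ≤ 1 / ((k : ℝ) + 1) := ⟨k, h, hr⟩
  rw [pushUp, dif_pos hex, hex.choose_spec.1.unique hT h]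

theorem pushUp_of_not {r : unitInterval}
    (h : ∀ k, IsTowerUp T x u k → ¬ (r : ℝ) ≤ 1 / ((k : ℝ) + 1)) : pushUp r T x u = T := by
  rw [pushUp, dif_neg]
  rintro ⟨k, h1, h2⟩
  exact h k h1 h2

theorem IsTiling.push (hT : IsTiling R T) (r : unitInterval) :
    IsTiling R (pushUp r T x u) ∧ Compat R T (pushUp r T x u) := by
  by_cases hex : ∃ k, IsTowerUp T x u k ∧ (r : ℝ) ≤ 1 / ((k : ℝ) + 1)
  · obtain ⟨k, h, hr⟩ := hex
    rw [pushUp_of_tower hT h hr]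
    exact ⟨(hT.tower h).1, (hT.tower h).2.1⟩
  · rw [pushUp_of_not fun k h hr => hex ⟨k, h, hr⟩]
    exact ⟨hT, hT.compat_refl⟩

end Towers

/-! ### The order on compatible tilings -/

section Order

variable {R : Region} {S T : Config}

theorem Compat.below_iff (h : Compat R S T) :
    Below R S T ↔ ∀ q ∈ sites R S, ht S q ≤ ht T q := by
  constructor
  · intro hb q hq
    have := mem_sites.1 hq
    exact hb _ this.1 _ this.2.2.le
  · intro hb s hs n hn
    by_cases hq : (s, n) ∈ sites R S
    · exact hb _ hq
    · exact (h.height_eq_of_notMem hs hn hq).le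

theorem Compat.height_eq (h : Compat R S T) (he : ∀ q ∈ sites R S, ht S q = ht T q)
    {s : Edge} (hs : s ∈ starts R) {n : ℕ} (hn : n ≤ length R S s) :
    height S s n = height T s n := by
  by_cases hq : (s, n) ∈ sites R S
  · exact he _ hq
  · exact h.height_eq_of_notMem hs hn hq

/-- A tiling is determined by its paths: their steps are the non-horizontal lozenges, and the
horizontal ones sit exactly at the interior edges that no path visits. -/
theorem Compat.subset_of_ht_eq (h : Compat R S T) (hS : IsTiling R S) (hT : IsTiling R T)
    (he : ∀ q ∈ sites R S, ht S q = ht T q) : S ⊆ T := by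
  have key : ∀ x u, .right x u ∈ R → .horiz x u ∉ S → ∃ s ∈ starts R, ∃ n : ℕ,
      n < length R S s ∧ n < length R T s ∧ s.1 + n = x ∧ height S s n = u ∧ height T s n = u ∧
      height S s (n + 1) = height T s (n + 1) := by
    intro x u hr hh
    obtain ⟨s, hs, n, hn, h1, h2⟩ := hS.exists_path hh (Or.inl hr)
    have hlt : n < length R S s := by
      refine lt_of_le_of_ne hn fun hL => ?_
      rw [← h1, ← h2, hL] at hr
      exact right_length_notMem hr
    exact ⟨s, hs, n, hlt, h.len s hs ▸ hlt, h1, h2, h.height_eq he hs hn ▸ h2,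
      h.height_eq he hs hlt⟩
  intro l hl
  cases l with
  | horiz x u =>
    by_contra hh
    obtain ⟨q, hq, h1, h2⟩ := hT.exists_site hh (hS.horiz_mem hl)
    rw [← h.sites_eq] at hq
    have := hS.site_horiz_notMem hq
    rw [he q hq, h1, h2] at this
    exact this hl
  | up x u =>
    obtain ⟨s, hs, n, h1, h2, h3, h4, h5, h6⟩ :=
      key x u (hS.up_mem hl).1 (hS.not_horiz_of_up hl)
    have h7 : height S s (n + 1) = height S s n + 1 :=
      height_succ_of_up (by rw [h3, h4]; exact hl)
    rcases hT.height_step hs h2 with h8 | h8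
    · rw [h3, h5] at h8; exact h8.1
    · omega
  | down x u =>
    obtain ⟨s, hs, n, h1, h2, h3, h4, h5, h6⟩ :=
      key x u (hS.down_mem hl).1 (hS.not_horiz_of_down hl)
    have h7 : height S s (n + 1) = height S s n :=
      height_succ_of_not_up (by rw [h3, h4]; exact fun h => hS.not_down_of_up h hl)
    rcases hT.height_step hs h2 with h8 | h8
    · omega
    · rw [h3, h5] at h8; exact h8.1

theorem Compat.eq_of_ht_eq (h : Compat R S T) (hS : IsTiling R S) (hT : IsTiling R T)
    (he : ∀ q ∈ sites R S, ht S q = ht T q) : S = T :=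
  (h.subset_of_ht_eq hS hT he).antisymm
    ((h.symm hS).subset_of_ht_eq hT hS fun q hq => (he q (h.sites_eq ▸ hq)).symm)

theorem Compat.eq_of_below (h : Compat R S T) (hS : IsTiling R S) (hT : IsTiling R T)
    (h1 : Below R S T) (h2 : Below R T S) : S = T :=
  h.eq_of_ht_eq hS hT fun q hq =>
    (h.below_iff.1 h1 q hq).antisymm ((h.symm hS).below_iff.1 h2 q (h.sites_eq ▸ hq))

/-- A tiling that is not above a compatible tiling can be moved up. -/
theorem exists_flippable (hS : IsTiling R S) (hT : IsTiling R T) (h : Compat R S T)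
    (hb : ¬ Below R S T) : ∃ x u, Flippable T x u := by
  classical
  rw [h.below_iff] at hb
  push Not at hb
  let D := (sites R S).filter fun q => ht T q < ht S q
  have hend : ∀ s ∈ starts R, ∀ n ≤ length R S s, height T s n < height S s n → (s, n) ∈ D := by
    intro s hs n hn hlt
    refine Finset.mem_filter.2 ⟨?_, hlt⟩
    by_contra hq
    exact hlt.ne' (h.height_eq_of_notMem hs hn hq)
  have hE : ((D.filter fun q => LocMin T (col q) (ht T q))).Nonempty := by
    obtain ⟨q0, hq0, hlt0⟩ := hb
    -- `2 * ht - col` is twice the geometric height. At its lowest point in `D` the path of `T` must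
    -- have a local minimum: a lower neighbour would again lie strictly below `S`, hence in `D`.
    obtain ⟨q, hq, hmin⟩ := D.exists_min_image (fun q => 2 * ht T q - col q)
      ⟨q0, Finset.mem_filter.2 ⟨hq0, hlt0⟩⟩
    refine ⟨q, Finset.mem_filter.2 ⟨hq, ?_⟩⟩
    obtain ⟨hqS, hlt⟩ := Finset.mem_filter.1 hq
    have hqT := h.sites_eq ▸ hqS
    obtain ⟨hs, h0, hL⟩ := mem_sites.1 hqS
    obtain ⟨a1, a2⟩ := hS.site_steps hqS
    obtain ⟨b1, b2⟩ := hT.site_steps hqT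
    rw [hT.locMin_iff hqT]
    have m1 := hmin (q.1, q.2 - 1)
    have m2 := hmin (q.1, q.2 + 1)
    have e1 := hend q.1 hs (q.2 - 1) (by omega)
    have e2 := hend q.1 hs (q.2 + 1) (by omega)
    simp only [col, ht] at *
    push_cast [Nat.cast_sub h0] at m1 m2
    constructor
    · rcases b1 with b1 | b1
      · exact b1.symm
      · have := m1 (e1 (by omega))
        omega
    · rcases b2 with b2 | b2
      · have := m2 (e2 (by omega))
        omega
      · exact b2
  -- The highest of these local minima is free. A path blocking it would pass directly above with a
  -- local minimum, and by the common vertical order it would also be strictly below its counterpart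
  -- in `S`.
  obtain ⟨q, hq, hmax⟩ := Finset.exists_max_image _ (ht T) hE
  obtain ⟨hqD, hmin⟩ := Finset.mem_filter.1 hq
  obtain ⟨hqS, hlt⟩ := Finset.mem_filter.1 hqD
  refine ⟨col q, ht T q, hmin, ?_⟩
  by_contra hh
  have hi : Interior R (col q) (ht T q + 1) :=
    h.interior q hqS _ (by rw [Set.uIcc_of_ge hlt.le]; exact ⟨by omega, by omega⟩)
  obtain ⟨q', hq', hc, hu⟩ := hT.exists_site hh hi
  rw [← h.sites_eq] at hq'
  have h1 := (h.order_iff hS hqS hq' hc.symm).2 (by omega)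
  have h2 := hmax q' (Finset.mem_filter.2 ⟨Finset.mem_filter.2 ⟨hq', by omega⟩, by
    rw [hc, hu]; exact hT.locMin_succ hmin hi hh⟩)
  omega

end Order

/-! ### Monotonicity of the tower moves -/

section Monotone

variable {R : Region} {S T : Config} {x u : ℤ} {k j : ℕ}

/-- If the upper tiling visits all edges from `u` to `u + j`, and the path at `u` is the same in the
lower tiling, then so are the others. -/
theorem Compat.climb (h : Compat R S T) (hS : IsTiling R S) (hT : IsTiling R T)
    (hb : ∀ q ∈ sites R S, ht S q ≤ ht T q) {q : Edge × ℕ} (hq : q ∈ sites R S) (hqS : ht S q = u)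
    (hqT : ht T q = u) (hint : ∀ i ≤ j, Interior R (col q) (u + i))
    (hvis : ∀ i ≤ j, .horiz (col q) (u + i) ∉ T) {q' : Edge × ℕ} (hq' : q' ∈ sites R S)
    (hc : col q' = col q) (hq'T : ht T q' = u + j) : ht S q' = u + j := by
  induction j generalizing q' with
  | zero =>
    have : q' = q := hT.site_unique (h.sites_eq ▸ hq') (h.sites_eq ▸ hq) hc (by simp [hq'T, hqT])
    rw [this, hqS]; simp
  | succ j ih =>
    obtain ⟨p, hp, hpc, hpT⟩ := hT.exists_site (hvis j (by omega)) (hint j (by omega))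
    rw [← h.sites_eq] at hp
    have h1 := ih (fun i hi => hint i (by omega)) (fun i hi => hvis i (by omega)) hp hpc hpT
    -- The next path lies in `S` strictly above `u + j` by the common order, and at most at `u + j +
    -- 1` since `S` is below `T`.
    have h2 := (h.order_iff hS hp hq' (hpc.trans hc.symm)).2 (by rw [hpT, hq'T]; push_cast; omega)
    have h3 := hb q' hq'
    push_cast at *
    omega

/-- If the lower tiling visits all edges from `u` to `u + j`, and the path at `u + j` is the same in
the upper tiling, then so are the others. -/
theorem Compat.descend (h : Compat R S T) (hS : IsTiling R S)
    (hb : ∀ q ∈ sites R S, ht S q ≤ ht T q) {q' : Edge × ℕ} (hq' : q' ∈ sites R S)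
    (hq'S : ht S q' = u + j)
    (hq'T : ht T q' = u + j) (hint : ∀ i ≤ j, Interior R (col q') (u + i))
    (hvis : ∀ i ≤ j, .horiz (col q') (u + i) ∉ S) {q : Edge × ℕ} (hq : q ∈ sites R S)
    (hc : col q = col q') {i : ℕ} (hi : i ≤ j) (hqS : ht S q = u + i) : ht T q = u + i := by
  obtain ⟨d, rfl⟩ := Nat.exists_eq_add_of_le hi
  induction d generalizing q i with
  | zero =>
    have : q = q' := hS.site_unique hq hq' hc (by simp [hqS, hq'S])
    rw [this, hq'T]; simp
  | succ d ih =>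
    obtain ⟨p, hp, hpc, hpS⟩ := hS.exists_site (hvis (i + 1) (by omega)) (hint (i + 1) (by omega))
    have e : i + (d + 1) = i + 1 + d := by omega
    rw [e] at hq'S hq'T hint hvis
    have h1 := ih hp hpc (i := i + 1) hpS hq'S hq'T hint hvis (by omega)
    -- Dually, in `T` this path lies strictly below the next one, which is at `u + i + 1`, and not
    -- below its position `u + i` in `S`.
    have h2 := h.order q hq p hp (hc.trans hpc.symm) (by rw [hpS, hqS]; push_cast; omega)
    have h3 := hb q hq
    push_cast at *
    omega

theorem Compat.locMin_of_eq (h : Compat R S T) (hS : IsTiling R S) (hT : IsTiling R T)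
    (hb : Below R S T) {q : Edge × ℕ} (hq : q ∈ sites R S) (hm : LocMin S (col q) (ht S q))
    (he : ht T q = ht S q) : LocMin T (col q) (ht T q) := by
  have hqT := h.sites_eq ▸ hq
  obtain ⟨h1, h2⟩ := (hS.locMin_iff hq).1 hm
  obtain ⟨b1, b2⟩ := hT.site_steps hqT
  obtain ⟨hs, h0, hL⟩ := mem_sites.1 hq
  have h3 := hb q.1 hs (q.2 - 1) (by omega)
  have h4 := hb q.1 hs (q.2 + 1) (by omega)
  rw [hT.locMin_iff hqT]
  omega

/-- The local minima above a site extend as far as the interior edges that are visited. -/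
theorem IsTiling.locMin_add (hT : IsTiling R T) (hm : LocMin T x u)
    (hint : ∀ i ≤ j, Interior R x (u + i)) (hvis : ∀ i ≤ j, .horiz x (u + i) ∉ T) :
    LocMin T x (u + j) := by
  induction j with
  | zero => simpa using hm
  | succ j ih =>
    have h1 := ih (fun i hi => hint i (by omega)) (fun i hi => hvis i (by omega))
    have h2 := hint (j + 1) le_rfl
    have h3 := hvis (j + 1) le_rfl
    push_cast at *
    rw [← add_assoc] at *
    exact hT.locMin_succ h1 h2 h3

theorem IsTowerUp.interior (hT : IsTiling R T) (h : IsTowerUp T x u k) {i : ℕ} (hi : i ≤ k + 1) :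
    Interior R x (u + i) := by
  rcases Nat.lt_or_ge k i with h1 | h1
  · have : i = k + 1 := by omega
    subst this
    push_cast
    rw [← add_assoc]
    exact hT.horiz_mem h.2
  · exact hT.interior_of_locMin (h.locMin h1)

theorem IsTowerUp.horiz_notMem (hT : IsTiling R T) (h : IsTowerUp T x u k) {i : ℕ} (hi : i ≤ k) :
    .horiz x (u + i) ∉ T :=
  hT.not_horiz_of_up (h.locMin hi).2

/-- A tower of the lower tiling at a site where both tilings agree gives a tower of at most the
same size in the upper tiling, and it contains all points of the first tower where the two tilings
agree. -/
theorem Compat.tower_of_tower (h : Compat R S T) (hS : IsTiling R S) (hT : IsTiling R T)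
    (hb : Below R S T) {q : Edge × ℕ} (hq : q ∈ sites R S) (he : ht T q = ht S q)
    (hk : IsTowerUp S (col q) (ht S q) k) :
    ∃ k' ≤ k, IsTowerUp T (col q) (ht T q) k' ∧ ∀ q' ∈ sites R S, col q' = col q →
      ht T q' = ht S q' → ht S q ≤ ht S q' → ht S q' ≤ ht S q + k → ht S q' ≤ ht S q + k' := by
  classical
  have hb' := h.below_iff.1 hb
  have hm : LocMin T (col q) (ht T q) :=
    h.locMin_of_eq hS hT hb hq (by simpa using hk.locMin (Nat.zero_le k)) he
  -- If `T` had no horizontal lozenge up to the top of the tower of `S`, `climb` would put a path of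
  -- `S` at the edge above that tower, where `S` has a horizontal lozenge.
  have hex : ∃ j : ℕ, .horiz (col q) (ht S q + (j + 1 : ℕ)) ∈ T ∧ j ≤ k := by
    by_contra! hcon
    have hvis : ∀ i ≤ k + 1, .horiz (col q) (ht S q + (i : ℕ)) ∉ T := by
      intro i hi
      cases i with
      | zero => simpa [← he] using hT.site_horiz_notMem (h.sites_eq ▸ hq)
      | succ i => exact fun hc => absurd (hcon i hc) (by omega)
    obtain ⟨p, hp, hpc, hpT⟩ := hT.exists_site (hvis (k + 1) le_rfl) (hk.interior hS le_rfl)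
    rw [← h.sites_eq] at hp
    have := h.climb hS hT hb' hq rfl he (fun i hi => hk.interior hS hi) hvis hp hpc hpT
    have h1 := hS.site_horiz_notMem hp
    rw [this, hpc] at h1
    push_cast at h1
    rw [← add_assoc] at h1
    exact h1 hk.2
  have hspec := Nat.find_spec hex
  have hleast : ∀ i < Nat.find hex, .horiz (col q) (ht S q + (i + 1 : ℕ)) ∉ T :=
    fun i hi hc => Nat.find_min hex hi ⟨hc, by omega⟩
  generalize Nat.find hex = k' at hspec hleast
  refine ⟨k', hspec.2, ⟨fun i hi => ?_, ?_⟩, fun q' hq' hc he' h1 h2 => ?_⟩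
  · refine hT.locMin_add hm (fun l hl => ?_) fun l hl => ?_
    · rw [he]; exact hk.interior hS (by omega)
    · rw [he]
      cases l with
      | zero => simpa [← he] using hT.site_horiz_notMem (h.sites_eq ▸ hq)
      | succ l => exact hleast l (by omega)
  · rw [he]
    have := hspec.1
    push_cast at this
    rwa [← add_assoc] at this
  · by_contra! hlt
    obtain ⟨j, hj⟩ := Int.eq_ofNat_of_zero_le (sub_nonneg.2 h1)
    have hj' : ht S q' = ht S q + j := by omega
    -- A point of agreement beyond the tower of `T` would, by `descend`, force a path of `T` through
    -- the horizontal lozenge that ends this tower.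
    obtain ⟨p, hp, hpc, hpS⟩ := hS.exists_site (hk.horiz_notMem hS (i := k' + 1) (by omega))
      (hk.interior hS (i := k' + 1) (by omega))
    have := h.descend hS hb' hq' hj' (he'.trans hj')
      (fun i hi => by rw [hc]; exact hk.interior hS (by omega))
      (fun i hi => by rw [hc]; exact hk.horiz_notMem hS (by omega)) hp (hpc.trans hc.symm)
      (i := k' + 1) (by omega) hpS
    have h3 := hT.site_horiz_notMem (h.sites_eq ▸ hp)
    rw [this, hpc] at h3
    exact h3 hspec.1

/-- An upward push at the same site preserves the order. -/
theorem Compat.below_pushUp (h : Compat R S T) (hS : IsTiling R S) (hT : IsTiling R T)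
    (hb : Below R S T) {q : Edge × ℕ} (hq : q ∈ sites R S) (r : unitInterval) :
    Below R (pushUp r S (col q) (ht S q)) (pushUp r T (col q) (ht T q)) := by
  have hb' := h.below_iff.1 hb
  by_cases hex : ∃ k, IsTowerUp S (col q) (ht S q) k ∧ (r : ℝ) ≤ 1 / ((k : ℝ) + 1)
  · obtain ⟨k, hk, hr⟩ := hex
    rw [pushUp_of_tower hS hk hr]
    obtain ⟨-, hc1, hh1⟩ := hS.tower hk
    intro s hs n hn
    rw [← hc1.len s hs] at hn
    rw [hh1 s hs n hn]
    have hTge : height T s n ≤ height (pushUp r T (col q) (ht T q)) s n := by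
      by_cases hex : ∃ k, IsTowerUp T (col q) (ht T q) k ∧ (r : ℝ) ≤ 1 / ((k : ℝ) + 1)
      · obtain ⟨k, hk, hr⟩ := hex
        rw [pushUp_of_tower hT hk hr, (hT.tower hk).2.2 s hs n (h.len s hs ▸ hn)]
        split_ifs <;> omega
      · rw [pushUp_of_not fun k h hr => hex ⟨k, h, hr⟩]
    have hST := hb s hs n hn
    split_ifs with hc
    · by_cases heq : height T s n = height S s n
      · obtain ⟨hcx, hc2, hc3⟩ := hc
        obtain ⟨j, hj⟩ := Int.eq_ofNat_of_zero_le (sub_nonneg.2 hc2)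
        have hj' : height S s n = ht S q + j := by omega
        have hs' : (s, n) ∈ sites R S := by
          refine mem_sites_of_interior hs hn ?_
          rw [hcx, hj']
          exact hk.interior hS (by omega)
        -- Agreement at a point of the tower propagates down to its base, so both tilings are pushed
        -- at the same edge.
        have hq' : ht T q = ht S q := by
          have := h.descend hS hb' hs' (u := ht S q) (j := j) hj' (heq.trans hj')
            (fun i hi => by rw [show col (s, n) = col q from hcx]; exact hk.interior hS (by omega))
            (fun i hi => by
              rw [show col (s, n) = col q from hcx]; exact hk.horiz_notMem hS (by omega))
            hq hcx.symm (i := 0) (by omega) (by simp)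
          simpa using this
        obtain ⟨k', hk'k, hk', hall⟩ := h.tower_of_tower hS hT hb hq hq' hk
        have h5 := hall (s, n) hs' hcx heq hc2 hc3
        simp only [ht] at h5 hq'
        -- The upper tower is no larger, hence its acceptance threshold is no smaller, and the same
        -- `r` moves it too.
        have hr' : (r : ℝ) ≤ 1 / ((k' : ℝ) + 1) :=
          hr.trans (one_div_le_one_div_of_le (by positivity) (by gcongr))
        rw [pushUp_of_tower hT hk' hr', (hT.tower hk').2.2 s hs n (h.len s hs ▸ hn), if_pos]
        · omega
        · simp only [ht] at *
          exact ⟨hcx, by omega, by omega⟩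
      · omega
    · omega
  · rw [pushUp_of_not fun k h hr => hex ⟨k, h, hr⟩]
    by_cases hex : ∃ k, IsTowerUp T (col q) (ht T q) k ∧ (r : ℝ) ≤ 1 / ((k : ℝ) + 1)
    · obtain ⟨k, hk, hr⟩ := hex
      rw [pushUp_of_tower hT hk hr]
      intro s hs n hn
      rw [(hT.tower hk).2.2 s hs n (h.len s hs ▸ hn)]
      have := hb s hs n hn
      split_ifs <;> omega
    · rw [pushUp_of_not fun k h hr => hex ⟨k, h, hr⟩]
      exact hb

/-- If the upward movement at a local minimum of the lower tiling is blocked by the boundary, then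
so is that of the upper tiling. -/
theorem Compat.blocked (h : Compat R S T) (hS : IsTiling R S) (hT : IsTiling R T)
    (hb : Below R S T) {q : Edge × ℕ} (hq : q ∈ sites R S) (hm : LocMin S (col q) (ht S q))
    (hno : ∀ k, ¬ IsTowerUp S (col q) (ht S q) k) :
    LocMin T (col q) (ht T q) ∧ ∀ k, ¬ IsTowerUp T (col q) (ht T q) k := by
  classical
  have hb' := h.below_iff.1 hb
  -- The region is finite, so the column above the site leaves its interior; `j` becomes the first
  -- such offset.
  have hex : ∃ j : ℕ, ¬ Interior R (col q) (ht S q + j) := by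
    by_contra! hcon
    exact Set.infinite_of_injective_forall_mem (s := (R : Set Triangle))
      (f := fun n : ℕ => Triangle.left (col q) (ht S q + n))
      (fun a b hab => by simpa using (Triangle.left.inj hab).2) (fun n => (hcon n).1)
      R.finite_toSet
  have hspec := Nat.find_spec hex
  have hint : ∀ i < Nat.find hex, Interior R (col q) (ht S q + i) :=
    fun i hi => not_not.1 (Nat.find_min hex hi)
  generalize Nat.find hex = j at hspec hint
  have hj : j ≠ 0 := by
    rintro rfl
    exact hspec (by simpa using hS.interior_site hq)
  obtain ⟨j, rfl⟩ := Nat.exists_eq_succ_of_ne_zero hj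
  -- Paths of `S` fill the whole column up to the boundary, since the first gap would complete a
  -- tower.
  have hvis : ∀ i ≤ j, .horiz (col q) (ht S q + (i : ℕ)) ∉ S := by
    intro i
    induction i using Nat.strong_induction_on with
    | _ i ih =>
      intro hi hcon
      cases i with
      | zero => exact hS.site_horiz_notMem hq (by simpa using hcon)
      | succ i =>
        refine hno i ⟨fun l hl => ?_, ?_⟩
        · exact hS.locMin_add hm (fun a ha => hint a (by omega))
            (fun a ha => ih a (by omega) (by omega))
        · push_cast at hcon
          rwa [← add_assoc] at hcon
  obtain ⟨p, hp, hpc, hpS⟩ := hS.exists_site (hvis j le_rfl) (hint j (by omega))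
  -- The topmost path of the stack cannot be higher in `T`, because compatibility forbids passing
  -- the edge that is not interior. By `descend` the whole stack is pinned.
  have hpT : ht T p = ht S q + j := by
    have h1 := hb' p hp
    by_contra hne
    refine hspec ?_
    rw [← hpc]
    refine h.interior p hp _ ?_
    rw [Set.uIcc_of_le h1]
    simp only [Set.mem_Icc, Nat.succ_eq_add_one]
    push_cast
    omega
  have key : ∀ i ≤ j, ∀ p' ∈ sites R S, col p' = col q → ht S p' = ht S q + i →
      ht T p' = ht S q + i := fun i hi p' hp' hc hpS' =>
    h.descend hS hb' hp hpS hpT (fun a ha => by rw [hpc]; exact hint a (by omega))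
      (fun a ha => by rw [hpc]; exact hvis a ha) hp' (hc.trans hpc.symm) hi hpS'
  have hqT : ht T q = ht S q := by
    simpa using key 0 (by omega) q hq rfl (by simp)
  refine ⟨h.locMin_of_eq hS hT hb hq hm hqT, fun k hk => ?_⟩
  rw [hqT] at hk
  have hkj : k + 1 ≤ j := by
    by_contra! hlt
    exact hspec (hk.interior hT (i := j + 1) (by omega))
  obtain ⟨p', hp', hpc', hpS'⟩ := hS.exists_site (hvis (k + 1) hkj) (hint (k + 1) (by omega))
  have h1 := key (k + 1) hkj p' hp' hpc' hpS'
  have h2 := hT.site_horiz_notMem (h.sites_eq ▸ hp')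
  rw [h1, hpc'] at h2
  push_cast at h2
  rw [← add_assoc] at h2
  exact h2 hk.2

end Monotone

/-! ### Reflection in a horizontal line -/

section Reflection

/-- The reflection `(x, u) ↦ (x, x - u)`, on triangles. -/
def Triangle.refl : Triangle → Triangle
  | .left x u => .left x (x - u)
  | .right x u => .right x (x - u)

/-- The reflection on lozenges. -/
def Lozenge.refl : Lozenge → Lozenge
  | .horiz x u => .horiz x (x - u)
  | .up x u => .down x (x - u)
  | .down x u => .up x (x - u)

/-- The reflection on edges. -/
def reflEdge (e : Edge) : Edge := (e.1, e.1 - e.2)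

/-- The reflection on sites. -/
def reflSite (q : Edge × ℕ) : Edge × ℕ := (reflEdge q.1, q.2)

/-- The reflection on regions. -/
def reflRegion (R : Region) : Region := R.image Triangle.refl

/-- The reflection on configurations. -/
def reflConfig (T : Config) : Config := T.image Lozenge.refl

theorem Triangle.refl_refl (t : Triangle) : t.refl.refl = t := by
  cases t <;> simp [Triangle.refl]

theorem Lozenge.refl_refl (l : Lozenge) : l.refl.refl = l := by
  cases l <;> simp [Lozenge.refl]

theorem reflEdge_reflEdge (e : Edge) : reflEdge (reflEdge e) = e := by
  simp [reflEdge]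

theorem reflSite_reflSite (q : Edge × ℕ) : reflSite (reflSite q) = q := by
  simp [reflSite, reflEdge_reflEdge]

theorem col_reflSite (q : Edge × ℕ) : col (reflSite q) = col q := rfl

variable {R : Region} {S T : Config} {x u : ℤ} {k : ℕ}

theorem mem_reflRegion {t : Triangle} : t ∈ reflRegion R ↔ t.refl ∈ R := by
  constructor
  · intro h
    obtain ⟨t', h', rfl⟩ := Finset.mem_image.1 h
    rwa [Triangle.refl_refl]
  · intro h
    exact Finset.mem_image.2 ⟨_, h, t.refl_refl⟩

theorem mem_reflConfig {l : Lozenge} : l ∈ reflConfig T ↔ l.refl ∈ T := by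
  constructor
  · intro h
    obtain ⟨t', h', rfl⟩ := Finset.mem_image.1 h
    rwa [Lozenge.refl_refl]
  · intro h
    exact Finset.mem_image.2 ⟨_, h, l.refl_refl⟩

theorem reflConfig_reflConfig (T : Config) : reflConfig (reflConfig T) = T := by
  ext l
  rw [mem_reflConfig, mem_reflConfig, Lozenge.refl_refl]

theorem reflRegion_reflRegion (R : Region) : reflRegion (reflRegion R) = R := by
  ext l
  rw [mem_reflRegion, mem_reflRegion, Triangle.refl_refl]

theorem mem_cells_refl {l : Lozenge} {t : Triangle} : t ∈ l.refl.cells ↔ t.refl ∈ l.cells := by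
  cases l <;> cases t <;> simp [Lozenge.refl, Triangle.refl, Lozenge.cells] <;> omega

theorem IsTiling.refl (hT : IsTiling R T) : IsTiling (reflRegion R) (reflConfig T) := by
  constructor
  · intro l hl t ht
    rw [mem_reflRegion]
    refine hT.1 _ (mem_reflConfig.1 hl) ?_
    rw [mem_cells_refl, Triangle.refl_refl]
    exact ht
  · intro t ht
    obtain ⟨l, ⟨h1, h2⟩, h3⟩ := hT.2 _ (mem_reflRegion.1 ht)
    refine ⟨l.refl, ⟨mem_reflConfig.2 (by rwa [Lozenge.refl_refl]), mem_cells_refl.2 h2⟩, ?_⟩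
    rintro l' ⟨h4, h5⟩
    rw [← h3 l'.refl ⟨mem_reflConfig.1 h4, mem_cells_refl.2 (by rwa [Triangle.refl_refl])⟩,
      Lozenge.refl_refl]

theorem mem_starts_refl {s : Edge} : reflEdge s ∈ starts (reflRegion R) ↔ s ∈ starts R := by
  simp [mem_starts, mem_reflRegion, Triangle.refl, reflEdge]

/-- The geometric height `u - x / 2` changes sign under `u ↦ x - u`, which exchanges ascending and
descending steps. -/
theorem IsTiling.height_refl (hT : IsTiling R T) {s : Edge} (hs : s ∈ starts R) {n : ℕ}
    (hn : n ≤ length R T s) :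
    height (reflConfig T) (reflEdge s) n = s.1 + n - height T s n := by
  induction n with
  | zero => simp [height, reflEdge]
  | succ n ih =>
    have ih := ih (by omega)
    rcases hT.height_step hs (n := n) hn with h | h
    · rw [height_succ_of_not_up, ih, h.2]
      · push_cast; ring
      · rw [ih, mem_reflConfig]
        simp only [Lozenge.refl, reflEdge, sub_sub_cancel]
        exact hT.not_down_of_up h.1
    · rw [height_succ_of_up, ih, h.2]
      · push_cast; ring
      · rw [ih, mem_reflConfig]
        simp only [Lozenge.refl, reflEdge, sub_sub_cancel]
        exact h.1

theorem IsTiling.length_refl (hT : IsTiling R T) {s : Edge} (hs : s ∈ starts R) :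
    length (reflRegion R) (reflConfig T) (reflEdge s) = length R T s := by
  refine length_eq (fun n hn => ?_) ?_
  · rw [hT.height_refl hs hn.le, mem_reflRegion]
    simpa [Triangle.refl, reflEdge] using right_mem hn
  · rw [hT.height_refl hs le_rfl, mem_reflRegion]
    simpa [Triangle.refl, reflEdge] using right_length_notMem (R := R) (T := T) (s := s)

theorem IsTiling.mem_sites_refl (hT : IsTiling R T) {q : Edge × ℕ} :
    reflSite q ∈ sites (reflRegion R) (reflConfig T) ↔ q ∈ sites R T := by
  rw [mem_sites, mem_sites]
  simp only [reflSite, mem_starts_refl]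
  refine and_congr_right fun h => ?_
  rw [hT.length_refl h]

theorem IsTiling.exists_reflSite (hT : IsTiling R T) {q : Edge × ℕ}
    (hq : q ∈ sites (reflRegion R) (reflConfig T)) : ∃ q' ∈ sites R T, reflSite q' = q :=
  ⟨reflSite q, hT.mem_sites_refl.1 (by rwa [reflSite_reflSite]), reflSite_reflSite q⟩

theorem IsTiling.ht_refl (hT : IsTiling R T) {q : Edge × ℕ} (hq : q ∈ sites R T) :
    ht (reflConfig T) (reflSite q) = col q - ht T q :=
  have h := mem_sites.1 hq
  hT.height_refl h.1 h.2.2.le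

theorem interior_refl : Interior (reflRegion R) x u ↔ Interior R x (x - u) := by
  simp [Interior, mem_reflRegion, Triangle.refl]

theorem exists_reflEdge {s : Edge} (hs : s ∈ starts (reflRegion R)) :
    ∃ s' ∈ starts R, reflEdge s' = s :=
  ⟨reflEdge s, mem_starts_refl.1 (by rwa [reflEdge_reflEdge]), reflEdge_reflEdge s⟩

theorem Compat.refl (h : Compat R S T) (hS : IsTiling R S) (hT : IsTiling R T) :
    Compat (reflRegion R) (reflConfig S) (reflConfig T) where
  len s hs := by
    obtain ⟨s, hs', rfl⟩ := exists_reflEdge hs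
    replace hs := hs'
    rw [hS.length_refl hs, hT.length_refl hs, h.len s hs]
  last s hs := by
    obtain ⟨s, hs', rfl⟩ := exists_reflEdge hs
    replace hs := hs'
    rw [hS.length_refl hs, hS.height_refl hs le_rfl, hT.height_refl hs (h.len s hs).le,
      h.last s hs]
  order q hq q' hq' hc hlt := by
    obtain ⟨q, hr, rfl⟩ := hS.exists_reflSite hq
    obtain ⟨q', hr', rfl⟩ := hS.exists_reflSite hq'
    clear hq hq'
    rename' hr => hq, hr' => hq'
    rw [hS.ht_refl hq, hS.ht_refl hq'] at hlt
    rw [hT.ht_refl (h.sites_eq ▸ hq), hT.ht_refl (h.sites_eq ▸ hq')]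
    rw [col_reflSite, col_reflSite] at hc
    have := h.order q' hq' q hq hc.symm (by omega)
    omega
  interior q hq v hv := by
    obtain ⟨q, hr, rfl⟩ := hS.exists_reflSite hq
    replace hq := hr
    rw [hS.ht_refl hq, hT.ht_refl (h.sites_eq ▸ hq)] at hv
    rw [interior_refl, col_reflSite]
    refine h.interior q hq _ ?_
    rw [Set.mem_uIcc] at hv ⊢
    omega

theorem Compat.below_refl (h : Compat R S T) (hS : IsTiling R S) (hT : IsTiling R T)
    (hb : Below R S T) : Below (reflRegion R) (reflConfig T) (reflConfig S) := by
  intro s hs n hn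
  obtain ⟨s, hs', rfl⟩ := exists_reflEdge hs
  replace hs := hs'
  rw [hT.length_refl hs] at hn
  have hn' : n ≤ length R S s := (h.len s hs) ▸ hn
  rw [hT.height_refl hs hn, hS.height_refl hs hn']
  have := hb s hs n hn'
  omega

/-- Pushing a path down at a local maximum is the reflection of pushing one up. -/
theorem flipDown_eq_refl (T : Config) (x u : ℤ) :
    flipDown T x u = reflConfig (flipUp (reflConfig T) x (x - u)) := by
  ext l
  rw [mem_reflConfig]
  have e : x - 1 - (x - u) = u - 1 := by ring
  cases l with
  | horiz y v =>
    simp only [Lozenge.refl, horiz_mem_flipUp, mem_reflConfig]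
    simp [flipDown]
    grind
  | up y v =>
    simp only [Lozenge.refl, down_mem_flipUp, mem_reflConfig]
    simp [flipDown]
    grind
  | down y v =>
    simp only [Lozenge.refl, up_mem_flipUp, mem_reflConfig]
    simp [flipDown]
    grind

theorem isTowerDown_iff_refl :
    IsTowerDown T x u k ↔ IsTowerUp (reflConfig T) x (x - u) k := by
  have e1 : ∀ j : ℤ, x - 1 - (x - u + j) = u - j - 1 := fun j => by ring
  have e2 : ∀ j : ℤ, x - (x - u + j) = u - j := fun j => by ring
  have e3 : x - (x - u + k + 1) = u - k - 1 := by ring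
  simp only [IsTowerDown, IsTowerUp, mem_reflConfig, Lozenge.refl, e1, e2, e3]

theorem towerDown_eq_refl (T : Config) (x u : ℤ) (k : ℕ) :
    towerDown T x u k = reflConfig (towerUp (reflConfig T) x (x - u) k) := by
  induction k generalizing T with
  | zero => exact flipDown_eq_refl T x u
  | succ k ih =>
    rw [towerDown, towerUp, ih, flipDown_eq_refl, reflConfig_reflConfig]
    congr 3
    ring

theorem locMax_iff_refl : LocMax T x u ↔ LocMin (reflConfig T) x (x - u) := by
  simp only [LocMax, LocMin, mem_reflConfig, Lozenge.refl]
  rw [show x - 1 - (x - u) = u - 1 by ring, sub_sub_cancel]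

theorem IsTiling.pushDown_eq_refl (hT : IsTiling R T) (r : unitInterval) (x u : ℤ) :
    pushDown r T x u = reflConfig (pushUp r (reflConfig T) x (x - u)) := by
  by_cases hex : ∃ k, IsTowerDown T x u k ∧ (r : ℝ) ≤ 1 / ((k : ℝ) + 1)
  · rw [pushDown, dif_pos hex]
    obtain ⟨h1, h2⟩ := hex.choose_spec
    rw [isTowerDown_iff_refl] at h1
    rw [pushUp_of_tower hT.refl h1 h2, towerDown_eq_refl]
  · rw [pushDown, dif_neg hex, pushUp_of_not fun k hk hr => hex ⟨k, isTowerDown_iff_refl.2 hk, hr⟩,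
      reflConfig_reflConfig]

theorem IsTiling.pushDown (hT : IsTiling R T) (r : unitInterval) :
    IsTiling R (pushDown r T x u) ∧ Compat R T (pushDown r T x u) := by
  rw [hT.pushDown_eq_refl]
  obtain ⟨h1, h2⟩ := hT.refl.push (x := x) (u := x - u) r
  have h3 := h1.refl
  have h4 := h2.refl hT.refl h1
  rw [reflRegion_reflRegion] at h3 h4
  rw [reflConfig_reflConfig] at h4
  exact ⟨h3, h4⟩

/-- A downward push at the same site preserves the order. -/
theorem Compat.below_pushDown (h : Compat R S T) (hS : IsTiling R S) (hT : IsTiling R T)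
    (hb : Below R S T) {q : Edge × ℕ} (hq : q ∈ sites R S) (r : unitInterval) :
    Below R (pushDown r S (col q) (ht S q)) (pushDown r T (col q) (ht T q)) := by
  have hqT : q ∈ sites R T := h.sites_eq ▸ hq
  have h1 := ((h.refl hS hT).symm hS.refl).below_pushUp hT.refl hS.refl (h.below_refl hS hT hb)
    (hT.mem_sites_refl.2 hqT) r
  rw [col_reflSite, hT.ht_refl hqT, hS.ht_refl hq] at h1
  obtain ⟨a1, a2⟩ := hS.refl.push (x := col q) (u := col q - ht S q) r
  obtain ⟨b1, b2⟩ := hT.refl.push (x := col q) (u := col q - ht T q) r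
  have h2 := (((b2.symm hT.refl).trans ((h.refl hS hT).symm hS.refl)).trans a2).below_refl b1 a1 h1
  rwa [reflRegion_reflRegion, ← hT.pushDown_eq_refl, ← hS.pushDown_eq_refl] at h2

/-- If the downward movement at a local maximum of the upper tiling is blocked by the boundary, then
so is that of the lower tiling. -/
theorem Compat.blocked_down (h : Compat R S T) (hS : IsTiling R S) (hT : IsTiling R T)
    (hb : Below R S T) {q : Edge × ℕ} (hq : q ∈ sites R S) (hm : LocMax T (col q) (ht T q))
    (hno : ∀ k, ¬ IsTowerDown T (col q) (ht T q) k) :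
    LocMax S (col q) (ht S q) ∧ ∀ k, ¬ IsTowerDown S (col q) (ht S q) k := by
  have hqT : q ∈ sites R T := h.sites_eq ▸ hq
  have h1 := ((h.refl hS hT).symm hS.refl).blocked hT.refl hS.refl (h.below_refl hS hT hb)
    (hT.mem_sites_refl.2 hqT)
  rw [col_reflSite, hT.ht_refl hqT, hS.ht_refl hq] at h1
  simp only [← isTowerDown_iff_refl, ← locMax_iff_refl] at h1
  exact h1 hm hno

/-- A tiling that is not below a compatible tiling can be moved down. -/
theorem exists_lower (hS : IsTiling R S) (hT : IsTiling R T) (h : Compat R S T)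
    (hb : ¬ Below R S T) : ∃ U, IsTiling R U ∧ Compat R S U ∧
      ∑ q ∈ sites R S, ht U q < ∑ q ∈ sites R S, ht S q := by
  have hb' : ¬ Below (reflRegion R) (reflConfig T) (reflConfig S) := fun hcon => hb <| by
    have := ((h.refl hS hT).symm hS.refl).below_refl hT.refl hS.refl hcon
    rwa [reflRegion_reflRegion, reflConfig_reflConfig, reflConfig_reflConfig] at this
  obtain ⟨x, u, hf⟩ := exists_flippable hT.refl hS.refl ((h.refl hS hT).symm hS.refl) hb'
  have h1 := hS.refl.flip hf
  have h2 := hS.refl.compat_flipUp hf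
  have h3 := h1.refl
  have h4 := h2.refl hS.refl h1
  rw [reflRegion_reflRegion] at h3 h4
  rw [reflConfig_reflConfig] at h4
  refine ⟨_, h3, h4, ?_⟩
  have key : ∀ q ∈ sites R S, ht (reflConfig (flipUp (reflConfig S) x u)) q = ht S q -
      if col q = x ∧ col q - ht S q = u then 1 else 0 := by
    intro q hq
    have h5 := hS.mem_sites_refl.2 hq
    have h6 := h1.ht_refl (q := reflSite q) (h2.sites_eq ▸ h5)
    rw [reflSite_reflSite, col_reflSite] at h6
    rw [h6]
    have h7 := mem_sites.1 h5
    have h8 := hS.refl.height_flipUp hf h7.1 h7.2.2.le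
    have h9 := hS.ht_refl hq
    have h10 : (reflSite q).1.1 + ((reflSite q).2 : ℤ) = col q := rfl
    simp only [ht] at h8 h9 ⊢
    rw [h8, h9, h10]
    split_ifs <;> omega
  refine Finset.sum_lt_sum (fun q hq => ?_) ?_
  · rw [key q hq]; split_ifs <;> omega
  · obtain ⟨p, hp, hpc, hpu⟩ := hS.refl.exists_site (hS.refl.not_horiz_of_up hf.1.2)
      (hS.refl.interior_of_locMin hf.1)
    obtain ⟨q, hq, rfl⟩ := hS.exists_reflSite hp
    refine ⟨q, hq, ?_⟩
    rw [hS.ht_refl hq] at hpu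
    rw [key q hq, if_pos ⟨hpc, hpu⟩]
    omega

end Reflection

/-! ### The component of a tiling -/

section Space

variable {R : Region} {T₀ S T : Config} {x u : ℤ} {k : ℕ}

/-- The tilings compatible with `T₀`; they form the component of `T₀`. -/
def Space (R : Region) (T₀ : Config) : Set Config := {T | IsTiling R T ∧ Compat R T₀ T}

theorem Space.compat (hT₀ : IsTiling R T₀) (hS : S ∈ Space R T₀) (hT : T ∈ Space R T₀) :
    Compat R S T :=
  (hS.2.symm hT₀).trans hT.2

theorem Space.sites_eq (hT : T ∈ Space R T₀) : sites R T = sites R T₀ := hT.2.sites_eq.symm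

theorem finite_tilings (R : Region) : {T | IsTiling R T}.Finite := by
  classical
  let f : Triangle → Finset Lozenge
    | .left _ _ => ∅
    | .right x u => {.horiz x u, .up x u, .down x u}
  refine (R.biUnion f).powerset.finite_toSet.subset fun T hT => ?_
  rw [Finset.mem_coe, Finset.mem_powerset]
  intro l hl
  rw [Finset.mem_biUnion]
  cases l with
  | horiz x u => exact ⟨.right x u, hT.1 _ hl (by simp [Lozenge.cells]), by simp [f]⟩
  | up x u => exact ⟨.right x u, hT.1 _ hl (by simp [Lozenge.cells]), by simp [f]⟩
  | down x u => exact ⟨.right x u, hT.1 _ hl (by simp [Lozenge.cells]), by simp [f]⟩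

theorem finite_space (R : Region) (T₀ : Config) : (Space R T₀).Finite :=
  (finite_tilings R).subset fun _ h => h.1

/-- The sum of the heights, weighted by a function of the column. -/
noncomputable def potential (R : Region) (T₀ : Config) (w : ℤ → ℝ) (T : Config) : ℝ :=
  ∑ q ∈ sites R T₀, w (col q) * (ht T q : ℝ)

theorem Space.flip (hT : T ∈ Space R T₀) (h : Flippable T x u) : flipUp T x u ∈ Space R T₀ :=
  ⟨hT.1.flip h, hT.2.trans (hT.1.compat_flipUp h)⟩

/-- By disjointness of the paths exactly one site sits at `(x, u)`, and its height rises by one. -/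
theorem Space.potential_flip (w : ℤ → ℝ) (hT : T ∈ Space R T₀) (h : Flippable T x u) :
    potential R T₀ w (flipUp T x u) = potential R T₀ w T + w x := by
  obtain ⟨p, hp, hpc, hpu⟩ := hT.1.exists_site (hT.1.not_horiz_of_up h.1.2)
    (hT.1.interior_of_locMin h.1)
  have e : ∀ q ∈ sites R T₀, w (col q) * (ht (flipUp T x u) q : ℝ) =
      w (col q) * (ht T q : ℝ) + if q = p then w x else 0 := by
    intro q hq
    rw [← Space.sites_eq hT] at hq
    have h1 := mem_sites.1 hq
    have h2 : ht (flipUp T x u) q = _ := hT.1.height_flipUp h h1.1 h1.2.2.le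
    rw [h2]
    by_cases hqp : q = p
    · subst hqp
      rw [if_pos ⟨hpc, hpu⟩, if_pos rfl, hpc]
      simp only [ht]
      push_cast
      ring
    · rw [if_neg, if_neg hqp]
      · simp [ht]
      · rintro ⟨h3, h4⟩
        exact hqp (hT.1.site_unique hq hp (h3.trans hpc.symm) (h4.trans hpu.symm))
  rw [potential, Finset.sum_congr rfl e, Finset.sum_add_distrib, Finset.sum_ite_eq',
    if_pos (Space.sites_eq hT ▸ hp), potential]

theorem Space.potential_tower (w : ℤ → ℝ) (hT : T ∈ Space R T₀) (h : IsTowerUp T x u k) :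
    potential R T₀ w (towerUp T x u k) = potential R T₀ w T + (k + 1) * w x := by
  induction k generalizing T with
  | zero =>
    rw [towerUp, Space.potential_flip w hT (isTowerUp_zero.1 h)]
    push_cast; ring
  | succ k ih =>
    have hf := h.flippable
    push_cast at hf
    rw [towerUp, ih (Space.flip hT hf) h.flip, Space.potential_flip w hT hf]
    push_cast; ring

theorem potential_refl (w : ℤ → ℝ) (hT₀ : IsTiling R T₀) (hT : T ∈ Space R T₀) :
    potential (reflRegion R) (reflConfig T₀) w (reflConfig T) =
      ∑ q ∈ sites R T₀, w (col q) * col q - potential R T₀ w T := by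
  classical
  have e : sites (reflRegion R) (reflConfig T₀) = (sites R T₀).image reflSite := by
    ext q
    constructor
    · intro hq
      obtain ⟨q', hq', rfl⟩ := hT₀.exists_reflSite hq
      exact Finset.mem_image_of_mem _ hq'
    · intro hq
      obtain ⟨q', hq', rfl⟩ := Finset.mem_image.1 hq
      exact hT₀.mem_sites_refl.2 hq'
  rw [potential, e, Finset.sum_image fun a _ b _ hab => by
    rw [← reflSite_reflSite a, hab, reflSite_reflSite], potential, ← Finset.sum_sub_distrib]
  refine Finset.sum_congr rfl fun q hq => ?_
  rw [hT.1.ht_refl (Space.sites_eq hT ▸ hq), col_reflSite]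
  push_cast; ring

theorem Space.refl (hT₀ : IsTiling R T₀) (hT : T ∈ Space R T₀) :
    reflConfig T ∈ Space (reflRegion R) (reflConfig T₀) :=
  ⟨hT.1.refl, hT.2.refl hT₀ hT.1⟩

theorem Space.pushUp (hT : T ∈ Space R T₀) (r : unitInterval) : pushUp r T x u ∈ Space R T₀ :=
  ⟨(hT.1.push r).1, hT.2.trans (hT.1.push r).2⟩

theorem Space.pushDown (hT : T ∈ Space R T₀) (r : unitInterval) : pushDown r T x u ∈ Space R T₀ :=
  ⟨(hT.1.pushDown r).1, hT.2.trans (hT.1.pushDown r).2⟩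

/-- A tiling with maximal height sum admits no flip up, hence lies above every compatible tiling by
`exists_flippable`. -/
theorem exists_top (hT₀ : IsTiling R T₀) :
    ∃ top ∈ Space R T₀, ∀ T ∈ Space R T₀, Below R T top := by
  obtain ⟨M, hM, hmax⟩ := (finite_space R T₀).exists_maximalFor (potential R T₀ 1) _
    ⟨T₀, hT₀, hT₀.compat_refl⟩
  refine ⟨M, hM, fun T hT => ?_⟩
  by_contra hb
  obtain ⟨x, u, hf⟩ := exists_flippable hT.1 hM.1 (Space.compat hT₀ hT hM) hb
  have h1 := Space.potential_flip 1 hM hf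
  have := hmax (Space.flip hM hf) (by rw [h1]; simp)
  rw [h1] at this
  norm_num at this

theorem exists_bot (hT₀ : IsTiling R T₀) :
    ∃ bot ∈ Space R T₀, ∀ T ∈ Space R T₀, Below R bot T := by
  obtain ⟨M, hM, hmin⟩ := (finite_space R T₀).exists_minimalFor
    (fun T => ∑ q ∈ sites R T₀, ht T q) _ ⟨T₀, hT₀, hT₀.compat_refl⟩
  refine ⟨M, hM, fun T hT => ?_⟩
  by_contra hb
  obtain ⟨U, hU, hc, hlt⟩ := exists_lower hM.1 hT.1 (Space.compat hT₀ hM hT) hb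
  rw [Space.sites_eq hM] at hlt
  exact (hmin (j := U) ⟨hU, hM.2.trans hc⟩ hlt.le).not_gt hlt

theorem LocalUp.exists_flippable (h : LocalUp R S T) :
    ∃ x u, Flippable S x u ∧ T = flipUp S x u := by
  obtain ⟨-, -, x, u, h1, h2⟩ := h
  exact ⟨x, u, flippable_iff_subset.2 h1, h2⟩

theorem LocalUp.compat (h : LocalUp R S T) : Compat R S T := by
  obtain ⟨x, u, h1, rfl⟩ := h.exists_flippable
  exact h.1.compat_flipUp h1

theorem moveGraph_adj_of_flippable (hT : IsTiling R T) (h : Flippable T x u) :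
    (moveGraph R).Adj T (flipUp T x u) := by
  rw [moveGraph, SimpleGraph.fromRel_adj]
  refine ⟨fun he => ?_, Or.inl (hT.localUp h)⟩
  have : Lozenge.horiz x u ∈ flipUp T x u := horiz_mem_flipUp.2 (Or.inr ⟨rfl, rfl⟩)
  rw [← he] at this
  exact hT.not_horiz_of_up h.1.2 this

theorem Space.adj (hS : S ∈ Space R T₀) (h : (moveGraph R).Adj S T) :
    T ∈ Space R T₀ ∧ potential R T₀ 1 T ≤ potential R T₀ 1 S + 1 := by
  rw [moveGraph, SimpleGraph.fromRel_adj] at h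
  rcases h.2 with h1 | h1
  · obtain ⟨x, u, h2, rfl⟩ := h1.exists_flippable
    exact ⟨Space.flip hS h2, by rw [Space.potential_flip 1 hS h2]; simp⟩
  · have hT : T ∈ Space R T₀ := ⟨h1.1, hS.2.trans (h1.compat.symm h1.1)⟩
    refine ⟨hT, ?_⟩
    obtain ⟨x, u, h2, rfl⟩ := h1.exists_flippable
    rw [Space.potential_flip 1 hT h2]
    simp only [Pi.one_apply]
    linarith

theorem Space.walk (p : (moveGraph R).Walk S T) (hS : S ∈ Space R T₀) :
    T ∈ Space R T₀ ∧ potential R T₀ 1 T ≤ potential R T₀ 1 S + p.length := by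
  induction p with
  | nil => exact ⟨hS, by simp⟩
  | cons h p ih =>
    obtain ⟨h1, h2⟩ := Space.adj hS h
    obtain ⟨h3, h4⟩ := ih h1
    refine ⟨h3, ?_⟩
    rw [SimpleGraph.Walk.length_cons]
    push_cast
    linarith

/-- Among the tilings reachable from `T`, one with the largest height sum admits no flip up, so it
lies above the top tiling and equals it. -/
theorem Space.reachable_top (hT₀ : IsTiling R T₀) {top : Config} (htop : top ∈ Space R T₀)
    (hmax : ∀ T ∈ Space R T₀, Below R T top) (hT : T ∈ Space R T₀) :
    (moveGraph R).Reachable T top := by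
  have hfin : {M | M ∈ Space R T₀ ∧ (moveGraph R).Reachable T M}.Finite :=
    (finite_space R T₀).subset fun _ h => h.1
  obtain ⟨M, hM, hmaxM⟩ := hfin.exists_maximalFor (potential R T₀ 1) _
    ⟨T, hT, SimpleGraph.Reachable.refl T⟩
  have hc := Space.compat hT₀ htop hM.1
  suffices h : top = M by rw [h]; exact hM.2
  refine hc.eq_of_below htop.1 hM.1.1 ?_ (hmax M hM.1)
  by_contra hb
  obtain ⟨x, u, hf⟩ := Lozenges.exists_flippable htop.1 hM.1.1 hc hb
  have h1 := Space.potential_flip 1 hM.1 hf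
  have := hmaxM (j := flipUp M x u)
    ⟨Space.flip hM.1 hf, hM.2.trans (moveGraph_adj_of_flippable hM.1.1 hf).reachable⟩
    (by rw [h1]; simp)
  rw [h1] at this
  norm_num at this

/-- Local moves preserve compatibility, and any two compatible tilings are connected through the
top. -/
theorem component_eq (hT₀ : IsTiling R T₀) : component R T₀ = Space R T₀ := by
  have h₀ : T₀ ∈ Space R T₀ := ⟨hT₀, hT₀.compat_refl⟩
  ext T
  constructor
  · rintro ⟨p⟩
    exact (Space.walk p h₀).1
  · intro hT
    obtain ⟨top, htop, hmax⟩ := exists_top hT₀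
    exact (Space.reachable_top hT₀ htop hmax h₀).trans
      (Space.reachable_top hT₀ htop hmax hT).symm

/-- The total difference of the heights is at most the number of local moves. -/
theorem Space.potential_sub_le_dist (hT₀ : IsTiling R T₀) (hS : S ∈ Space R T₀)
    (hT : T ∈ Space R T₀) :
    potential R T₀ 1 T - potential R T₀ 1 S ≤ ((moveGraph R).dist S T : ℝ) := by
  rw [← component_eq hT₀] at hT
  have hS' := hS
  rw [← component_eq hT₀] at hS'
  obtain ⟨p, hp⟩ := (hS'.symm.trans hT).exists_walk_length_eq_dist
  have := (Space.walk p hS).2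
  rw [hp] at this
  linarith

end Space

/-! ### The drift of the potential -/

section Drift

variable {R : Region} {T₀ S T : Config} {x u : ℤ} {k : ℕ}

open Classical in
/-- Whether the path through `(x, u)` can be pushed up, possibly together with other paths. -/
noncomputable def upInd (T : Config) (x u : ℤ) : ℤ := if ∃ k, IsTowerUp T x u k then 1 else 0

open Classical in
/-- Whether the path through `(x, u)` can be pushed down, possibly together with other paths. -/
noncomputable def downInd (T : Config) (x u : ℤ) : ℤ := if ∃ k, IsTowerDown T x u k then 1 else 0

theorem ite_le_eq_indicator (c A B : ℝ) :
    (fun r : unitInterval => if (r : ℝ) ≤ c then A else B) = fun r =>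
      B + {r : unitInterval | (r : ℝ) ≤ c}.indicator (fun _ => A - B) r := by
  funext r
  by_cases hr : (r : ℝ) ≤ c
  · rw [if_pos hr, Set.indicator_of_mem (show r ∈ {r : unitInterval | (r : ℝ) ≤ c} from hr)]; ring
  · rw [if_neg hr, Set.indicator_of_notMem (show r ∉ {r : unitInterval | (r : ℝ) ≤ c} from hr)]
    ring

theorem measurableSet_coe_le (c : ℝ) : MeasurableSet {r : unitInterval | (r : ℝ) ≤ c} :=
  measurableSet_le measurable_subtype_coe measurable_const

theorem integrable_ite_le (c A B : ℝ) :
    Integrable (fun r : unitInterval => if (r : ℝ) ≤ c then A else B) := by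
  rw [ite_le_eq_indicator]
  exact (integrable_const _).add ((integrable_const _).indicator (measurableSet_coe_le c))

theorem integral_ite_le {c : ℝ} (h0 : 0 ≤ c) (h1 : c ≤ 1) (A B : ℝ) :
    ∫ r : unitInterval, (if (r : ℝ) ≤ c then A else B) = B + c * (A - B) := by
  have hv : (volume : Measure unitInterval).real {r : unitInterval | (r : ℝ) ≤ c} = c := by
    have e : {r : unitInterval | (r : ℝ) ≤ c} =
        Set.Iic (⟨c, Set.mem_Icc.2 ⟨h0, h1⟩⟩ : unitInterval) := rfl
    rw [e, measureReal_def, unitInterval.volume_Iic, ENNReal.toReal_ofReal h0]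
  rw [ite_le_eq_indicator, integral_add (integrable_const _)
    ((integrable_const _).indicator (measurableSet_coe_le c)),
    integral_indicator_const _ (measurableSet_coe_le c), integral_const, hv]
  simp

theorem pushUp_eq_ite (hT : IsTiling R T) (h : IsTowerUp T x u k) (r : unitInterval) :
    pushUp r T x u = if (r : ℝ) ≤ 1 / ((k : ℝ) + 1) then towerUp T x u k else T := by
  split_ifs with hr
  · exact pushUp_of_tower hT h hr
  · refine pushUp_of_not fun k' h' hr' => hr ?_
    rwa [h.unique hT h']

/-- The reason for the acceptance probability: a tower of `k + 1` points in one column contributes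
`(k + 1) * w x` with probability `1 / (k + 1)`, so the expected change does not depend on `k`. -/
theorem Space.integral_pushUp (w : ℤ → ℝ) (hT : T ∈ Space R T₀) :
    ∫ r : unitInterval, potential R T₀ w (Lozenges.pushUp r T x u) =
      potential R T₀ w T + w x * upInd T x u := by
  by_cases hex : ∃ k, IsTowerUp T x u k
  · obtain ⟨k, hk⟩ := hex
    have e : (fun r : unitInterval => potential R T₀ w (Lozenges.pushUp r T x u)) =
        fun r : unitInterval => if (r : ℝ) ≤ 1 / ((k : ℝ) + 1) then
          potential R T₀ w (towerUp T x u k)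
          else potential R T₀ w T := by
      funext r
      rw [pushUp_eq_ite hT.1 hk]
      exact apply_ite _ _ _ _
    have hk0 : (0 : ℝ) < (k : ℝ) + 1 := by positivity
    rw [e, integral_ite_le (by positivity) (by
      rw [div_le_one hk0]; linarith [(Nat.cast_nonneg k : (0 : ℝ) ≤ k)]),
      Space.potential_tower w hT hk, upInd, if_pos ⟨k, hk⟩]
    field_simp
    push_cast
    ring
  · rw [upInd, if_neg hex]
    simp only [pushUp_of_not fun k hk _ => hex ⟨k, hk⟩]
    simp

theorem downInd_eq_refl : downInd T x u = upInd (reflConfig T) x (x - u) := by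
  have e : (∃ k, IsTowerDown T x u k) ↔ ∃ k, IsTowerUp (reflConfig T) x (x - u) k :=
    exists_congr fun _ => isTowerDown_iff_refl
  by_cases h : ∃ k, IsTowerDown T x u k
  · rw [downInd, upInd, if_pos h, if_pos (e.1 h)]
  · rw [downInd, upInd, if_neg h, if_neg (mt e.2 h)]

theorem Space.integral_pushDown (w : ℤ → ℝ) (hT₀ : IsTiling R T₀) (hT : T ∈ Space R T₀) :
    ∫ r : unitInterval, potential R T₀ w (Lozenges.pushDown r T x u) =
      potential R T₀ w T - w x * downInd T x u := by
  have hT' := Space.refl hT₀ hT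
  have h1 := Space.integral_pushUp (x := x) (u := x - u) w hT'
  have e : (fun r : unitInterval => potential R T₀ w (Lozenges.pushDown r T x u)) = fun r =>
      ∑ q ∈ sites R T₀, w (col q) * col q - potential (reflRegion R) (reflConfig T₀) w
        (Lozenges.pushUp r (reflConfig T) x (x - u)) := by
    funext r
    have h2 := potential_refl w hT₀ (Space.pushDown (x := x) (u := u) hT r)
    rw [hT.1.pushDown_eq_refl, reflConfig_reflConfig] at h2
    rw [hT.1.pushDown_eq_refl, h2]
    ring
  rw [potential_refl w hT₀ hT] at h1
  have hint : Integrable (fun r : unitInterval => potential (reflRegion R) (reflConfig T₀) w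
      (Lozenges.pushUp r (reflConfig T) x (x - u))) := by
    by_cases hex : ∃ k, IsTowerUp (reflConfig T) x (x - u) k
    · obtain ⟨k, hk⟩ := hex
      refine (integrable_ite_le (1 / ((k : ℝ) + 1))
        (potential (reflRegion R) (reflConfig T₀) w (towerUp (reflConfig T) x (x - u) k))
        (potential (reflRegion R) (reflConfig T₀) w (reflConfig T))).congr (ae_of_all _ fun r => ?_)
      dsimp only
      rw [pushUp_eq_ite hT'.1 hk]
      exact (apply_ite _ _ _ _).symm
    · simp only [pushUp_of_not fun k hk _ => hex ⟨k, hk⟩]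
      exact integrable_const _
  rw [e, integral_sub (integrable_const _) hint, h1, downInd_eq_refl]
  simp only [integral_const, probReal_univ, one_smul]
  ring

/-- The difference of the drifts of two ordered tilings at a site is at most the discrete Laplacian
of the difference of the heights. -/
theorem Compat.drift_le (h : Compat R S T) (hS : IsTiling R S) (hT : IsTiling R T)
    (hb : Below R S T) {q : Edge × ℕ} (hq : q ∈ sites R S) :
    upInd T (col q) (ht T q) - downInd T (col q) (ht T q) -
        (upInd S (col q) (ht S q) - downInd S (col q) (ht S q)) ≤
      (height T q.1 (q.2 - 1) - height S q.1 (q.2 - 1)) +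
        (height T q.1 (q.2 + 1) - height S q.1 (q.2 + 1)) - 2 * (ht T q - ht S q) := by
  have hqT := h.sites_eq ▸ hq
  obtain ⟨a1, a2⟩ := hS.site_steps hq
  obtain ⟨b1, b2⟩ := hT.site_steps hqT
  have mS := hS.locMin_iff hq
  have mT := hT.locMin_iff hqT
  have MS := hS.locMax_iff hq
  have MT := hT.locMax_iff hqT
  -- A local minimum has Laplacian `1`, a local maximum `-1`, other points `0`; without blocking the
  -- claim is an equality. Blocking is harmful only for a minimum of `S` or a maximum of `T`, and
  -- then the other tiling is blocked in the same way, so the two effects cancel.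
  have up := h.blocked hS hT hb hq
  have dn := h.blocked_down hS hT hb hq
  have uS : (∃ k, IsTowerUp S (col q) (ht S q) k) → LocMin S (col q) (ht S q) :=
    fun ⟨k, hk⟩ => by simpa using hk.locMin (Nat.zero_le k)
  have uT : (∃ k, IsTowerUp T (col q) (ht T q) k) → LocMin T (col q) (ht T q) :=
    fun ⟨k, hk⟩ => by simpa using hk.locMin (Nat.zero_le k)
  have dS : (∃ k, IsTowerDown S (col q) (ht S q) k) → LocMax S (col q) (ht S q) :=
    fun ⟨k, hk⟩ => by
      have := hk.1 0 (Nat.zero_le k)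
      simpa [LocMax] using this
  have dT : (∃ k, IsTowerDown T (col q) (ht T q) k) → LocMax T (col q) (ht T q) :=
    fun ⟨k, hk⟩ => by
      have := hk.1 0 (Nat.zero_le k)
      simpa [LocMax] using this
  rw [← not_exists, ← not_exists] at up dn
  rw [mS] at uS up
  rw [mT] at uT up
  rw [MS] at dS dn
  rw [MT] at dT dn
  unfold upInd downInd
  generalize (∃ k, IsTowerUp S (col q) (ht S q) k) = US at *
  generalize (∃ k, IsTowerUp T (col q) (ht T q) k) = UT at *
  generalize (∃ k, IsTowerDown S (col q) (ht S q) k) = DS at *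
  generalize (∃ k, IsTowerDown T (col q) (ht T q) k) = DT at *
  clear mS mT MS MT
  by_cases c1 : US <;> by_cases c2 : UT <;> by_cases c3 : DS <;> by_cases c4 : DT <;>
    simp only [c1, c2, c3, c4, if_true, if_false, true_imp_iff, false_imp_iff, not_true_eq_false,
      not_false_eq_true, and_true, and_false, imp_false] at * <;> omega

/-- Summation by parts on a path. -/
theorem sum_mul_neighbors_le {L : ℕ} {v g : ℕ → ℝ} (hv : ∀ n, 0 ≤ v n) (hg : ∀ n ≤ L, 0 ≤ g n)
    (h0 : g 0 = 0) (hL : g L = 0) :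
    ∑ n ∈ Finset.Ioo 0 L, v n * (g (n - 1) + g (n + 1)) ≤
      ∑ n ∈ Finset.Ioo 0 L, g n * (v (n - 1) + v (n + 1)) := by
  cases L with
  | zero => simp
  | succ M =>
    have e : Finset.Ioo 0 (M + 1) = (Finset.range M).map ⟨Nat.succ, Nat.succ_injective⟩ := by
      ext n
      simp only [Finset.mem_Ioo, Finset.mem_map, Finset.mem_range, Function.Embedding.coeFn_mk]
      constructor
      · rintro ⟨h1, h2⟩; exact ⟨n - 1, by omega, by omega⟩
      · rintro ⟨a, h1, rfl⟩; omega
    rw [e, Finset.sum_map, Finset.sum_map, ← sub_nonneg, ← Finset.sum_sub_distrib]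
    simp only [Function.Embedding.coeFn_mk, Nat.succ_eq_add_one, Nat.add_sub_cancel]
    -- The difference of the two sums is a telescoping sum of discrete Wronskians. As `g` vanishes
    -- at both ends, what remains is `g 1 * v 0 + v (M + 1) * g M`, which is nonnegative.
    have h1 := Finset.sum_range_sub' (fun i => g (i + 1) * v i - v (i + 1) * g i) M
    have h2 : ∀ i ∈ Finset.range M, g (i + 1) * (v i + v (i + 1 + 1)) -
        v (i + 1) * (g i + g (i + 1 + 1)) =
        (g (i + 1) * v i - v (i + 1) * g i) -
          (g (i + 1 + 1) * v (i + 1) - v (i + 1 + 1) * g (i + 1)) := fun i _ => by ring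
    rw [Finset.sum_congr rfl h2, h1, hL, h0, zero_mul, mul_zero, zero_sub, sub_zero, sub_neg_eq_add]
    rcases Nat.eq_zero_or_pos M with rfl | hM
    · rw [h0, hL]; simp
    · exact add_nonneg (mul_nonneg (hg _ (by omega)) (hv _)) (mul_nonneg (hv _) (hg _ (by omega)))

theorem sum_sites (R : Region) (T₀ : Config) (f : Edge × ℕ → ℝ) :
    ∑ q ∈ sites R T₀, f q =
      ∑ s ∈ starts R, ∑ n ∈ Finset.Ioo 0 (length R T₀ s), f (s, n) := by
  rw [sites, Finset.sum_biUnion]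
  · refine Finset.sum_congr rfl fun s _ => ?_
    rw [Finset.sum_product, Finset.sum_singleton]
  · intro a _ b _ hab
    rw [Function.onFun, Finset.disjoint_left]
    intro q hq hq'
    simp only [Finset.mem_product, Finset.mem_singleton] at hq hq'
    exact hab (hq.1.symm.trans hq'.1)

/-- The total drift of the potential, up to the factor `2 * p`. -/
noncomputable def drift (R : Region) (T₀ : Config) (w : ℤ → ℝ) (T : Config) : ℝ :=
  ∑ q ∈ sites R T₀, w (col q) * ((upInd T (col q) (ht T q) : ℝ) - downInd T (col q) (ht T q))

/-- The drift difference is at most the weighted Laplacian of the height difference `g`; since `g`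
vanishes at the endpoints of each path, the neighbour sums can be moved from `g` to the weights. The
inequality on the weights is needed only where `g` is positive. -/
theorem Space.drift_sub_le {w : ℤ → ℝ} {lam : ℝ} (hT₀ : IsTiling R T₀) (hS : S ∈ Space R T₀)
    (hT : T ∈ Space R T₀) (hb : Below R S T) (hw : ∀ x, 0 ≤ w x)
    (hlam : ∀ q ∈ sites R T₀, ht S q < ht T q →
      (w (col q - 1) + w (col q + 1)) / 2 ≤ (1 - lam) * w (col q)) :
    drift R T₀ w T - drift R T₀ w S ≤
      -(2 * lam) * (potential R T₀ w T - potential R T₀ w S) := by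
  have hc := Space.compat hT₀ hS hT
  have hsS := Space.sites_eq hS
  let g : Edge → ℕ → ℝ := fun s n => (height T s n : ℝ) - height S s n
  have h1 : drift R T₀ w T - drift R T₀ w S ≤ ∑ q ∈ sites R T₀,
      w (col q) * (g q.1 (q.2 - 1) + g q.1 (q.2 + 1) - 2 * g q.1 q.2) := by
    rw [drift, drift, ← Finset.sum_sub_distrib]
    refine Finset.sum_le_sum fun q hq => ?_
    rw [← mul_sub]
    refine mul_le_mul_of_nonneg_left ?_ (hw _)
    have := hc.drift_le hS.1 hT.1 hb (hsS ▸ hq)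
    have h2 : ((_ : ℤ) : ℝ) ≤ ((_ : ℤ) : ℝ) := Int.cast_le.2 this
    push_cast at h2
    exact h2
  have h2 : ∑ q ∈ sites R T₀, w (col q) * (g q.1 (q.2 - 1) + g q.1 (q.2 + 1)) ≤
      ∑ q ∈ sites R T₀, g q.1 q.2 * (w (col q - 1) + w (col q + 1)) := by
    rw [sum_sites, sum_sites]
    refine Finset.sum_le_sum fun s hs => ?_
    have hlen : length R T₀ s = length R S s := hS.2.len s hs
    have key := sum_mul_neighbors_le (L := length R T₀ s) (v := fun n => w (s.1 + n)) (g := g s)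
      (fun n => hw _) (fun n hn => sub_nonneg.2 (Int.cast_le.2 (hb s hs n (hlen ▸ hn))))
      (by simp [g, height]) (by
        simp only [g]
        rw [hlen, hc.last s hs, sub_self])
    refine key.trans_eq (Finset.sum_congr rfl fun n hn => ?_)
    have hn0 := (Finset.mem_Ioo.1 hn).1
    simp only [col]
    push_cast [Nat.cast_sub (show 1 ≤ n from hn0)]
    ring_nf
  have h3 : ∑ q ∈ sites R T₀, g q.1 q.2 * (w (col q - 1) + w (col q + 1)) ≤
      ∑ q ∈ sites R T₀, (2 - 2 * lam) * (w (col q) * g q.1 q.2) := by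
    refine Finset.sum_le_sum fun q hq => ?_
    have hq' := mem_sites.1 (hsS.symm ▸ hq)
    have hle : ht S q ≤ ht T q := hb q.1 hq'.1 q.2 hq'.2.2.le
    rcases hle.eq_or_lt with he | hlt
    · have : g q.1 q.2 = 0 := by
        simp only [g, ht] at *
        rw [he, sub_self]
      rw [this]; simp
    · have hg : 0 ≤ g q.1 q.2 := sub_nonneg.2 (Int.cast_le.2 hle)
      have := mul_le_mul_of_nonneg_left (hlam q hq hlt) hg
      linarith
  have h4 : potential R T₀ w T - potential R T₀ w S = ∑ q ∈ sites R T₀, w (col q) * g q.1 q.2 := by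
    rw [potential, potential, ← Finset.sum_sub_distrib]
    refine Finset.sum_congr rfl fun q _ => ?_
    simp only [g, ht]
    ring
  have h5 : ∑ q ∈ sites R T₀, w (col q) * (g q.1 (q.2 - 1) + g q.1 (q.2 + 1) - 2 * g q.1 q.2) =
      ∑ q ∈ sites R T₀, w (col q) * (g q.1 (q.2 - 1) + g q.1 (q.2 + 1)) -
        2 * ∑ q ∈ sites R T₀, w (col q) * g q.1 q.2 := by
    rw [Finset.mul_sum, ← Finset.sum_sub_distrib]
    refine Finset.sum_congr rfl fun q _ => ?_
    ring
  rw [← Finset.mul_sum] at h3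
  rw [h4]
  linarith

end Drift

/-! ### Measurability and the contraction estimate -/

section Measurability

instance : MeasurableSpace (Finset Lozenge) := ⊤

instance : DiscreteMeasurableSpace (Finset Lozenge) := ⟨fun _ => trivial⟩

/-- Makes `Config` countable, so that functions of random choices and a configuration can be checked
for measurability one configuration at a time. -/
instance : Countable Lozenge := by
  let f : Lozenge → Fin 3 × ℤ × ℤ
    | .horiz x u => (0, x, u)
    | .up x u => (1, x, u)
    | .down x u => (2, x, u)
  refine Function.Injective.countable (f := f) fun a b hab => ?_
  cases a <;> cases b <;> simp [f] at hab ⊢ <;> exact hab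

variable {R : Region} {T₀ S T : Config}

theorem step_eq (a : Update R T₀) (T : Config) :
    step a T = if a.1.2 = true then pushUp a.2 T (col a.1.1.1) (ht T a.1.1.1)
      else pushDown a.2 T (col a.1.1.1) (ht T a.1.1.1) := by
  obtain ⟨⟨q, b⟩, r⟩ := a
  cases b <;> rfl

theorem Space.step (hT : T ∈ Space R T₀) (a : Update R T₀) : step a T ∈ Space R T₀ := by
  rw [step_eq]
  split_ifs
  · exact Space.pushUp hT _
  · exact Space.pushDown hT _

theorem Space.step_below (hT₀ : IsTiling R T₀) (hS : S ∈ Space R T₀) (hT : T ∈ Space R T₀)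
    (hb : Below R S T) (a : Update R T₀) : Below R (Lozenges.step a S) (Lozenges.step a T) := by
  have hc := Space.compat hT₀ hS hT
  have hq : a.1.1.1 ∈ sites R S := by
    rw [Space.sites_eq hS]
    exact a.1.1.2
  rw [step_eq, step_eq]
  split_ifs
  · exact hc.below_pushUp hS.1 hT.1 hb hq _
  · exact hc.below_pushDown hS.1 hT.1 hb hq _

theorem Space.run (hT : T ∈ Space R T₀) {t : ℕ} (ω : Fin t → Update R T₀) :
    run t ω T ∈ Space R T₀ := by
  induction t with
  | zero => exact hT
  | succ t ih => exact Space.step (ih _) _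

theorem Space.run_below (hT₀ : IsTiling R T₀) (hS : S ∈ Space R T₀) (hT : T ∈ Space R T₀)
    (hb : Below R S T) {t : ℕ} (ω : Fin t → Update R T₀) :
    Below R (Lozenges.run t ω S) (Lozenges.run t ω T) := by
  induction t with
  | zero => exact hb
  | succ t ih => exact Space.step_below hT₀ (Space.run hS _) (Space.run hT _) (ih _) _

theorem IsTiling.measurable_pushUp (hT : IsTiling R T) (x u : ℤ) :
    Measurable fun r : unitInterval => pushUp r T x u := by
  by_cases hex : ∃ k, IsTowerUp T x u k
  · obtain ⟨k, hk⟩ := hex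
    simp only [pushUp_eq_ite hT hk]
    exact Measurable.ite (measurableSet_coe_le _) measurable_const measurable_const
  · simp only [pushUp_of_not fun k hk _ => hex ⟨k, hk⟩]
    exact measurable_const

theorem IsTiling.measurable_pushDown (hT : IsTiling R T) (x u : ℤ) :
    Measurable fun r : unitInterval => Lozenges.pushDown r T x u := by
  simp only [hT.pushDown_eq_refl]
  exact (measurable_of_countable reflConfig).comp (hT.refl.measurable_pushUp _ _)

theorem IsTiling.measurable_step (hT : IsTiling R T) :
    Measurable fun a : Update R T₀ => step a T := by
  refine measurable_from_prod_countable_right fun i => ?_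
  simp only [step_eq]
  split_ifs
  · exact hT.measurable_pushUp _ _
  · exact hT.measurable_pushDown _ _

open Classical in
-- Measurability of a step is known at tilings only. Replacing it by the identity elsewhere gives a
-- jointly measurable map, and the chain never leaves `Space R T₀`.
theorem measurable_step_ite :
    Measurable fun z : Update R T₀ × Config =>
      if z.2 ∈ Space R T₀ then step z.1 z.2 else z.2 := by
  refine measurable_from_prod_countable_left fun T => ?_
  dsimp only
  split_ifs with hT
  · exact hT.1.measurable_step
  · exact measurable_const

theorem Space.measurable_run (hT : T ∈ Space R T₀) (t : ℕ) :
    Measurable fun ω : Fin t → Update R T₀ => Lozenges.run t ω T := by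
  classical
  induction t with
  | zero => exact measurable_const
  | succ t ih =>
    have h1 : Measurable fun ω : Fin (t + 1) → Update R T₀ =>
        (ω (Fin.last t), Lozenges.run t (fun i => ω i.castSucc) T) :=
      (measurable_pi_apply _).prodMk
        (ih.comp (measurable_pi_lambda _ fun i => measurable_pi_apply _))
    have h2 := measurable_step_ite.comp h1
    have e : ((fun z : Update R T₀ × Config => if z.2 ∈ Space R T₀ then Lozenges.step z.1 z.2
        else z.2) ∘ fun ω : Fin (t + 1) → Update R T₀ =>
          (ω (Fin.last t), Lozenges.run t (fun i => ω i.castSucc) T)) =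
        fun ω => Lozenges.run (t + 1) ω T := by
      funext ω
      exact if_pos (Space.run hT _)
    rwa [e] at h2

theorem isProbabilityMeasure_updateLaw (hp : (sites R T₀).Nonempty) :
    IsProbabilityMeasure (updateLaw R T₀) := by
  obtain ⟨q, hq⟩ := hp
  have : Nonempty {q // q ∈ sites R T₀} := ⟨⟨q, hq⟩⟩
  unfold updateLaw
  infer_instance

theorem integral_uniformOn_univ {ι : Type*} [Fintype ι] [Nonempty ι] [MeasurableSpace ι]
    [MeasurableSingletonClass ι] (f : ι → ℝ) :
    ∫ i, f i ∂(uniformOn (Set.univ : Set ι)) = (∑ i, f i) / Fintype.card ι := by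
  rw [integral_fintype (.of_finite), Finset.sum_div]
  refine Finset.sum_congr rfl fun i _ => ?_
  rw [measureReal_def, uniformOn_univ, Measure.count_singleton, smul_eq_mul, ENNReal.toReal_div]
  simp
  ring

theorem Space.exists_potential_bound (R : Region) (T₀ : Config) (w : ℤ → ℝ) :
    ∃ C, ∀ T ∈ Space R T₀, |potential R T₀ w T| ≤ C := by
  obtain ⟨C, hC⟩ := ((finite_space R T₀).image fun T => |potential R T₀ w T|).bddAbove
  exact ⟨C, fun T hT => hC (Set.mem_image_of_mem _ hT)⟩

theorem Space.integrable_potential_step (w : ℤ → ℝ) (hp : (sites R T₀).Nonempty)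
    (hT : T ∈ Space R T₀) :
    Integrable (fun a => potential R T₀ w (Lozenges.step a T)) (updateLaw R T₀) := by
  have := isProbabilityMeasure_updateLaw hp
  obtain ⟨C, hC⟩ := Space.exists_potential_bound R T₀ w
  refine Integrable.of_bound ?_ C (ae_of_all _ fun a => hC _ (Space.step hT a))
  exact ((measurable_of_countable (potential R T₀ w)).comp
    hT.1.measurable_step).aestronglyMeasurable

/-- Averages the expected changes over the `2 * p` equally likely pairs of a site and a direction.
-/
theorem Space.integral_potential_step (w : ℤ → ℝ) (hT₀ : IsTiling R T₀)
    (hp : (sites R T₀).Nonempty) (hT : T ∈ Space R T₀) :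
    ∫ a, potential R T₀ w (Lozenges.step a T) ∂(updateLaw R T₀) =
      potential R T₀ w T + drift R T₀ w T / (2 * (sites R T₀).card) := by
  have hint := Space.integrable_potential_step w hp hT
  have hcard : ((sites R T₀).card : ℝ) ≠ 0 := by exact_mod_cast hp.card_pos.ne'
  have : Nonempty {q // q ∈ sites R T₀} := ⟨⟨hp.choose, hp.choose_spec⟩⟩
  rw [updateLaw] at hint ⊢
  rw [integral_prod _ hint, integral_uniformOn_univ, Fintype.sum_prod_type]
  have e : ∀ q : {q // q ∈ sites R T₀}, ∑ b : Bool, ∫ r : unitInterval,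
      potential R T₀ w (Lozenges.step (((q, b), r) : Update R T₀) T) =
      2 * potential R T₀ w T + w (col q.1) * ((upInd T (col q.1) (ht T q.1) : ℝ) -
        downInd T (col q.1) (ht T q.1)) := by
    intro q
    rw [Fintype.sum_bool]
    simp only [step_eq, if_true, Bool.false_eq_true, if_false]
    rw [Space.integral_pushUp w hT, Space.integral_pushDown w hT₀ hT]
    ring
  rw [Finset.sum_congr rfl fun q _ => e q, Finset.sum_add_distrib, Finset.sum_const,
    Finset.card_univ, Fintype.card_prod, Fintype.card_bool, Fintype.card_coe, drift,
    ← Finset.sum_coe_sort (sites R T₀)]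
  simp only [nsmul_eq_mul]
  push_cast
  field_simp

/-- The expected weighted difference of two ordered tilings contracts in each step. -/
theorem Space.lintegral_step_le {w : ℤ → ℝ} {lam : ℝ} (hT₀ : IsTiling R T₀)
    (hp : (sites R T₀).Nonempty) (hS : S ∈ Space R T₀)
    (hT : T ∈ Space R T₀) (hb : Below R S T) (hw : ∀ x, 0 ≤ w x)
    (hlam : ∀ q ∈ sites R T₀, ht S q < ht T q →
      (w (col q - 1) + w (col q + 1)) / 2 ≤ (1 - lam) * w (col q)) :
    ∫⁻ a, ENNReal.ofReal (potential R T₀ w (Lozenges.step a T) -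
        potential R T₀ w (Lozenges.step a S)) ∂(updateLaw R T₀) ≤
      ENNReal.ofReal ((1 - lam / (sites R T₀).card) *
        (potential R T₀ w T - potential R T₀ w S)) := by
  have iS := Space.integrable_potential_step w hp hS
  have iT := Space.integrable_potential_step w hp hT
  have mono : ∀ U V, U ∈ Space R T₀ → Below R U V →
      potential R T₀ w U ≤ potential R T₀ w V := by
    intro U V hU hUV
    refine Finset.sum_le_sum fun q hq => mul_le_mul_of_nonneg_left ?_ (hw _)
    have h := mem_sites.1 (Space.sites_eq hU ▸ hq)
    exact Int.cast_le.2 (hUV _ h.1 _ h.2.2.le)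
  -- Monotonicity of the coupling makes the integrand nonnegative, so the lower integral is the
  -- ordinary one.
  refine (ofReal_integral_eq_lintegral_ofReal (iT.sub iS) (ae_of_all _ fun a => sub_nonneg.2
    (mono _ _ (Space.step hS a) (Space.step_below hT₀ hS hT hb a)))).symm.trans_le ?_
  refine ENNReal.ofReal_le_ofReal ?_
  have h1 := Space.drift_sub_le hT₀ hS hT hb hw hlam
  have hcard : (0 : ℝ) < (sites R T₀).card := by exact_mod_cast hp.card_pos
  simp only [Pi.sub_apply]
  rw [integral_sub iT iS, Space.integral_potential_step w hT₀ hp hT,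
    Space.integral_potential_step w hT₀ hp hS]
  have h2 := div_le_div_of_nonneg_right h1 (show (0 : ℝ) ≤ 2 * (sites R T₀).card by positivity)
  rw [sub_div] at h2
  have e : -(2 * lam) * (potential R T₀ w T - potential R T₀ w S) / (2 * (sites R T₀).card) =
      -(lam / (sites R T₀).card) * (potential R T₀ w T - potential R T₀ w S) := by
    field_simp
  rw [e] at h2
  linarith

/-- Tonelli's theorem with the last step split off, which is the Markov property needed below. -/
theorem lintegral_runLaw_succ (hp : (sites R T₀).Nonempty) {t : ℕ}
    {f : Update R T₀ × (Fin t → Update R T₀) → ENNReal} (hf : Measurable f) :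
    ∫⁻ ω, f (ω (Fin.last t), fun i => ω i.castSucc) ∂(runLaw R T₀ (t + 1)) =
      ∫⁻ ω, ∫⁻ a, f (a, ω) ∂(updateLaw R T₀) ∂(runLaw R T₀ t) := by
  have := isProbabilityMeasure_updateLaw hp
  have h1 := (measurePreserving_piFinSuccAbove (fun _ : Fin (t + 1) => updateLaw R T₀)
    (Fin.last t)).lintegral_comp hf
  have h2 := lintegral_prod_symm' (μ := updateLaw R T₀)
    (ν := Measure.pi fun _ : Fin t => updateLaw R T₀) f hf
  rw [h2] at h1
  simp only [runLaw]
  rw [← h1]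
  refine lintegral_congr fun ω => ?_
  congr 1
  refine Prod.ext rfl (funext fun i => ?_)
  simp [MeasurableEquiv.piFinSuccAbove, Fin.insertNthEquiv, Fin.init]

/-- Iterates the one-step contraction. The two extreme copies stay between `bot` and `top`, so sites
where they differ are sites where `bot` and `top` differ, and one condition on the weights serves
for all times. -/
theorem Space.lintegral_run_le {w : ℤ → ℝ} {lam : ℝ} (hT₀ : IsTiling R T₀)
    (hp : (sites R T₀).Nonempty) {bot top : Config} (hbot : bot ∈ Space R T₀)
    (htop : top ∈ Space R T₀)
    (hall : ∀ T ∈ Space R T₀, Below R bot T ∧ Below R T top) (hw : ∀ x, 0 ≤ w x)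
    (hlam1 : lam ≤ 1)
    (hlam : ∀ q ∈ sites R T₀, ht bot q < ht top q →
      (w (col q - 1) + w (col q + 1)) / 2 ≤ (1 - lam) * w (col q)) (t : ℕ) :
    ∫⁻ ω, ENNReal.ofReal (potential R T₀ w (Lozenges.run t ω top) -
        potential R T₀ w (Lozenges.run t ω bot)) ∂(runLaw R T₀ t) ≤
      ENNReal.ofReal ((1 - lam / (sites R T₀).card) ^ t *
        (potential R T₀ w top - potential R T₀ w bot)) := by
  classical
  have := isProbabilityMeasure_updateLaw hp
  have hcard : (1 : ℝ) ≤ (sites R T₀).card := by exact_mod_cast hp.card_pos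
  have hc0 : 0 ≤ 1 - lam / (sites R T₀).card := by
    rw [sub_nonneg, div_le_one (by linarith)]
    linarith
  induction t with
  | zero =>
    have : IsProbabilityMeasure (runLaw R T₀ 0) := by unfold runLaw; infer_instance
    simp [Lozenges.run]
  | succ t ih =>
    let g : Update R T₀ → Config → Config := fun a T => if T ∈ Space R T₀ then
      Lozenges.step a T else T
    let f : Update R T₀ × (Fin t → Update R T₀) → ENNReal := fun z =>
      ENNReal.ofReal (potential R T₀ w (g z.1 (Lozenges.run t z.2 top)) -
        potential R T₀ w (g z.1 (Lozenges.run t z.2 bot)))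
    have hg : ∀ U ∈ Space R T₀, Measurable fun z : Update R T₀ × (Fin t → Update R T₀) =>
        potential R T₀ w (g z.1 (Lozenges.run t z.2 U)) := fun U hU =>
      (measurable_of_countable (potential R T₀ w)).comp (measurable_step_ite.comp
        (measurable_fst.prodMk ((Space.measurable_run hU t).comp measurable_snd)))
    have hf : Measurable f := ((hg top htop).sub (hg bot hbot)).ennreal_ofReal
    have e : ∀ ω : Fin (t + 1) → Update R T₀, ENNReal.ofReal (potential R T₀ w
        (Lozenges.run (t + 1) ω top) - potential R T₀ w (Lozenges.run (t + 1) ω bot)) =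
        f (ω (Fin.last t), fun i => ω i.castSucc) := by
      intro ω
      simp only [f, g, if_pos (Space.run htop _), if_pos (Space.run hbot _)]
      rfl
    rw [lintegral_congr e, lintegral_runLaw_succ hp hf]
    have hstep : ∀ ω : Fin t → Update R T₀, ∫⁻ a, f (a, ω) ∂(updateLaw R T₀) ≤
        ENNReal.ofReal (1 - lam / (sites R T₀).card) * ENNReal.ofReal (potential R T₀ w
          (Lozenges.run t ω top) - potential R T₀ w (Lozenges.run t ω bot)) := by
      intro ω
      have hS := Space.run hbot ω
      have hT := Space.run htop ω
      simp only [f, g, if_pos hT, if_pos hS]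
      rw [← ENNReal.ofReal_mul hc0]
      refine Space.lintegral_step_le hT₀ hp hS hT
        (Space.run_below hT₀ hbot htop (hall _ htop).1 ω) hw fun q hq hlt => hlam q hq ?_
      have h1 := mem_sites.1 (Space.sites_eq hbot ▸ hq)
      have h2 := mem_sites.1 (Space.sites_eq hT ▸ hq)
      have h3 : ht bot q ≤ ht (Lozenges.run t ω bot) q := (hall _ hS).1 _ h1.1 _ h1.2.2.le
      have h4 : ht (Lozenges.run t ω top) q ≤ ht top q := (hall _ hT).2 _ h2.1 _ h2.2.2.le
      omega
    refine (lintegral_mono hstep).trans ?_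
    rw [lintegral_const_mul' _ _ ENNReal.ofReal_ne_top]
    refine (mul_le_mul_right ih _).trans ?_
    rw [← ENNReal.ofReal_mul hc0]
    refine le_of_eq (congrArg _ ?_)
    ring

/-- The probability that the copies of the chain have not coalesced, bounded by means of weights
for which the heat flow contracts. -/
theorem notCoalesced_le {w : ℤ → ℝ} {lam κ : ℝ} (hT₀ : IsTiling R T₀)
    {bot top : Config} (hbot : bot ∈ Space R T₀) (htop : top ∈ Space R T₀)
    (hall : ∀ T ∈ Space R T₀, Below R bot T ∧ Below R T top) (hw : ∀ x, 0 ≤ w x)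
    (hlam1 : lam ≤ 1) (hκ : 0 ≤ κ)
    (hlam : ∀ q ∈ sites R T₀, ht bot q < ht top q → 1 ≤ w (col q) ∧ w (col q) ≤ κ ∧
      (w (col q - 1) + w (col q + 1)) / 2 ≤ (1 - lam) * w (col q)) (t : ℕ) :
    (runLaw R T₀ t).real (notCoalesced R T₀ (Space R T₀) t) ≤
      κ * (potential R T₀ 1 top - potential R T₀ 1 bot) *
        Real.exp (-(lam * t / (sites R T₀).card)) := by
  have hht : ∀ U ∈ Space R T₀, ∀ V, Below R U V → ∀ q ∈ sites R T₀, ht U q ≤ ht V q := by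
    intro U hU V hUV q hq
    have h := mem_sites.1 (Space.sites_eq hU ▸ hq)
    exact hUV _ h.1 _ h.2.2.le
  have hG0 : 0 ≤ potential R T₀ 1 top - potential R T₀ 1 bot := by
    rw [sub_nonneg]
    refine Finset.sum_le_sum fun q hq => ?_
    simpa using hht bot hbot top (hall _ htop).1 q hq
  -- Without sites `updateLaw` need not be a probability measure; but then all compatible tilings
  -- coincide.
  rcases (sites R T₀).eq_empty_or_nonempty with hp | hp
  · have : notCoalesced R T₀ (Space R T₀) t = ∅ := by
      refine Set.eq_empty_iff_forall_notMem.2 fun ω => ?_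
      rintro ⟨S, hS, T, hT, hne⟩
      refine hne ((Space.compat hT₀ (Space.run hS ω) (Space.run hT ω)).eq_of_ht_eq
        (Space.run hS ω).1 (Space.run hT ω).1 fun q hq => ?_)
      rw [Space.sites_eq (Space.run hS ω), hp] at hq
      simp at hq
    rw [this, measureReal_empty]
    positivity
  have := isProbabilityMeasure_updateLaw hp
  have : IsProbabilityMeasure (runLaw R T₀ t) := by unfold runLaw; infer_instance
  let F : (Fin t → Update R T₀) → ENNReal := fun ω => ENNReal.ofReal
    (potential R T₀ w (run t ω top) - potential R T₀ w (run t ω bot))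
  have hF : Measurable F :=
    (((measurable_of_countable (potential R T₀ w)).comp (Space.measurable_run htop t)).sub
      ((measurable_of_countable (potential R T₀ w)).comp
        (Space.measurable_run hbot t))).ennreal_ofReal
  -- If two copies differ, then so do the extreme ones, by an integer at least 1 at a site of weight
  -- at least 1. Markov's inequality applies to `F`.
  have hsub : notCoalesced R T₀ (Space R T₀) t ⊆ {ω | 1 ≤ F ω} := by
    rintro ω ⟨S, hS, T, hT, hne⟩
    have hb := Space.run hbot ω
    have hu := Space.run htop ω
    have hex : ∃ q ∈ sites R T₀, ht (run t ω bot) q ≠ ht (run t ω top) q := by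
      by_contra! hcon
      have key : ∀ U ∈ Space R T₀, run t ω U = run t ω bot := by
        intro U hU
        have hU' := Space.run hU ω
        refine (Space.compat hT₀ hU' hb).eq_of_ht_eq hU'.1 hb.1 fun q hq => ?_
        rw [Space.sites_eq hU'] at hq
        have h1 := hht _ hb _ (Space.run_below hT₀ hbot hU (hall U hU).1 ω) q hq
        have h2 := hht _ hU' _ (Space.run_below hT₀ hU htop (hall U hU).2 ω) q hq
        have h3 := hcon q hq
        omega
      exact hne ((key S hS).trans (key T hT).symm)
    obtain ⟨q, hq, hqne⟩ := hex
    have hle := hht _ hb _ (Space.run_below hT₀ hbot htop (hall _ htop).1 ω)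
    have hqlt : ht (run t ω bot) q + 1 ≤ ht (run t ω top) q := by
      have := hle q hq
      omega
    have hw1 : 1 ≤ w (col q) := by
      refine (hlam q hq ?_).1
      have h1 := hht _ hbot _ (hall _ hb).1 q hq
      have h2 := hht _ hu _ (hall _ hu).2 q hq
      omega
    change 1 ≤ ENNReal.ofReal _
    rw [ENNReal.one_le_ofReal, potential, potential, ← Finset.sum_sub_distrib]
    refine le_trans ?_ (Finset.single_le_sum (f := fun q => w (col q) * (ht (run t ω top) q : ℝ) -
      w (col q) * (ht (run t ω bot) q : ℝ)) (fun q' hq' => ?_) hq)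
    · have h1 : ((ht (run t ω bot) q : ℝ)) + 1 ≤ ht (run t ω top) q := by exact_mod_cast hqlt
      rw [← mul_sub]
      nlinarith
    · rw [← mul_sub]
      exact mul_nonneg (hw _) (sub_nonneg.2 (Int.cast_le.2 (hle q' hq')))
  have hcard : (1 : ℝ) ≤ (sites R T₀).card := by exact_mod_cast hp.card_pos
  have hc0 : 0 ≤ 1 - lam / (sites R T₀).card := by
    rw [sub_nonneg, div_le_one (by linarith)]
    linarith
  have hpot : potential R T₀ w top - potential R T₀ w bot ≤
      κ * (potential R T₀ 1 top - potential R T₀ 1 bot) := by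
    simp only [potential]
    rw [← Finset.sum_sub_distrib, ← Finset.sum_sub_distrib, Finset.mul_sum]
    refine Finset.sum_le_sum fun q hq => ?_
    rw [← mul_sub, ← mul_sub, Pi.one_apply, one_mul]
    rcases (hht bot hbot top (hall _ htop).1 q hq).eq_or_lt with he | hlt
    · rw [he]; simp
    · exact mul_le_mul_of_nonneg_right (hlam q hq hlt).2.1
        (sub_nonneg.2 (Int.cast_le.2 hlt.le))
  have h1 : runLaw R T₀ t (notCoalesced R T₀ (Space R T₀) t) ≤ ENNReal.ofReal
      ((1 - lam / (sites R T₀).card) ^ t *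
        (potential R T₀ w top - potential R T₀ w bot)) := by
    refine (measure_mono hsub).trans ?_
    refine (meas_ge_le_lintegral_div hF.aemeasurable one_ne_zero ENNReal.one_ne_top).trans ?_
    rw [div_one]
    exact Space.lintegral_run_le hT₀ hp hbot htop hall hw hlam1
      (fun q hq hlt => (hlam q hq hlt).2.2) t
  have hexp : (1 - lam / (sites R T₀).card) ^ t ≤
      Real.exp (-(lam * t / (sites R T₀).card)) := by
    have h2 : 1 - lam / (sites R T₀).card ≤ Real.exp (-(lam / (sites R T₀).card)) := by
      have := Real.add_one_le_exp (-(lam / (sites R T₀).card))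
      linarith
    refine (pow_le_pow_left₀ hc0 h2 t).trans_eq ?_
    rw [← Real.exp_nat_mul]
    congr 1
    ring
  rw [measureReal_def]
  refine (ENNReal.toReal_mono ENNReal.ofReal_ne_top h1).trans ?_
  have h3 : (1 - lam / (sites R T₀).card) ^ t *
      (potential R T₀ w top - potential R T₀ w bot) ≤
      κ * (potential R T₀ 1 top - potential R T₀ 1 bot) *
        Real.exp (-(lam * t / (sites R T₀).card)) := by
    refine (mul_le_mul_of_nonneg_left hpot (pow_nonneg hc0 t)).trans ?_
    rw [mul_comm]
    exact mul_le_mul_of_nonneg_left hexp (mul_nonneg hκ hG0)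
  refine (ENNReal.toReal_mono ENNReal.ofReal_ne_top (ENNReal.ofReal_le_ofReal h3)).trans ?_
  rw [ENNReal.toReal_ofReal (by positivity)]

end Measurability

/-! ### Estimates of the coalescence time -/

section Estimates

/-- Taylor's formula: the fourth-order error is a small multiple of `β ^ 2 * β ^ 2`, and the
hypothesis on `β ^ 2` lets it fit into the loss of the factor `a`. -/
theorem one_sub_cos_ge {a β : ℝ} (hβ : |β| ≤ 1) (h : β ^ 2 ≤ 1 - a) :
    a * (β ^ 2 / 2) ≤ 1 - Real.cos β := by
  have h1 := (abs_le.1 (Real.cos_bound hβ)).2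
  have h2 : |β| ^ 4 = β ^ 2 * β ^ 2 := by
    rw [show |β| ^ 4 = (|β| ^ 2) ^ 2 by ring, sq_abs]; ring
  rw [h2] at h1
  nlinarith [mul_le_mul_of_nonneg_left h (sq_nonneg β), sq_nonneg β, mul_self_nonneg (β ^ 2)]

/-- The bound with cosine weights, for sites in a vertical strip of width `w`. -/
theorem exists_notCoalesced_le_exp {η : ℝ} (hη : 0 < η) (hη1 : η < 1) :
    ∃ K : ℝ, 1 ≤ K ∧ ∃ W : ℕ, ∀ (R : Region) (T₀ : Config), IsTiling R T₀ →
      ∀ bot ∈ Space R T₀, ∀ top ∈ Space R T₀,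
      (∀ T ∈ Space R T₀, Below R bot T ∧ Below R T top) →
      ∀ (x₀ : ℤ) (w : ℕ), W ≤ w → (∀ q ∈ sites R T₀, x₀ < col q ∧ col q < x₀ + w) → ∀ t : ℕ,
        (runLaw R T₀ t).real (notCoalesced R T₀ (Space R T₀) t) ≤
          K * (potential R T₀ 1 top - potential R T₀ 1 bot) *
            Real.exp (-((1 - η) * (Real.pi ^ 2 / (2 * w ^ 2)) * t / (sites R T₀).card)) := by
  -- Lowering the frequency from `π / w` to `a * π / w` keeps the cosine at least `c = cos (a * π /
  -- 2) > 0` on the whole strip. The rate loses a factor `a ^ 3` in all, and `(1 - η / 3) ^ 3 ≥ 1 -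
  -- η`.
  obtain ⟨a, ha⟩ : ∃ a : ℝ, a = 1 - η / 3 := ⟨_, rfl⟩
  have ha0 : 0 < a := by linarith
  have ha1 : a < 1 := by linarith
  have hπ := Real.pi_pos
  have hc : 0 < Real.cos (a * Real.pi / 2) :=
    Real.cos_pos_of_mem_Ioo ⟨by nlinarith, by nlinarith⟩
  obtain ⟨c, hcdef⟩ : ∃ c, c = Real.cos (a * Real.pi / 2) := ⟨_, rfl⟩
  rw [← hcdef] at hc
  have hc1 : c ≤ 1 := hcdef ▸ Real.cos_le_one _
  -- Since `β * w ≤ 4`, this width forces `β ≤ η / 12`, more than enough for `β ^ 2 ≤ 1 - a = η /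
  -- 3`.
  refine ⟨1 / c, (one_le_div hc).2 hc1, ⌈48 / η⌉₊, ?_⟩
  intro R T₀ hT₀ bot hbot top htop hall x₀ w hw hstrip t
  have hw' : 48 / η ≤ w := Nat.ceil_le.1 hw
  have hw48 : (48 : ℝ) ≤ w := le_trans (by rw [le_div_iff₀ hη]; linarith) hw'
  have hηw : 48 ≤ η * w := by rwa [div_le_iff₀ hη, mul_comm] at hw'
  have hw0 : (0 : ℝ) < w := by linarith
  obtain ⟨β, hβ⟩ : ∃ β, β = a * Real.pi / w := ⟨_, rfl⟩
  have hβw : β * w = a * Real.pi := by rw [hβ]; field_simp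
  have hβ0 : 0 < β := by rw [hβ]; positivity
  have hβ4 : β * w ≤ 4 := by
    rw [hβw]
    nlinarith [Real.pi_le_four]
  have hβ1 : β ≤ 1 := by nlinarith
  have hβsq : β ^ 2 ≤ 1 - a := by
    have h1 : β * 48 ≤ η * 4 := by
      have : β * 48 ≤ β * (η * w) := mul_le_mul_of_nonneg_left hηw hβ0.le
      nlinarith
    rw [ha]
    nlinarith
  have hlam := one_sub_cos_ge (by rw [abs_of_pos hβ0]; exact hβ1) hβsq
  -- A cosine centred in the strip is an eigenfunction of averaging over the two neighbours, with
  -- eigenvalue `cos β`. Division by `c` makes it at least 1 on the strip. Sites are strictly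
  -- inside, so the cut-off at the sides is never felt.
  obtain ⟨wt, hwt⟩ : ∃ wt : ℤ → ℝ, wt = fun x => if x₀ ≤ x ∧ x ≤ x₀ + w then
    Real.cos (β * (x - x₀ - w / 2)) / c else 0 := ⟨_, rfl⟩
  have hcos : ∀ x : ℤ, x₀ ≤ x → x ≤ x₀ + w → c ≤ Real.cos (β * (x - x₀ - w / 2)) := by
    intro x h1 h2
    have h1' : (x₀ : ℝ) ≤ x := by exact_mod_cast h1
    have h2' : (x : ℝ) ≤ x₀ + w := by exact_mod_cast h2
    rw [hcdef, ← Real.cos_abs (β * _)]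
    refine Real.cos_le_cos_of_nonneg_of_le_pi (abs_nonneg _) (by nlinarith) ?_
    rw [abs_le]
    constructor <;> nlinarith
  have hwt_in : ∀ x : ℤ, x₀ ≤ x → x ≤ x₀ + w → wt x = Real.cos (β * (x - x₀ - w / 2)) / c :=
    fun x h1 h2 => by rw [hwt]; exact if_pos ⟨h1, h2⟩
  have hwt0 : ∀ x, 0 ≤ wt x := by
    intro x
    by_cases hx : x₀ ≤ x ∧ x ≤ x₀ + w
    · rw [hwt_in x hx.1 hx.2]
      exact div_nonneg (hc.le.trans (hcos x hx.1 hx.2)) hc.le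
    · rw [hwt]
      exact (if_neg hx).ge
  have hcosβ : 0 ≤ Real.cos β :=
    Real.cos_nonneg_of_mem_Icc ⟨by linarith, by linarith [Real.two_le_pi]⟩
  have main := notCoalesced_le (w := wt) (lam := 1 - Real.cos β) (κ := 1 / c) hT₀ hbot htop hall
    hwt0 (by linarith) (by positivity) (fun q hq _ => by
      obtain ⟨h1, h2⟩ := hstrip q hq
      have h3 := hcos (col q) h1.le h2.le
      rw [hwt_in (col q) h1.le h2.le, hwt_in (col q - 1) (by omega) (by omega),
        hwt_in (col q + 1) (by omega) (by omega)]
      refine ⟨(one_le_div hc).2 h3, div_le_div_of_nonneg_right (Real.cos_le_one _) hc.le,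
        le_of_eq ?_⟩
      push_cast
      rw [show β * ((col q : ℝ) - 1 - x₀ - w / 2) = β * (col q - x₀ - w / 2) - β by ring,
        show β * ((col q : ℝ) + 1 - x₀ - w / 2) = β * (col q - x₀ - w / 2) + β by ring,
        Real.cos_sub, Real.cos_add]
      field_simp
      ring) t
  refine main.trans ?_
  have hG0 : 0 ≤ potential R T₀ 1 top - potential R T₀ 1 bot := by
    rw [sub_nonneg]
    refine Finset.sum_le_sum fun q hq => ?_
    have h := mem_sites.1 (Space.sites_eq hbot ▸ hq)
    have : ht bot q ≤ ht top q := (hall _ htop).1 _ h.1 _ h.2.2.le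
    simpa using this
  refine mul_le_mul_of_nonneg_left (Real.exp_le_exp.2 (neg_le_neg ?_)) (by positivity)
  refine div_le_div_of_nonneg_right (mul_le_mul_of_nonneg_right ?_ (Nat.cast_nonneg _))
    (Nat.cast_nonneg _)
  refine le_trans ?_ hlam
  have e : a * (β ^ 2 / 2) = a ^ 3 * (Real.pi ^ 2 / (2 * w ^ 2)) := by
    rw [hβ]; field_simp
  rw [e]
  refine mul_le_mul_of_nonneg_right ?_ (by positivity)
  rw [ha]
  nlinarith [mul_pos hη hη, mul_pos (mul_pos hη hη) hη]

/-- The bound with weights depending on the rank of a column, which is useful if there are few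
local moves. -/
theorem notCoalesced_le_rank {R : Region} {T₀ bot top : Config} (hT₀ : IsTiling R T₀)
    (hbot : bot ∈ Space R T₀) (htop : top ∈ Space R T₀)
    (hall : ∀ T ∈ Space R T₀, Below R bot T ∧ Below R T top) {m : ℕ} (hm : 0 < m)
    (hG : potential R T₀ 1 top - potential R T₀ 1 bot ≤ m) (t : ℕ) :
    (runLaw R T₀ t).real (notCoalesced R T₀ (Space R T₀) t) ≤
      m * (potential R T₀ 1 top - potential R T₀ 1 bot) *
        Real.exp (-(1 / (m : ℝ) ^ 2 * t / (sites R T₀).card)) := by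
  classical
  have hle : ∀ q ∈ sites R T₀, ht bot q ≤ ht top q := by
    intro q hq
    have h := mem_sites.1 (Space.sites_eq hbot ▸ hq)
    exact (hall _ htop).1 _ h.1 _ h.2.2.le
  -- Each site where `bot` and `top` differ adds at least 1 to the total difference, so there are at
  -- most `m` of them, in at most `m` columns.
  let D := (sites R T₀).filter fun q => ht bot q < ht top q
  let X := D.image col
  have hX : X.card ≤ m := by
    have h1 : (D.card : ℝ) ≤ potential R T₀ 1 top - potential R T₀ 1 bot := by
      rw [potential, potential, ← Finset.sum_sub_distrib, Finset.card_filter]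
      push_cast
      refine Finset.sum_le_sum fun q hq => ?_
      rw [← mul_sub, Pi.one_apply, one_mul]
      split_ifs with h
      · have : (ht bot q : ℝ) + 1 ≤ ht top q := by exact_mod_cast h
        linarith
      · exact sub_nonneg.2 (Int.cast_le.2 (hle q hq))
    have h2 : D.card ≤ m := by exact_mod_cast h1.trans hG
    exact Finset.card_image_le.trans h2
  let r : ℤ → ℕ := fun x => (X.filter (· ≤ x)).card
  -- A parabola vanishing at `0` and `m + 1`, with values between 1 and `m` on the possible ranks
  -- `1, …, m`. Averaging over two neighbours lowers it by `1 / m`, at least the fraction `1 / m ^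
  -- 2` of its value.
  let f : ℝ → ℝ := fun y => y * (m + 1 - y) / m
  have hm0 : (0 : ℝ) < m := by exact_mod_cast hm
  have hm1 : (1 : ℝ) ≤ m := by exact_mod_cast hm
  have hr1 : ∀ x ∈ X, 1 ≤ r x := fun x hx =>
    Finset.card_pos.2 ⟨x, Finset.mem_filter.2 ⟨hx, le_rfl⟩⟩
  have hrm : ∀ x, r x ≤ m := fun x => (Finset.card_filter_le _ _).trans hX
  have hrs : ∀ x, x + 1 ∈ X → r (x + 1) = r x + 1 := by
    intro x hx
    have : X.filter (· ≤ x + 1) = insert (x + 1) (X.filter (· ≤ x)) := by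
      ext y
      simp only [Finset.mem_filter, Finset.mem_insert]
      constructor
      · rintro ⟨h1, h2⟩
        rcases h2.eq_or_lt with h3 | h3
        · exact Or.inl h3
        · exact Or.inr ⟨h1, by omega⟩
      · rintro (rfl | ⟨h1, h2⟩)
        · exact ⟨hx, le_rfl⟩
        · exact ⟨h1, by omega⟩
    simp only [r]
    rw [this, Finset.card_insert_of_notMem]
    simp
  have hf0 : ∀ y : ℝ, 0 ≤ y → y ≤ m + 1 → 0 ≤ f y := fun y h1 h2 =>
    div_nonneg (mul_nonneg h1 (by linarith)) hm0.le
  let wt : ℤ → ℝ := fun x => if x ∈ X then f (r x) else 0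
  have hrR : ∀ x, (r x : ℝ) ≤ m := fun x => by exact_mod_cast hrm x
  have hwt0 : ∀ x, 0 ≤ wt x := by
    intro x
    simp only [wt]
    split_ifs
    · exact hf0 _ (Nat.cast_nonneg _) (by linarith [hrR x])
    · exact le_rfl
  have hlam1 : 1 / (m : ℝ) ^ 2 ≤ 1 := by
    rw [div_le_one (by positivity)]
    nlinarith
  refine notCoalesced_le (w := wt) hT₀ hbot htop hall hwt0 hlam1 hm0.le (fun q hq hlt => ?_) t
  have hx : col q ∈ X := Finset.mem_image_of_mem _ (Finset.mem_filter.2 ⟨hq, hlt⟩)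
  generalize col q = x at hx
  have h1 : (1 : ℝ) ≤ r x := by exact_mod_cast hr1 x hx
  have h2 := hrR x
  have hwx : wt x = f (r x) := if_pos hx
  have hfm : f (r x) ≤ m := by
    simp only [f]
    rw [div_le_iff₀ hm0]
    nlinarith
  rw [hwx]
  refine ⟨?_, hfm, ?_⟩
  · simp only [f]
    rw [le_div_iff₀ hm0]
    nlinarith
  -- A neighbouring column in `X` has the neighbouring rank; one outside `X` has weight zero, which
  -- is at most the value of the parabola there.
  · have h3 : wt (x + 1) ≤ f (r x + 1) := by
      by_cases hx1 : x + 1 ∈ X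
      · simp only [wt, if_pos hx1, hrs x hx1]
        push_cast
        exact le_rfl
      · simp only [wt, if_neg hx1]
        exact hf0 _ (by linarith) (by linarith)
    have h4 : wt (x - 1) ≤ f (r x - 1) := by
      by_cases hx1 : x - 1 ∈ X
      · have := hrs (x - 1) (by simpa using hx)
        rw [sub_add_cancel] at this
        simp only [wt, if_pos hx1]
        rw [this]
        push_cast
        rw [add_sub_cancel_right]
      · simp only [wt, if_neg hx1]
        exact hf0 _ (by linarith) (by linarith)
    have h5 : (f (r x - 1) + f (r x + 1)) / 2 = f (r x) - 1 / m := by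
      simp only [f]
      field_simp
      ring
    have h6 : f (r x) * (1 / (m : ℝ) ^ 2) ≤ 1 / m := by
      refine (mul_le_mul_of_nonneg_right hfm (by positivity)).trans_eq ?_
      field_simp
    linarith

/-- The sites lie strictly between the leftmost start and the rightmost end. -/
theorem IsTiling.exists_strip {R : Region} {T₀ : Config} (hT₀ : IsTiling R T₀) :
    ∃ x₀ : ℤ, ∀ q ∈ sites R T₀, x₀ < col q ∧ col q < x₀ + width R := by
  rcases (starts R).eq_empty_or_nonempty with h | h
  · refine ⟨0, fun q hq => ?_⟩
    have := (mem_sites.1 hq).1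
    rw [h] at this
    simp at this
  · obtain ⟨s₀, hs₀, hmin⟩ := Finset.exists_min_image _ (fun s : Edge => s.1) h
    refine ⟨s₀.1, fun q hq => ?_⟩
    obtain ⟨hs, h0, hL⟩ := mem_sites.1 hq
    have h1 := hmin q.1 hs
    let e : Edge := (q.1.1 + (length R T₀ q.1 : ℕ), height T₀ q.1 (length R T₀ q.1))
    have he : e ∈ ends R :=
      mem_ends.2 ⟨hT₀.left_mem hs (length_pos hs) le_rfl, right_length_notMem⟩
    have h2 : (e.1 - s₀.1).toNat ≤ width R :=
      Finset.le_sup (f := fun q : Edge × Edge => (q.2.1 - q.1.1).toNat)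
        (Finset.mk_mem_product hs₀ he)
    simp only [e] at h2
    simp only [col]
    omega

theorem runLaw_real_le_one {R : Region} {T₀ : Config} (hp : (sites R T₀).Nonempty) {t : ℕ}
    (A : Set (Fin t → Update R T₀)) : (runLaw R T₀ t).real A ≤ 1 := by
  have := isProbabilityMeasure_updateLaw hp
  have : IsProbabilityMeasure (runLaw R T₀ t) := by unfold runLaw; infer_instance
  exact measureReal_le_one

/-- Coalescence in a component, in terms of the number of local moves from the bottom to the top. -/
theorem coalescence_component {δ : ℝ} (hδ : 0 < δ) : ∃ W : ℕ, ∀ (R : Region) (T₀ : Config),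
    IsTiling R T₀ → W ≤ width R →
      ∃ bot ∈ component R T₀, ∃ top ∈ component R T₀,
        (∀ T ∈ component R T₀, Below R bot T ∧ Below R T top) ∧
        ∀ ε : ℝ, 0 < ε → ∀ t : ℕ,
          (2 + δ) / Real.pi ^ 2 * ((sites R T₀).card : ℝ) * (width R : ℝ) ^ 2 *
              Real.log (((moveGraph R).dist bot top : ℝ) / ε) ≤ (t : ℝ) →
            (runLaw R T₀ t).real (notCoalesced R T₀ (component R T₀) t) ≤ ε := by
  have hπ := Real.pi_pos
  -- With this `η` one has `(1 - η) * (2 + δ) / 2 = 1 + δ / 4`, which leaves a factor `exp (-(δ / 4)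
  -- * L)` to absorb `K`.
  obtain ⟨K, hK1, W₁, hcore⟩ := exists_notCoalesced_le_exp (η := δ / (4 + 2 * δ)) (by positivity)
    (by rw [div_lt_one (by positivity)]; linarith)
  -- Bounds `m` when `K` is not absorbed. It depends on `δ` only, so the width can be required to
  -- exceed `4 * M`.
  obtain ⟨M, hM⟩ : ∃ M, M = Real.exp (4 * Real.log K / δ) := ⟨_, rfl⟩
  have hM0 : 0 < M := hM ▸ Real.exp_pos _
  refine ⟨max W₁ (⌈4 * M⌉₊ + 1), fun R T₀ hT₀ hW => ?_⟩
  obtain ⟨top, htop, hmax⟩ := exists_top hT₀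
  obtain ⟨bot, hbot, hmin⟩ := exists_bot hT₀
  have hall : ∀ T ∈ Space R T₀, Below R bot T ∧ Below R T top := fun T hT => ⟨hmin T hT, hmax T hT⟩
  rw [component_eq hT₀]
  refine ⟨bot, hbot, top, htop, hall, fun ε hε t ht => ?_⟩
  have hdist := Space.potential_sub_le_dist hT₀ hbot htop
  obtain ⟨m, hm⟩ : ∃ m, m = (moveGraph R).dist bot top := ⟨_, rfl⟩
  rw [← hm] at ht hdist
  obtain ⟨x₀, hstrip⟩ := hT₀.exists_strip
  have hcore := hcore R T₀ hT₀ bot hbot top htop hall x₀ (width R) ((le_max_left _ _).trans hW)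
    hstrip t
  have hrank := notCoalesced_le_rank (m := m) hT₀ hbot htop hall
  have hW2 := (le_max_right _ _).trans hW
  have hw1 : (1 : ℝ) ≤ width R := by
    exact_mod_cast (Nat.le_add_left 1 _).trans hW2
  have hw4 : 4 * M ≤ width R :=
    (Nat.le_ceil _).trans (by exact_mod_cast (Nat.le_succ _).trans hW2)
  generalize width R = w at *
  obtain ⟨G, hG⟩ : ∃ G, G = potential R T₀ 1 top - potential R T₀ 1 bot := ⟨_, rfl⟩
  rw [← hG] at hcore hdist hrank
  -- Covers `m = 0`, where `Real.log (0 / ε) = 0` and the hypothesis on `t` is void, and the case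
  -- without sites.
  have hzero : G ≤ 0 → (runLaw R T₀ t).real (notCoalesced R T₀ (Space R T₀) t) ≤ ε := fun h =>
    (hcore.trans (mul_nonpos_of_nonpos_of_nonneg
      (mul_nonpos_of_nonneg_of_nonpos (by linarith) h) (Real.exp_pos _).le)).trans hε.le
  rcases Nat.eq_zero_or_pos m with hm0 | hm0
  · exact hzero (by simpa [hm0] using hdist)
  rcases (sites R T₀).eq_empty_or_nonempty with hp | hp
  · exact hzero (by simp [hG, potential, hp])
  rcases le_or_gt 1 ε with hε1 | hε1
  · exact (runLaw_real_le_one hp _).trans hε1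
  have hp1 : (1 : ℝ) ≤ (sites R T₀).card := by exact_mod_cast hp.card_pos
  generalize ((sites R T₀).card : ℝ) = p at *
  have hmR : (1 : ℝ) ≤ m := by exact_mod_cast hm0
  obtain ⟨L, hL⟩ : ∃ L, L = Real.log (m / ε) := ⟨_, rfl⟩
  rw [← hL] at ht
  have hexpL : Real.exp (-L) = ε / m := by
    rw [Real.exp_neg, hL, Real.exp_log (by positivity), inv_div]
  have hLm : Real.log m ≤ L := by
    rw [hL]
    refine Real.log_le_log (by linarith) ?_
    rw [le_div_iff₀ hε]
    nlinarith
  have hL0 : 0 ≤ L := (Real.log_nonneg hmR).trans hLm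
  have htp : (2 + δ) / Real.pi ^ 2 * w ^ 2 * L ≤ t / p := by
    rw [le_div_iff₀ (by linarith)]
    linarith
  -- If this fails, `ε < 1` gives `log m ≤ L < 4 * log K / δ`, hence `m ≤ M`, and the rank weights
  -- take over.
  by_cases hcase : Real.log K ≤ δ / 4 * L
  · refine hcore.trans ?_
    have h1 : (1 + δ / 4) * L ≤
        (1 - δ / (4 + 2 * δ)) * (Real.pi ^ 2 / (2 * (w : ℝ) ^ 2)) * t / p := by
      have h2 : (1 + δ / 4) * L = (1 - δ / (4 + 2 * δ)) * (Real.pi ^ 2 / (2 * (w : ℝ) ^ 2)) *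
          ((2 + δ) / Real.pi ^ 2 * w ^ 2 * L) := by
        field_simp
        ring
      rw [h2, mul_div_assoc]
      refine mul_le_mul_of_nonneg_left htp (mul_nonneg ?_ (by positivity))
      rw [sub_nonneg, div_le_one (by positivity)]
      linarith
    have h2 : K ≤ Real.exp (δ / 4 * L) := by
      rw [← Real.log_le_iff_le_exp (by linarith)]
      exact hcase
    calc K * G * Real.exp _ ≤ K * m * Real.exp (-((1 + δ / 4) * L)) := by
          refine mul_le_mul (mul_le_mul_of_nonneg_left hdist (by linarith))
            (Real.exp_le_exp.2 (neg_le_neg h1)) (Real.exp_pos _).le (by positivity)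
      _ ≤ Real.exp (δ / 4 * L) * m * Real.exp (-((1 + δ / 4) * L)) := by gcongr
      _ = m * Real.exp (-L) := by
          rw [mul_right_comm, ← Real.exp_add, mul_comm]
          congr 2
          ring
      _ = ε := by rw [hexpL]; field_simp
  · have hlog : L ≤ 4 * Real.log K / δ := by
      rw [le_div_iff₀ hδ]
      linarith [not_le.1 hcase]
    have hmM : (m : ℝ) ≤ M := by
      rw [hM, ← Real.log_le_iff_le_exp (by linarith)]
      exact hLm.trans hlog
    refine (hrank hm0 hdist t).trans ?_
    -- Because `π * m ≤ 4 * M ≤ w`, the rate `1 / m ^ 2` is at least `π ^ 2 / w ^ 2`. The exponent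
    -- `2 * L` then beats the prefactor `m * m` and leaves `ε ^ 2`.
    have h1 : 2 * L ≤ 1 / (m : ℝ) ^ 2 * t / p := by
      have h2 : (Real.pi * m) ^ 2 ≤ (w : ℝ) ^ 2 := by
        refine pow_le_pow_left₀ (by positivity) ?_ 2
        nlinarith [Real.pi_le_four]
      rw [mul_div_assoc]
      refine le_trans ?_ (mul_le_mul_of_nonneg_left htp (by positivity))
      have h3 : 1 / (m : ℝ) ^ 2 * ((2 + δ) / Real.pi ^ 2 * w ^ 2 * L) =
          (w ^ 2 / (Real.pi * m) ^ 2) * ((2 + δ) * L) := by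
        field_simp
      rw [h3]
      have h4 : 1 ≤ (w : ℝ) ^ 2 / (Real.pi * m) ^ 2 := (one_le_div (by positivity)).2 h2
      nlinarith [mul_nonneg hδ.le hL0]
    calc m * G * Real.exp _ ≤ m * m * Real.exp (-(2 * L)) := by
          refine mul_le_mul (mul_le_mul_of_nonneg_left hdist (by linarith))
            (Real.exp_le_exp.2 (neg_le_neg h1)) (Real.exp_pos _).le (by positivity)
      _ = (m * Real.exp (-L)) ^ 2 := by
          rw [mul_pow, ← Real.exp_nat_mul]
          push_cast
          ring_nf
      _ = ε ^ 2 := by rw [hexpL]; field_simp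
      _ ≤ ε := by nlinarith

end Estimates

/-! ### The hexagon -/

section Hexagon

variable {ℓ : ℕ} {S T : Config}

theorem mem_hexEdges {x u : ℤ} : (x, u) ∈ hexEdges ℓ ↔
    (0 ≤ x ∧ x ≤ 2 * ℓ) ∧ (0 ≤ u ∧ u < 2 * ℓ) ∧ -(ℓ : ℤ) ≤ u - x ∧ u - x < ℓ := by
  simp [hexEdges, and_assoc]

theorem right_mem_hexagon {x u : ℤ} :
    .right x u ∈ hexagon ℓ ↔ (x, u) ∈ hexEdges ℓ ∧ x < 2 * ℓ := by
  simp [hexagon]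

theorem left_mem_hexagon {x u : ℤ} : .left x u ∈ hexagon ℓ ↔ (x, u) ∈ hexEdges ℓ ∧ 0 < x := by
  simp [hexagon]

theorem mem_starts_hexagon {s : Edge} : s ∈ starts (hexagon ℓ) ↔ s.1 = 0 ∧ 0 ≤ s.2 ∧ s.2 < ℓ := by
  rw [mem_starts, right_mem_hexagon, left_mem_hexagon, mem_hexEdges]
  omega

theorem IsTiling.hexagon_point (hT : IsTiling (hexagon ℓ) T) {s : Edge}
    (hs : s ∈ starts (hexagon ℓ)) {n : ℕ} (hn : n ≤ length (hexagon ℓ) T s) :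
    (0 ≤ height T s n ∧ height T s n < 2 * ℓ) ∧ -(ℓ : ℤ) ≤ height T s n - n ∧
      height T s n - n < ℓ ∧ n ≤ 2 * ℓ := by
  have hs' := mem_starts_hexagon.1 hs
  rcases Nat.eq_zero_or_pos n with rfl | h0
  · simp only [height]
    push_cast
    omega
  · have := left_mem_hexagon.1 (hT.left_mem hs h0 hn)
    rw [mem_hexEdges] at this
    omega

/-- Every point of a path is an edge of the hexagon, and such an edge lacks a right triangle only in
the last column. -/
theorem IsTiling.hexagon_length (hT : IsTiling (hexagon ℓ) T) {s : Edge}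
    (hs : s ∈ starts (hexagon ℓ)) : length (hexagon ℓ) T s = 2 * ℓ := by
  have hs' := mem_starts_hexagon.1 hs
  have h1 := hT.hexagon_point hs le_rfl
  have h2 := right_length_notMem (R := hexagon ℓ) (T := T) (s := s)
  rw [right_mem_hexagon, mem_hexEdges] at h2
  omega

theorem IsTiling.hexagon_lt (hT : IsTiling (hexagon ℓ) T) {s s' : Edge}
    (hs : s ∈ starts (hexagon ℓ)) (hs' : s' ∈ starts (hexagon ℓ)) (hlt : s.2 < s'.2) {n : ℕ}
    (hn : n ≤ 2 * ℓ) : height T s n < height T s' n := by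
  have h1 := mem_starts_hexagon.1 hs
  have h2 := mem_starts_hexagon.1 hs'
  have l1 := hT.hexagon_length hs
  have l2 := hT.hexagon_length hs'
  induction n with
  | zero => exact hlt
  | succ n ih =>
    have ih := ih (by omega)
    have a := hT.height_step hs (n := n) (by omega)
    have b := hT.height_step hs' (n := n) (by omega)
    have hne : height T s (n + 1) ≠ height T s' (n + 1) := by
      intro h
      have := (hT.path_unique hs hs' (by omega) (by omega) (by rw [h1.1, h2.1]) h).1
      rw [this] at hlt
      exact lt_irrefl _ hlt
    omega

/-- The right side has exactly `ℓ` edges for `ℓ` strictly ordered paths, which leaves no freedom.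
Induction from the lowest path gives the lower bounds, from the highest one the upper bounds. -/
theorem IsTiling.hexagon_last (hT : IsTiling (hexagon ℓ) T) {s : Edge}
    (hs : s ∈ starts (hexagon ℓ)) : height T s (2 * ℓ) = s.2 + ℓ := by
  have lower : ∀ j : ℕ, j < ℓ → (ℓ : ℤ) + j ≤ height T (0, (j : ℤ)) (2 * ℓ) := by
    intro j
    induction j with
    | zero =>
      intro hj
      have hs : ((0, ((0 : ℕ) : ℤ)) : Edge) ∈ starts (hexagon ℓ) :=
        mem_starts_hexagon.2 ⟨rfl, by simp, by simpa using hj⟩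
      have h := hT.hexagon_point hs (n := 2 * ℓ) (hT.hexagon_length hs).ge
      push_cast at *
      omega
    | succ j ih =>
      intro hj
      have h1 := ih (by omega)
      have hs1 : ((0, (j : ℤ)) : Edge) ∈ starts (hexagon ℓ) :=
        mem_starts_hexagon.2 ⟨rfl, by positivity, by dsimp only; omega⟩
      have hs2 : ((0, ((j + 1 : ℕ) : ℤ)) : Edge) ∈ starts (hexagon ℓ) :=
        mem_starts_hexagon.2 ⟨rfl, by positivity, by dsimp only; omega⟩
      have h2 := hT.hexagon_lt hs1 hs2 (by dsimp only; omega) (n := 2 * ℓ) le_rfl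
      push_cast at *
      omega
  have upper : ∀ i j : ℕ, i + j + 1 = ℓ →
      height T (0, (j : ℤ)) (2 * ℓ) ≤ 2 * ℓ - 1 - i := by
    intro i
    induction i with
    | zero =>
      intro j hj
      have hs : ((0, (j : ℤ)) : Edge) ∈ starts (hexagon ℓ) :=
        mem_starts_hexagon.2 ⟨rfl, by positivity, by dsimp only; omega⟩
      have h := hT.hexagon_point hs (n := 2 * ℓ) (hT.hexagon_length hs).ge
      push_cast at *
      omega
    | succ i ih =>
      intro j hj
      have h1 := ih (j + 1) (by omega)
      have hs1 : ((0, (j : ℤ)) : Edge) ∈ starts (hexagon ℓ) :=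
        mem_starts_hexagon.2 ⟨rfl, by positivity, by dsimp only; omega⟩
      have hs2 : ((0, ((j + 1 : ℕ) : ℤ)) : Edge) ∈ starts (hexagon ℓ) :=
        mem_starts_hexagon.2 ⟨rfl, by positivity, by dsimp only; omega⟩
      have h2 := hT.hexagon_lt hs1 hs2 (by dsimp only; omega) (n := 2 * ℓ) le_rfl
      push_cast at *
      omega
  obtain ⟨h1, h2, h3⟩ := mem_starts_hexagon.1 hs
  obtain ⟨j, hj⟩ := Int.eq_ofNat_of_zero_le h2
  have hsj : s = (0, (j : ℤ)) := Prod.ext h1 hj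
  rw [hsj] at h3 ⊢
  dsimp only at h3 ⊢
  have a := lower j (by omega)
  have b := upper (ℓ - 1 - j) j (by omega)
  push_cast [Nat.cast_sub (show j ≤ ℓ - 1 by omega), Nat.cast_sub (show 1 ≤ ℓ by omega)] at b
  omega

/-- All tilings of the hexagon are compatible. -/
theorem hexagon_compat (hS : IsTiling (hexagon ℓ) S) (hT : IsTiling (hexagon ℓ) T) :
    Compat (hexagon ℓ) S T where
  len s hs := by rw [hS.hexagon_length hs, hT.hexagon_length hs]
  last s hs := by rw [hS.hexagon_length hs, hS.hexagon_last hs, hT.hexagon_last hs]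
  order q hq q' hq' hc hlt := by
    obtain ⟨hs, h0, hL⟩ := mem_sites.1 hq
    obtain ⟨hs', h0', hL'⟩ := mem_sites.1 hq'
    have h1 := (mem_starts_hexagon.1 hs).1
    have h1' := (mem_starts_hexagon.1 hs').1
    rw [hS.hexagon_length hs] at hL
    have hn : q.2 = q'.2 := by
      simp only [col] at hc
      omega
    simp only [ht] at hlt ⊢
    rw [← hn] at hlt ⊢
    refine hT.hexagon_lt hs hs' ?_ hL.le
    rcases lt_trichotomy q.1.2 q'.1.2 with h | h | h
    · exact h
    · have : q.1 = q'.1 := Prod.ext (h1.trans h1'.symm) h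
      rw [this] at hlt
      exact absurd hlt (lt_irrefl _)
    · exact absurd hlt (hS.hexagon_lt hs' hs h hL.le).not_gt
  interior q hq u hu := by
    obtain ⟨hs, h0, hL⟩ := mem_sites.1 hq
    have h1 := (mem_starts_hexagon.1 hs).1
    have a := hS.hexagon_point hs hL.le
    have b := hT.hexagon_point hs (n := q.2) (by
      rw [hS.hexagon_length hs] at hL
      rw [hT.hexagon_length hs]
      exact hL.le)
    rw [hS.hexagon_length hs] at hL
    rw [Interior, right_mem_hexagon, left_mem_hexagon, mem_hexEdges]
    rw [Set.mem_uIcc] at hu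
    simp only [col, ht] at *
    omega

/-- Together with `component_eq` this shows that the hexagon has a single component. -/
theorem space_hexagon (hT : IsTiling (hexagon ℓ) T) :
    Space (hexagon ℓ) T = {S | IsTiling (hexagon ℓ) S} :=
  Set.ext fun _ => ⟨fun h => h.1, fun h => ⟨h, hexagon_compat hT h⟩⟩

theorem card_sites_hexagon_le (hT : IsTiling (hexagon ℓ) T) :
    (sites (hexagon ℓ) T).card ≤ 2 * ℓ ^ 2 := by
  have hsub : sites (hexagon ℓ) T ⊆
      ((Finset.range ℓ) ×ˢ (Finset.range (2 * ℓ))).image fun z => (((0 : ℤ), (z.1 : ℤ)), z.2) := by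
    intro q hq
    obtain ⟨hs, h0, hL⟩ := mem_sites.1 hq
    rw [hT.hexagon_length hs] at hL
    obtain ⟨h1, h2, h3⟩ := mem_starts_hexagon.1 hs
    refine Finset.mem_image.2 ⟨(q.1.2.toNat, q.2), Finset.mk_mem_product ?_ ?_, ?_⟩
    · rw [Finset.mem_range]; omega
    · exact Finset.mem_range.2 hL
    · refine Prod.ext (Prod.ext h1.symm ?_) rfl
      dsimp only
      omega
  refine (Finset.card_le_card hsub).trans (Finset.card_image_le.trans ?_)
  rw [Finset.card_product, Finset.card_range, Finset.card_range]
  nlinarith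

theorem sites_hexagon_nonempty (hℓ : 0 < ℓ) (hT : IsTiling (hexagon ℓ) T) :
    (sites (hexagon ℓ) T).Nonempty := by
  have hs : ((0, 0) : Edge) ∈ starts (hexagon ℓ) :=
    mem_starts_hexagon.2 ⟨rfl, le_rfl, by simpa using hℓ⟩
  refine ⟨((0, 0), 1), mem_sites.2 ⟨hs, Nat.one_pos, ?_⟩⟩
  rw [hT.hexagon_length hs]
  omega

/-- All heights lie in `[0, 2 * ℓ)` and there are at most `2 * ℓ ^ 2` sites. Only the exponent 3
influences the leading constant. -/
theorem potential_hexagon_sub_le {T₀ : Config} (hT₀ : IsTiling (hexagon ℓ) T₀)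
    (hS : IsTiling (hexagon ℓ) S) (hT : IsTiling (hexagon ℓ) T) :
    potential (hexagon ℓ) T₀ 1 T - potential (hexagon ℓ) T₀ 1 S ≤ 4 * (ℓ : ℝ) ^ 3 := by
  rw [potential, potential, ← Finset.sum_sub_distrib]
  have h1 : ∀ q ∈ sites (hexagon ℓ) T₀, (1 : ℤ → ℝ) (col q) * (ht T q : ℝ) -
      (1 : ℤ → ℝ) (col q) * (ht S q : ℝ) ≤ 2 * ℓ := by
    intro q hq
    obtain ⟨hs, h0, hL⟩ := mem_sites.1 hq
    rw [hT₀.hexagon_length hs] at hL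
    have a := hS.hexagon_point hs (n := q.2) (by rw [hS.hexagon_length hs]; exact hL.le)
    have b := hT.hexagon_point hs (n := q.2) (by rw [hT.hexagon_length hs]; exact hL.le)
    have : ht T q - ht S q ≤ 2 * ℓ := by
      simp only [ht]
      omega
    rw [Pi.one_apply, one_mul, one_mul]
    exact_mod_cast this
  refine (Finset.sum_le_card_nsmul _ _ _ h1).trans ?_
  rw [nsmul_eq_mul]
  have h2 : ((sites (hexagon ℓ) T₀).card : ℝ) ≤ 2 * ℓ ^ 2 := by
    exact_mod_cast card_sites_hexagon_le hT₀
  calc ((sites (hexagon ℓ) T₀).card : ℝ) * (2 * ℓ) ≤ 2 * ℓ ^ 2 * (2 * ℓ) := by gcongr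
    _ = 4 * (ℓ : ℝ) ^ 3 := by ring

/-- The distributions of two copies of the chain differ by at most the probability that the copies
have not coalesced. -/
theorem abs_run_sub_le {R : Region} {T₀ : Config} (hp : (sites R T₀).Nonempty) {C : Set Config}
    (hS : S ∈ C) (hT : T ∈ C) (t : ℕ) (A : Set Config) :
    |(runLaw R T₀ t).real {ω | run t ω S ∈ A} - (runLaw R T₀ t).real {ω | run t ω T ∈ A}| ≤
      (runLaw R T₀ t).real (notCoalesced R T₀ C t) := by
  have := isProbabilityMeasure_updateLaw hp
  have : IsProbabilityMeasure (runLaw R T₀ t) := by unfold runLaw; infer_instance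
  have key : ∀ U ∈ C, ∀ V ∈ C, (runLaw R T₀ t).real {ω | run t ω U ∈ A} ≤
      (runLaw R T₀ t).real {ω | run t ω V ∈ A} +
        (runLaw R T₀ t).real (notCoalesced R T₀ C t) := by
    intro U hU V hV
    refine (measureReal_mono (fun ω hω => ?_)).trans (measureReal_union_le _ _)
    by_cases h : run t ω U = run t ω V
    · exact Or.inl (show run t ω V ∈ A from h ▸ hω)
    · exact Or.inr ⟨U, hU, V, hV, h⟩
  rw [abs_le]
  constructor
  · linarith [key T hT S hS]
  · linarith [key S hS T hT]

/-- The leading constant is `(2 / π ^ 2) * (2 * ℓ ^ 2) * (2 * ℓ) ^ 2 * (3 * log ℓ)`. As `ℓ → ∞` with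
`ε` fixed, the cosine bound alone suffices. -/
theorem coalescence_hexagon {δ ε : ℝ} (hδ : 0 < δ) (hε : 0 < ε) : ∃ L : ℕ, ∀ ℓ : ℕ, L ≤ ℓ →
    0 < ℓ ∧ ∀ t : ℕ, (48 / Real.pi ^ 2 + δ) * (ℓ : ℝ) ^ 4 * Real.log (ℓ : ℝ) ≤ (t : ℝ) →
      ∀ T₀ : Config, IsTiling (hexagon ℓ) T₀ →
        (runLaw (hexagon ℓ) T₀ t).real
          (notCoalesced (hexagon ℓ) T₀ {T | IsTiling (hexagon ℓ) T} t) ≤ ε := by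
  have hπ := Real.pi_pos
  -- Chosen so that `48 / π ^ 2 + δ = 16 * (3 + d) / π ^ 2`; the `η` below satisfies `(1 - η) * (3 +
  -- d) = 3 + d / 2`.
  obtain ⟨d, hd⟩ : ∃ d, d = δ * Real.pi ^ 2 / 16 := ⟨_, rfl⟩
  have hd0 : 0 < d := by rw [hd]; positivity
  obtain ⟨K, hK1, W, hcore⟩ := exists_notCoalesced_le_exp (η := d / (6 + 2 * d)) (by positivity)
    (by rw [div_lt_one (by positivity)]; linarith)
  -- The last term ensures `ℓ ^ (d / 2) ≥ 4 * K / ε`, so the surplus `d / 2` in the exponent absorbs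
  -- the constants.
  refine ⟨W + 1 + ⌈Real.exp (2 / d * Real.log (4 * K / ε))⌉₊, fun ℓ hℓ =>
    ⟨by omega, fun t ht T₀ hT₀ => ?_⟩⟩
  have hℓ0 : 0 < ℓ := by omega
  have hℓR : (1 : ℝ) ≤ ℓ := by exact_mod_cast hℓ0
  have hlog0 : 0 ≤ Real.log ℓ := Real.log_nonneg hℓR
  have hlog : 2 / d * Real.log (4 * K / ε) ≤ Real.log ℓ := by
    rw [Real.le_log_iff_exp_le (by linarith)]
    exact (Nat.le_ceil _).trans (by exact_mod_cast (Nat.le_add_left _ _).trans hℓ)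
  obtain ⟨top, htop, hmax⟩ := exists_top hT₀
  obtain ⟨bot, hbot, hmin⟩ := exists_bot hT₀
  have hall : ∀ T ∈ Space (hexagon ℓ) T₀, Below (hexagon ℓ) bot T ∧ Below (hexagon ℓ) T top :=
    fun T hT => ⟨hmin T hT, hmax T hT⟩
  have hcore := hcore _ T₀ hT₀ bot hbot top htop hall 0 (2 * ℓ) (by omega) (fun q hq => by
    obtain ⟨hs, h0, hL⟩ := mem_sites.1 hq
    rw [hT₀.hexagon_length hs] at hL
    have := (mem_starts_hexagon.1 hs).1
    simp only [col]
    push_cast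
    omega) t
  rw [space_hexagon hT₀] at hcore
  refine hcore.trans ?_
  have hG := potential_hexagon_sub_le hT₀ hbot.1 htop.1
  have hp0 : (0 : ℝ) < (sites (hexagon ℓ) T₀).card := by
    exact_mod_cast (sites_hexagon_nonempty hℓ0 hT₀).card_pos
  have hp : ((sites (hexagon ℓ) T₀).card : ℝ) ≤ 2 * ℓ ^ 2 := by
    exact_mod_cast card_sites_hexagon_le hT₀
  generalize ((sites (hexagon ℓ) T₀).card : ℝ) = p at *
  obtain ⟨c, hc⟩ : ∃ c, c = (1 - d / (6 + 2 * d)) * (Real.pi ^ 2 / (2 * ((2 * ℓ : ℕ) : ℝ) ^ 2)) :=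
    ⟨_, rfl⟩
  rw [← hc]
  have hc0 : 0 ≤ c := by
    rw [hc]
    refine mul_nonneg ?_ (by positivity)
    rw [sub_nonneg, div_le_one (by positivity)]
    linarith
  have h1 : (3 + d / 2) * Real.log ℓ ≤ c * t / p := by
    rw [le_div_iff₀ hp0]
    calc (3 + d / 2) * Real.log ℓ * p ≤ (3 + d / 2) * Real.log ℓ * (2 * ℓ ^ 2) := by gcongr
      _ = c * ((48 / Real.pi ^ 2 + δ) * (ℓ : ℝ) ^ 4 * Real.log (ℓ : ℝ)) := by
        have : δ = 16 * d / Real.pi ^ 2 := by rw [hd]; field_simp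
        rw [hc, this]
        push_cast
        field_simp
        ring
      _ ≤ c * t := mul_le_mul_of_nonneg_left ht hc0
  have h2 : Real.log (4 * K / ε) ≤ d / 2 * Real.log ℓ := by
    have := mul_le_mul_of_nonneg_left hlog (show 0 ≤ d / 2 by positivity)
    have e : d / 2 * (2 / d * Real.log (4 * K / ε)) = Real.log (4 * K / ε) := by field_simp
    rwa [e] at this
  have h3 : 4 * K / ε ≤ Real.exp (d / 2 * Real.log ℓ) := by
    rwa [← Real.log_le_iff_le_exp (by positivity)]
  have h4 : Real.exp (3 * Real.log ℓ) = (ℓ : ℝ) ^ 3 := by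
    rw [show (3 : ℝ) * Real.log ℓ = ((3 : ℕ) : ℝ) * Real.log ℓ by norm_num, Real.exp_nat_mul,
      Real.exp_log (by linarith)]
  have h5 : Real.exp (-((3 + d / 2) * Real.log ℓ)) =
      1 / ((ℓ : ℝ) ^ 3 * Real.exp (d / 2 * Real.log ℓ)) := by
    rw [← h4, ← Real.exp_add, Real.exp_neg, one_div]
    congr 2
    ring
  calc K * (potential (hexagon ℓ) T₀ 1 top - potential (hexagon ℓ) T₀ 1 bot) *
        Real.exp (-(c * t / p)) ≤ K * (4 * (ℓ : ℝ) ^ 3) *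
          Real.exp (-((3 + d / 2) * Real.log ℓ)) :=
        mul_le_mul (mul_le_mul_of_nonneg_left hG (by linarith))
          (Real.exp_le_exp.2 (neg_le_neg h1)) (Real.exp_pos _).le (by positivity)
    _ = 4 * K / Real.exp (d / 2 * Real.log ℓ) := by
        rw [h5]
        field_simp
    _ ≤ ε := by
        rw [div_le_iff₀ (Real.exp_pos _), mul_comm ε, ← div_le_iff₀ hε]
        exact h3

end Hexagon

end Lozenges

theorem theorem5p1 :
    (∀ δ : ℝ, 0 < δ → ∃ W : ℕ, ∀ (R : Lozenges.Region) (T₀ : Lozenges.Config),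
      Lozenges.IsTiling R T₀ → W ≤ Lozenges.width R →
      ∃ bot ∈ Lozenges.component R T₀, ∃ top ∈ Lozenges.component R T₀,
        (∀ T ∈ Lozenges.component R T₀, Lozenges.Below R bot T ∧ Lozenges.Below R T top) ∧
        ∀ ε : ℝ, 0 < ε → ∀ t : ℕ,
          (2 + δ) / Real.pi ^ 2 * ((Lozenges.sites R T₀).card : ℝ) * (Lozenges.width R : ℝ) ^ 2 *
              Real.log (((Lozenges.moveGraph R).dist bot top : ℝ) / ε) ≤ (t : ℝ) →
            (Lozenges.runLaw R T₀ t).real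
              (Lozenges.notCoalesced R T₀ (Lozenges.component R T₀) t) ≤ ε) ∧
    (∀ δ : ℝ, 0 < δ → ∀ ε : ℝ, 0 < ε → ∃ L : ℕ, ∀ ℓ : ℕ, L ≤ ℓ → ∀ t : ℕ,
      (48 / Real.pi ^ 2 + δ) * (ℓ : ℝ) ^ 4 * Real.log (ℓ : ℝ) ≤ (t : ℝ) →
      ∀ T₀ : Lozenges.Config, Lozenges.IsTiling (Lozenges.hexagon ℓ) T₀ →
        (Lozenges.runLaw (Lozenges.hexagon ℓ) T₀ t).real
            (Lozenges.notCoalesced (Lozenges.hexagon ℓ) T₀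
              {T | Lozenges.IsTiling (Lozenges.hexagon ℓ) T} t) ≤ ε ∧
        ∀ S T : Lozenges.Config, Lozenges.IsTiling (Lozenges.hexagon ℓ) S →
          Lozenges.IsTiling (Lozenges.hexagon ℓ) T → ∀ A : Set Lozenges.Config,
            |(Lozenges.runLaw (Lozenges.hexagon ℓ) T₀ t).real {ω | Lozenges.run t ω S ∈ A} -
              (Lozenges.runLaw (Lozenges.hexagon ℓ) T₀ t).real {ω | Lozenges.run t ω T ∈ A}|
                ≤ ε) := by
  refine ⟨fun δ hδ => Lozenges.coalescence_component hδ, fun δ hδ ε hε => ?_⟩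
  obtain ⟨L, hL⟩ := Lozenges.coalescence_hexagon hδ hε
  refine ⟨L, fun ℓ hℓ t ht T₀ hT₀ => ?_⟩
  obtain ⟨h0, h⟩ := hL ℓ hℓ
  refine ⟨h t ht T₀ hT₀, fun S T hS hT A => ?_⟩
  exact (Lozenges.abs_run_sub_le (Lozenges.sites_hexagon_nonempty h0 hT₀)
    (C := {T | Lozenges.IsTiling (Lozenges.hexagon ℓ) T}) hS hT t A).trans (h t ht T₀ hT₀)
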